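/- Let $p$ be a prime, $P$ a finite $p$-group and $\mathbb Z_{(p)}$ the localization of $\mathbb Z$ at $p$; for a $\mathbb Z$-module $M$ write $M_{(p)}=\mathbb Z_{(p)}\otimes_{\mathbb Z}M$. A *divisible $P$-category* $\mathcal F$ is a subcategory of the category of finite groups whose objects are the subgroups of $P$, whose morphisms are injective group homomorphisms, which contains all the homomorphisms between subgroups of $P$ induced by conjugation by elements of $P$, and such that a group homomorphism $\theta\colon R\to Q$ between subgroups of $P$ is an $\mathcal F$-morphism whenever $\varphi$ and $\varphi\circ\theta$ are $\mathcal F$-morphisms for some $\varphi\colon Q\to T$. Write $\mathcal F(P,Q)$ for the set of $\mathcal F$-morphisms $Q\to P$, $\mathcal F(Q)$ for the group of $\mathcal F$-automorphisms of $Q$, and $\mathcal F_P(Q)\subseteq\mathcal F(Q)$ for the subgroup of those induced by conjugation by elements of $N_P(Q)$. $\mathcal F$ is a *Frobenius $P$-category* if $\mathcal F_P(P)$ is a Sylow $p$-subgroup of $\mathcal F(P)$ and if any $\varphi\in\mathcal F(P,Q)$ that satisfies $\zeta\big(C_P(\varphi(Q))\big)=C_P\big(\zeta(\varphi(Q))\big)$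 for all $\mathcal F$-morphisms $\zeta\colon\varphi(Q)\,C_P(\varphi(Q))\to P$ extends to an $\mathcal F$-morphism to $P$ from the group of all $x\in N_P(Q)$ for which there is $y\in N_P(\varphi(Q))$ with $\varphi(xux^{-1})=y\varphi(u)y^{-1}$ for all $u\in Q$. Let $\mathcal B_P$ be the Burnside algebra of $P$ (the free $\mathbb Z$-module over the isomorphism classes of transitive finite $P$-sets, with product induced by the direct product with diagonal action; its unit $1$ is the class of the one-point $P$-set). For finite groups $G,H$, a finite $G\times H$-set $\Omega$ and a finite $H$-set $X$, let $\Omega\times_HX$ be the $G$-set of orbits of $H$ on $\Omega\times X$ under $u\cdot(\omega,x)=((1,u)\omega,ux)$; similarly $\Omega\times_H\Omega'$ is a $G\times K$-set if $\Omega'$ is an $H\times K$-set. Let $\mathcal B_{P\times P}$ be the double Burnside algebra (the free $\mathbb Z$-module over the isomorphism classes of transitive finite $P\times P$-sets, with product induced by $\Omega\times_P\Omega'$); it acts on $\mathcal B_P$ via $\Omega\times_PX$. Let $f\mapsto f^\circ$ be the map on $\mathcal B_{P\times P}$ induced by exchanging the two factors of $P\times P$, and let $m^P\colon\mathcal B_P\to\mathcal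 B_{P\times P}$ be the homomorphism sending the class of a $P$-set $X$ to the class $m_X$ of the $P\times P$-set $X\times P$ with $(a,b)(x,v)=(ax,avb^{-1})$, which acts on $\mathcal B_P$ as multiplication by $X$. For a homomorphism $\varphi\colon Q\to P$ let $\mathrm{res}_\varphi$ be the class of the $Q\times P$-set $P$ with $(q,u)v=\varphi(q)vu^{-1}$. For a divisible $P$-category $\mathcal F$, the *Hecke algebra* $\mathcal H=\mathcal H_{\mathcal F}$ is the $\mathbb Z$-subalgebra of $\mathcal B_{P\times P}$ spanned by the classes of $(P\times P)/\{(\varphi(u),u)\mid u\in Q\}$, where $Q\le P$ and $\varphi\in\mathcal F(P,Q)$; it contains $m^P(\mathcal B_P)$. Let $v_{\mathcal H}\colon\mathcal H\to\mathcal B_P$, $f\mapsto f(1)$, be the evaluation, let $\mathcal K_{\mathcal H}=\ker v_{\mathcal H}$, and, with $\iota_Q^P$ the inclusion of $Q$ in $P$, set $$(\mathcal B_P)^{\mathcal F}=\{s\in\mathcal B_P\mid \mathrm{res}_\varphi(s)=\mathrm{res}_{\iota_Q^P}(s)\ \text{for all } Q\le P,\ \varphi\in\mathcal F(P,Q)\},$$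 $$\mathcal H^{\mathcal F}=\{f\in\mathcal H\mid \mathrm{res}_\varphi\cdot f=\mathrm{res}_{\iota_Q^P}\cdot f,\ \mathrm{res}_\varphi\cdot f^\circ=\mathrm{res}_{\iota_Q^P}\cdot f^\circ\ \text{for all } Q\le P,\ \varphi\in\mathcal F(P,Q)\}.$$ **Theorem.** Let $\mathcal F$ be a Frobenius $P$-category with Hecke algebra $\mathcal H$. Then: 1. $(\mathcal K_{\mathcal H}+\mathcal H^{\mathcal F})_{(p)}$ is a unitary $\mathbb Z_{(p)}$-subalgebra of $\mathcal H_{(p)}$, and it contains $m^P\big((\mathcal B_P)^{\mathcal F}\big)$. 2. $(\mathcal K_{\mathcal H})_{(p)}$ is a left ideal of $\mathcal H_{(p)}$, $\mathcal H^{\mathcal F}_{(p)}$ is closed under multiplication, and addition $(k,f)\mapsto k+f$ is an isomorphism $(\mathcal K_{\mathcal H})_{(p)}\rtimes\mathcal H^{\mathcal F}_{(p)}\cong(\mathcal K_{\mathcal H}+\mathcal H^{\mathcal F})_{(p)}$ of $\mathbb Z_{(p)}$-algebras, where $\rtimes$ denotes the direct product of $\mathbb Z_{(p)}$-modules with the product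 $(k,f)(k',f')=(kk'+fk',ff')$. 3. Every element of $\mathcal H^{\mathcal F}$ commutes with every element of $m^P\big((\mathcal B_P)^{\mathcal F}\big)$. 4. $(\mathcal B_P)^{\mathcal F}_{(p)}$ is a unitary subalgebra of $(\mathcal B_P)_{(p)}$, and $v_{\mathcal H}$ induces a $\mathbb Z_{(p)}$-algebra isomorphism $\mathcal H^{\mathcal F}_{(p)}\cong(\mathcal B_P)^{\mathcal F}_{(p)}$. -/

import Mathlib

open scoped TensorProduct

universe u v

noncomputable section

/-- Isomorphisms of `G`-sets. -/
structure GEquiv (G X Y : Type*) [SMul G X] [SMul G Y] extends X ≃ Y where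
  map_smul' : ∀ (g : G) (x : X), toFun (g • x) = g • toFun x

namespace GEquiv

variable {G X Y Z : Type*} [Group G] [MulAction G X] [MulAction G Y] [MulAction G Z]

theorem map_smul (e : GEquiv G X Y) (g : G) (x : X) : e.toEquiv (g • x) = g • e.toEquiv x :=
  e.map_smul' g x

def refl : GEquiv G X X := ⟨Equiv.refl X, fun _ _ => rfl⟩

def symm (e : GEquiv G X Y) : GEquiv G Y X :=
  ⟨e.toEquiv.symm, fun g y => by
    apply e.toEquiv.injective
    change e.toEquiv (e.toEquiv.symm _) = e.toEquiv (g • e.toEquiv.symm y)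
    rw [e.map_smul]; simp⟩

def trans (e : GEquiv G X Y) (f : GEquiv G Y Z) : GEquiv G X Z :=
  ⟨e.toEquiv.trans f.toEquiv, fun g x => by
    change f.toEquiv (e.toEquiv (g • x)) = g • f.toEquiv (e.toEquiv x)
    rw [e.map_smul, f.map_smul]⟩

end GEquiv

/-- Two subgroups `K`, `L` of `G` are related when the indecomposable `G`-sets `G ⧸ K` and
`G ⧸ L` are isomorphic. -/
def indecSetoid (G : Type u) [Group G] : Setoid (Subgroup G) where
  r K L := Nonempty (GEquiv G (G ⧸ K) (G ⧸ L))
  iseqv := ⟨fun _ => ⟨.refl⟩, fun ⟨e⟩ => ⟨e.symm⟩, fun ⟨e⟩ ⟨f⟩ => ⟨e.trans f⟩⟩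

/-- Isomorphism classes of indecomposable (that is, transitive) `G`-sets; every such `G`-set is
isomorphic to some `G ⧸ K`. -/
abbrev IndecClass (G : Type u) [Group G] : Type u := Quotient (indecSetoid G)

/-- The free `ℤ`-module over the isomorphism classes of indecomposable `G`-sets. -/
def Burn (G : Type u) [Group G] : Type u := IndecClass G →₀ ℤ

namespace Burn

section Basic

variable {G : Type u} [Group G]

instance : AddCommGroup (Burn G) := inferInstanceAs (AddCommGroup (IndecClass G →₀ ℤ))

/-- The basis element given by an isomorphism class of indecomposable `G`-sets. -/
def basisElt (q : IndecClass G) : Burn G := Finsupp.single q 1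

/-- The element of `Burn G` determined by a finite `G`-set `X`: the sum over the orbits of `X` of
the isomorphism class of the orbit, an orbit `G • x` being isomorphic to `G ⧸ stabilizer G x`. -/
def cls (G : Type u) [Group G] (X : Type u) [MulAction G X] : Burn G :=
  ∑ᶠ ω : MulAction.orbitRel.Quotient G X,
    basisElt (Quotient.mk (indecSetoid G) (MulAction.stabilizer G (Quotient.out ω)))

/-- Linear extension to `Burn G` of a function `c` on the indecomposable `G`-sets `G ⧸ K`. -/
def ext1 {M : Type*} [AddCommGroup M] (c : Subgroup G → M) : Burn G →ₗ[ℤ] M :=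
  Finsupp.linearCombination ℤ (fun q : IndecClass G => c (Quotient.out q))

theorem ext1_basisElt {M : Type*} [AddCommGroup M] (c : Subgroup G → M) (q : IndecClass G) :
    ext1 c (basisElt q) = c (Quotient.out q) := by
  unfold ext1 basisElt
  erw [Finsupp.linearCombination_single]
  simp

theorem hom_ext {M : Type*} [AddCommGroup M] {φ ψ : Burn G →ₗ[ℤ] M}
    (h : ∀ q, φ (basisElt q) = ψ (basisElt q)) : φ = ψ :=
  Finsupp.lhom_ext' fun q => LinearMap.ext_ring (h q)

/-- Any point of an orbit gives an isomorphism with the quotient by its stabilizer; so the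
isomorphism class of the quotient depends on the orbit only. -/
theorem mk_stabilizer_smul {X : Type u} [MulAction G X] (g : G) (x : X) :
    Quotient.mk (indecSetoid G) (MulAction.stabilizer G (g • x)) =
      Quotient.mk (indecSetoid G) (MulAction.stabilizer G x) := by
  apply Quotient.sound
  have key : ∀ y : X, Nonempty (GEquiv G (MulAction.orbit G y) (G ⧸ MulAction.stabilizer G y)) := by
    intro y
    refine ⟨GEquiv.symm ⟨(MulAction.orbitEquivQuotientStabilizer G y).symm, ?_⟩⟩
    intro a b
    induction b using Quotient.inductionOn'
    rename_i b
    apply Subtype.ext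
    change (MulAction.orbitEquivQuotientStabilizer G y).symm
      (((a * b : G) : G ⧸ MulAction.stabilizer G y)) = a • (((MulAction.orbitEquivQuotientStabilizer G y).symm (b : G ⧸ MulAction.stabilizer G y)) : X)
    simp only [MulAction.orbitEquivQuotientStabilizer_symm_apply, mul_smul]
  obtain ⟨e₁⟩ := key (g • x)
  obtain ⟨e₂⟩ := key x
  have ho : MulAction.orbit G (g • x) = MulAction.orbit G x := MulAction.orbit_smul g x
  refine ⟨e₁.symm.trans (GEquiv.trans ⟨Equiv.setCongr ho, ?_⟩ e₂)⟩
  intro a b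
  rfl

theorem mk_stabilizer_out {X : Type u} [MulAction G X] (x : X) :
    Quotient.mk (indecSetoid G) (MulAction.stabilizer G
      (Quotient.out (Quotient.mk (MulAction.orbitRel G X) x))) =
      Quotient.mk (indecSetoid G) (MulAction.stabilizer G x) := by
  have h := Quotient.mk_out (s := MulAction.orbitRel G X) x
  obtain ⟨g, hg⟩ := h
  rw [← hg]
  exact mk_stabilizer_smul g x

theorem cls_congr {X Y : Type u} [MulAction G X] [MulAction G Y] (e : GEquiv G X Y) :
    cls G X = cls G Y := by
  unfold cls
  let f : MulAction.orbitRel.Quotient G X ≃ MulAction.orbitRel.Quotient G Y :=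
    Quotient.congr e.toEquiv (by
      intro a b
      constructor
      · rintro ⟨g, hg⟩
        exact ⟨g, by change g • e.toEquiv b = _; rw [← e.map_smul]; exact congrArg _ hg⟩
      · rintro ⟨g, hg⟩
        refine ⟨g, e.toEquiv.injective ?_⟩
        change e.toEquiv (g • b) = _
        rw [e.map_smul]; exact hg)
  refine finsum_eq_of_bijective f f.bijective ?_
  intro ω
  induction ω using Quotient.inductionOn
  rename_i x
  congr 1
  change _ = Quotient.mk (indecSetoid G) (MulAction.stabilizer G
      (Quotient.out (Quotient.mk (MulAction.orbitRel G Y) (e.toEquiv x))))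
  rw [mk_stabilizer_out, mk_stabilizer_out]
  congr 1
  ext g
  simp only [MulAction.mem_stabilizer_iff]
  rw [← e.map_smul, e.toEquiv.injective.eq_iff]

theorem cls_sigma {ι : Type u} [Fintype ι] {X : ι → Type u} [∀ i, MulAction G (X i)]
    [∀ i, Finite (X i)] : cls G (Σ i, X i) = ∑ i, cls G (X i) := by
  classical
  let f : (Σ i, MulAction.orbitRel.Quotient G (X i)) → MulAction.orbitRel.Quotient G (Σ i, X i) :=
    fun a => Quotient.map' (s₁ := MulAction.orbitRel G (X a.1)) (fun x => ⟨a.1, x⟩) (by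
      rintro x y ⟨g, hg⟩
      exact ⟨g, by simp only [Sigma.smul_mk]; exact congrArg _ hg⟩) a.2
  have hf : Function.Bijective f := by
    constructor
    · rintro ⟨i, x⟩ ⟨j, y⟩ h
      induction x using Quotient.inductionOn
      induction y using Quotient.inductionOn
      rename_i x y
      obtain ⟨g, hg⟩ := Quotient.exact h
      simp only [Sigma.smul_mk] at hg
      obtain ⟨rfl, hg⟩ := Sigma.mk.inj hg
      have hg := eq_of_heq hg
      congr 1
      exact Quotient.sound ⟨g, hg⟩
    · intro ω
      induction ω using Quotient.inductionOn
      rename_i x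
      exact ⟨⟨x.1, Quotient.mk _ x.2⟩, rfl⟩
  unfold cls
  rw [← finsum_eq_of_bijective f hf (f := fun a => basisElt (Quotient.mk (indecSetoid G)
    (MulAction.stabilizer G (Quotient.out a.2))))]
  · have : ∀ i, Finite (MulAction.orbitRel.Quotient G (X i)) := fun i => Quotient.finite _
    let : ∀ i, Fintype (MulAction.orbitRel.Quotient G (X i)) := fun i => Fintype.ofFinite _
    rw [finsum_eq_sum_of_fintype, Fintype.sum_sigma]
    simp only [finsum_eq_sum_of_fintype]
  · rintro ⟨i, x⟩
    induction x using Quotient.inductionOn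
    rename_i x
    congr 1
    change _ = Quotient.mk (indecSetoid G) (MulAction.stabilizer G
      (Quotient.out (Quotient.mk (MulAction.orbitRel G (Σ i, X i)) ⟨i, x⟩)))
    rw [mk_stabilizer_out, mk_stabilizer_out]
    congr 1
    ext g
    simp [MulAction.mem_stabilizer_iff, Sigma.smul_mk]

theorem cls_quotient (K : Subgroup G) :
    cls G (G ⧸ K) = basisElt (Quotient.mk (indecSetoid G) K) := by
  unfold cls
  have hs : ∀ ω : MulAction.orbitRel.Quotient G (G ⧸ K),
      ω = Quotient.mk (MulAction.orbitRel G (G ⧸ K)) ((1 : G) : G ⧸ K) := by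
    intro ω
    induction ω using Quotient.inductionOn
    rename_i x
    apply Quotient.sound
    exact MulAction.exists_smul_eq G _ _
  rw [finsum_eq_single _ (Quotient.mk (MulAction.orbitRel G (G ⧸ K)) ((1 : G) : G ⧸ K))
    (fun ω hω => absurd (hs ω) hω)]
  rw [mk_stabilizer_out, MulAction.stabilizer_quotient]

theorem cls_out (q : IndecClass G) : cls G (G ⧸ Quotient.out q) = basisElt q := by
  rw [cls_quotient]; congr 1; exact Quotient.out_eq q

/-- A finite `G`-set is the disjoint union of its orbits. -/
def sigmaOrbits (X : Type u) [MulAction G X] : GEquiv G X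
    (Σ ω : MulAction.orbitRel.Quotient G X, G ⧸ MulAction.stabilizer G (Quotient.out ω)) :=
  GEquiv.symm ⟨Equiv.ofBijective
    (fun a => MulAction.ofQuotientStabilizer G (Quotient.out a.1) a.2) (by
      constructor
      · rintro ⟨ω, y⟩ ⟨ω', y'⟩ h
        induction y using Quotient.inductionOn'
        induction y' using Quotient.inductionOn'
        rename_i y y'
        change y • Quotient.out ω = y' • Quotient.out ω' at h
        have hω : ω = ω' := by
          rw [← Quotient.out_eq ω, ← Quotient.out_eq ω']
          refine Quotient.sound ⟨y⁻¹ * y', ?_⟩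
          change (y⁻¹ * y') • Quotient.out ω' = _
          rw [mul_smul, ← h, inv_smul_smul]
        subst hω
        congr 1
        exact MulAction.injective_ofQuotientStabilizer G (Quotient.out ω) h
      · intro x
        obtain ⟨g, hg⟩ := (MulAction.orbitRel G X).symm
          (Quotient.mk_out (s := MulAction.orbitRel G X) x)
        exact ⟨⟨Quotient.mk _ x, QuotientGroup.mk g⟩, hg⟩), by
    rintro g ⟨ω, y⟩
    exact MulAction.ofQuotientStabilizer_smul G _ g y⟩

theorem ext1_cls [Finite G] {M : Type*} [AddCommGroup M]
    (c : ∀ (X : Type u) [MulAction G X], M)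
    (hiso : ∀ (X Y : Type u) [MulAction G X] [MulAction G Y], GEquiv G X Y → c X = c Y)
    (hsigma : ∀ (ι : Type u) [Fintype ι] (X : ι → Type u) [∀ i, MulAction G (X i)]
      [∀ i, Finite (X i)], c (Σ i, X i) = ∑ i, c (X i))
    (X : Type u) [MulAction G X] [Finite X] :
    ext1 (fun K => c (G ⧸ K)) (cls G X) = c X := by
  have : Finite (MulAction.orbitRel.Quotient G X) := Quotient.finite _
  let : Fintype (MulAction.orbitRel.Quotient G X) := Fintype.ofFinite _
  rw [hiso _ _ (sigmaOrbits X), hsigma, cls, finsum_eq_sum_of_fintype, map_sum]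
  refine Finset.sum_congr rfl fun ω _ => ?_
  rw [ext1_basisElt]
  obtain ⟨e⟩ : (indecSetoid G).r _ _ := Quotient.mk_out (s := indecSetoid G) (MulAction.stabilizer G (Quotient.out ω))
  exact hiso _ _ e

end Basic

section Product

variable {G : Type u} [Group G]

/-- Bilinear extension of a function on pairs of indecomposable sets. -/
def ext2 {H : Type u} [Group H] {M : Type*} [AddCommGroup M] (c : Subgroup G → Subgroup H → M) :
    Burn G →ₗ[ℤ] Burn H →ₗ[ℤ] M :=
  ext1 fun K => ext1 fun L => c K L

theorem ext2_basisElt {H : Type u} [Group H] {M : Type*} [AddCommGroup M]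
    (c : Subgroup G → Subgroup H → M) (q : IndecClass G) (r : IndecClass H) :
    ext2 c (basisElt q) (basisElt r) = c (Quotient.out q) (Quotient.out r) := by
  rw [ext2, ext1_basisElt, ext1_basisElt]

theorem ext2_cls [Finite G] {H : Type u} [Group H] [Finite H] {M : Type*} [AddCommGroup M]
    (c : ∀ (X Y : Type u) [MulAction G X] [MulAction H Y], M)
    (hiso : ∀ (X X' Y Y' : Type u) [MulAction G X] [MulAction G X'] [MulAction H Y]
      [MulAction H Y'], GEquiv G X X' → GEquiv H Y Y' → c X Y = c X' Y')
    (hsigma : ∀ (ι : Type u) [Fintype ι] (X : ι → Type u) [∀ i, MulAction G (X i)]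
      [∀ i, Finite (X i)] (Y : Type u) [MulAction H Y] [Finite Y],
        c (Σ i, X i) Y = ∑ i, c (X i) Y)
    (hsigma' : ∀ (ι : Type u) [Fintype ι] (X : Type u) [MulAction G X] [Finite X]
      (Y : ι → Type u) [∀ i, MulAction H (Y i)] [∀ i, Finite (Y i)],
        c X (Σ i, Y i) = ∑ i, c X (Y i))
    (X Y : Type u) [MulAction G X] [Finite X] [MulAction H Y] [Finite Y] :
    ext2 (fun K L => c (G ⧸ K) (H ⧸ L)) (cls G X) (cls H Y) = c X Y := by
  have h1 : ∀ K : Subgroup G, ext1 (fun L => c (G ⧸ K) (H ⧸ L)) (cls H Y) = c (G ⧸ K) Y :=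
    fun K => ext1_cls (fun Y _ => c (G ⧸ K) Y) (fun Y Y' _ _ e => hiso _ _ _ _ .refl e)
      (fun ι _ Y _ _ => hsigma' ι _ Y) Y
  have h2 : (LinearMap.flip (ext2 (fun K L => c (G ⧸ K) (H ⧸ L)))) (cls H Y) =
      ext1 (fun K => c (G ⧸ K) Y) := by
    refine hom_ext fun q => ?_
    rw [LinearMap.flip_apply, ext2, ext1_basisElt, ext1_basisElt, h1]
  have h3 := LinearMap.congr_fun h2 (cls G X)
  rw [LinearMap.flip_apply] at h3
  rw [h3]
  exact ext1_cls (fun X _ => c X Y) (fun X X' _ _ e => hiso _ _ _ _ e .refl)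
      (fun ι _ X _ _ => hsigma ι X Y) X

/-- The product of `Burn G`, induced by the inner direct product `X × Y` of `G`-sets (with the
diagonal action). -/
instance : Mul (Burn G) :=
  ⟨fun a b => ext2 (fun K L => cls G ((G ⧸ K) × (G ⧸ L))) a b⟩

/-- The unit is the isomorphism class of the trivial `G`-set. -/
instance : One (Burn G) := ⟨basisElt (Quotient.mk (indecSetoid G) ⊤)⟩

theorem mul_def (a b : Burn G) :
    a * b = ext2 (fun K L => cls G ((G ⧸ K) × (G ⧸ L))) a b := rfl

theorem cls_mul_cls [Finite G] (X Y : Type u) [MulAction G X] [Finite X] [MulAction G Y]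
    [Finite Y] : cls G X * cls G Y = cls G (X × Y) := by
  have h := ext2_cls (G := G) (H := G) (M := Burn G)
    (fun X Y [MulAction G X] [MulAction G Y] => cls G (X × Y)) ?_ ?_ ?_ X Y
  · exact h
  · intro X X' Y Y' _ _ _ _ e f
    exact cls_congr ⟨e.toEquiv.prodCongr f.toEquiv, fun g x =>
      Prod.ext (e.map_smul g x.1) (f.map_smul g x.2)⟩
  · intro ι _ X _ _ Y _ _
    rw [← cls_sigma]
    exact cls_congr ⟨Equiv.sigmaProdDistrib X Y, fun _ _ => rfl⟩
  · intro ι _ X _ _ Y _ _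
    rw [← cls_sigma]
    exact cls_congr ⟨⟨fun a => ⟨a.2.1, a.1, a.2.2⟩, fun a => ⟨a.2.1, a.1, a.2.2⟩,
      fun _ => rfl, fun _ => rfl⟩, fun _ _ => rfl⟩

theorem one_eq (G : Type u) [Group G] : (1 : Burn G) = cls G (G ⧸ (⊤ : Subgroup G)) :=
  (cls_quotient _).symm

theorem induction_on {p : Burn G → Prop} (a : Burn G) (basis : ∀ q, p (basisElt q))
    (zero : p 0) (add : ∀ a b, p a → p b → p (a + b)) (neg : ∀ a, p a → p (-a)) : p a := by
  have h' : ∀ (n : ℤ) (q : IndecClass G), p (n • basisElt q) := by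
    intro n q
    induction n with
    | zero => simpa using zero
    | succ n ih => rw [add_smul, one_smul]; exact add _ _ ih (basis q)
    | pred n ih =>
      rw [sub_smul, one_smul, sub_eq_add_neg]
      exact add _ _ ih (neg _ (basis q))
  have h : ∀ (n : ℤ) (q : IndecClass G), p (Finsupp.single q n : IndecClass G →₀ ℤ) := by
    intro n q
    have key : (Finsupp.single q n : IndecClass G →₀ ℤ) = n • Finsupp.single q 1 := by simp
    rw [key]
    exact h' n q
  induction a using Finsupp.induction_linear with
  | zero => exact zero
  | add f g hf hg => exact add f g hf hg
  | single q n => exact h n q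

theorem burn_mul_comm [Finite G] (a b : Burn G) : a * b = b * a := by
  have h : (ext2 (fun K L => cls G ((G ⧸ K) × (G ⧸ L))) : Burn G →ₗ[ℤ] Burn G →ₗ[ℤ] Burn G) =
      (ext2 (fun K L => cls G ((G ⧸ K) × (G ⧸ L)))).flip := by
    refine hom_ext fun q => hom_ext fun r => ?_
    change basisElt q * basisElt r = basisElt r * basisElt q
    rw [← cls_out q, ← cls_out r, cls_mul_cls, cls_mul_cls]
    exact cls_congr ⟨Equiv.prodComm _ _, fun _ _ => rfl⟩
  exact LinearMap.congr_fun₂ h a b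

theorem burn_add_mul (a b c : Burn G) : (a + b) * c = a * c + b * c := by
  simp only [mul_def, map_add, LinearMap.add_apply]

theorem burn_mul_add (a b c : Burn G) : a * (b + c) = a * b + a * c := by
  simp only [mul_def, map_add]

theorem burn_zero_mul (a : Burn G) : 0 * a = 0 := by
  simp only [mul_def, map_zero, LinearMap.zero_apply]

theorem burn_mul_zero (a : Burn G) : a * 0 = 0 := by
  simp only [mul_def, map_zero]

theorem burn_neg_mul (a b : Burn G) : -a * b = -(a * b) := by
  simp only [mul_def, map_neg, LinearMap.neg_apply]

theorem burn_mul_neg (a b : Burn G) : a * -b = -(a * b) := by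
  simp only [mul_def, map_neg]

theorem burn_mul_assoc [Finite G] (a b c : Burn G) : a * b * c = a * (b * c) := by
  induction a using induction_on with
  | zero => simp only [burn_zero_mul]
  | add a a' h h' => simp only [burn_add_mul, h, h']
  | neg a h => simp only [burn_neg_mul, h]
  | basis q =>
  induction b using induction_on with
  | zero => simp only [burn_zero_mul, burn_mul_zero]
  | add a a' h h' => simp only [burn_add_mul, burn_mul_add, h, h']
  | neg a h => simp only [burn_neg_mul, burn_mul_neg, h]
  | basis r =>
  induction c using induction_on with
  | zero => simp only [burn_mul_zero]
  | add a a' h h' => simp only [burn_mul_add, h, h']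
  | neg a h => simp only [burn_mul_neg, h]
  | basis s =>
  rw [← cls_out q, ← cls_out r, ← cls_out s]
  simp only [cls_mul_cls]
  exact cls_congr ⟨Equiv.prodAssoc _ _ _, fun _ _ => rfl⟩

theorem burn_one_mul [Finite G] (a : Burn G) : 1 * a = a := by
  induction a using induction_on with
  | zero => simp only [burn_mul_zero]
  | add a a' h h' => simp only [burn_mul_add, h, h']
  | neg a h => simp only [burn_mul_neg, h]
  | basis q =>
  rw [← cls_out q, one_eq, cls_mul_cls]
  have : Subsingleton (G ⧸ (⊤ : Subgroup G)) := QuotientGroup.subsingleton_quotient_top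
  exact cls_congr ⟨⟨fun a => a.2, fun x => (((1 : G) : G ⧸ (⊤ : Subgroup G)), x),
    fun a => Prod.ext (Subsingleton.elim _ _) rfl, fun _ => rfl⟩, fun _ _ => rfl⟩

/-- The Burnside algebra of a finite group. -/
instance [Finite G] : CommRing (Burn G) where
  left_distrib := burn_mul_add
  right_distrib := burn_add_mul
  zero_mul := burn_zero_mul
  mul_zero := burn_mul_zero
  mul_assoc := burn_mul_assoc
  one_mul := burn_one_mul
  mul_one a := by rw [burn_mul_comm, burn_one_mul]
  mul_comm := burn_mul_comm
  zsmul := (· • ·)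
  zsmul_zero' := zero_zsmul
  zsmul_succ' n a := SubNegMonoid.zsmul_succ' n a
  zsmul_neg' n a := SubNegMonoid.zsmul_neg' n a
  neg_add_cancel := neg_add_cancel
  nsmul := (· • ·)
  nsmul_zero := zero_nsmul
  nsmul_succ n a := succ_nsmul a n
  sub_eq_add_neg := sub_eq_add_neg

end Product

end Burn

/-! ### Bisets -/

section Amalgamation

variable {A H G₁ G₂ : Type u} [Group A] [Group H] [Group G₁] [Group G₂]
  (α : A × H →* G₁) (β : A × H →* G₂)

/-- Let `A × H` act on `Ω` and on `X` through `α` and `β`. This is the equivalence relation on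
`Ω × X` whose classes are the orbits of `H`. -/
def amalgSetoid (Ω X : Type u) [MulAction G₁ Ω] [MulAction G₂ X] : Setoid (Ω × X) where
  r a b := ∃ u : H, b = (α (1, u) • a.1, β (1, u) • a.2)
  iseqv := by
    refine ⟨fun a => ⟨1, ?_⟩, ?_, ?_⟩
    · have h : ((1 : A), (1 : H)) = 1 := rfl
      simp [h]
    · rintro a _ ⟨u, rfl⟩
      have h : ((1 : A), u⁻¹) * (1, u) = 1 := by simp
      exact ⟨u⁻¹, by simp only [← mul_smul, ← map_mul, h]; simp⟩
    · rintro a _ _ ⟨u, rfl⟩ ⟨v, rfl⟩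
      exact ⟨v * u, by simp only [← mul_smul, ← map_mul]; simp⟩

/-- The set of orbits of `H` on `Ω × X`. -/
def Amalg (Ω X : Type u) [MulAction G₁ Ω] [MulAction G₂ X] : Type u :=
  Quotient (amalgSetoid α β Ω X)

namespace Amalg

variable {α β} {Ω X : Type u} [MulAction G₁ Ω] [MulAction G₂ X]

/-- The orbit of `(ω, x)`. -/
def mk (ω : Ω) (x : X) : Amalg α β Ω X := Quotient.mk (amalgSetoid α β Ω X) (ω, x)

theorem mk_eq_mk {ω ω' : Ω} {x x' : X} : (mk ω x : Amalg α β Ω X) = mk ω' x' ↔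
    ∃ u : H, ω' = α (1, u) • ω ∧ x' = β (1, u) • x := by
  constructor
  · intro h
    obtain ⟨u, hu⟩ := Quotient.exact h
    exact ⟨u, congrArg Prod.fst hu, congrArg Prod.snd hu⟩
  · rintro ⟨u, rfl, rfl⟩
    exact Quotient.sound ⟨u, rfl⟩

theorem ind {p : Amalg α β Ω X → Prop} (h : ∀ ω x, p (mk ω x)) (a : Amalg α β Ω X) : p a :=
  Quotient.inductionOn a fun b => h b.1 b.2

/-- Maps out of the set of orbits. -/
def lift {Y : Type*} (f : Ω → X → Y)
    (hf : ∀ ω x (u : H), f ω x = f (α (1, u) • ω) (β (1, u) • x)) (a : Amalg α β Ω X) : Y :=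
  Quotient.lift (fun b : Ω × X => f b.1 b.2) (by rintro a _ ⟨u, rfl⟩; exact hf _ _ u) a

instance [Finite Ω] [Finite X] : Finite (Amalg α β Ω X) :=
  inferInstanceAs (Finite (Quotient (amalgSetoid α β Ω X)))

/-- The action of `A` on the set of orbits of `H`. -/
instance : MulAction A (Amalg α β Ω X) where
  smul a := lift (fun ω x => mk (α (a, 1) • ω) (β (a, 1) • x)) (by
    intro ω x u
    refine mk_eq_mk.2 ⟨u, ?_, ?_⟩ <;> simp only [← mul_smul, ← map_mul] <;> simp)
  one_smul := ind fun ω x => by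
    change mk (α (1, 1) • ω) (β (1, 1) • x) = _
    have h : ((1 : A), (1 : H)) = 1 := rfl
    simp [h]
  mul_smul a b := ind fun ω x => by
    change mk (α (a * b, 1) • ω) (β (a * b, 1) • x) =
      mk (α (a, 1) • α (b, 1) • ω) (β (a, 1) • β (b, 1) • x)
    simp only [← mul_smul, ← map_mul]; simp

theorem smul_mk (a : A) (ω : Ω) (x : X) :
    a • (mk ω x : Amalg α β Ω X) = mk (α (a, 1) • ω) (β (a, 1) • x) := rfl

/-- Functoriality of the amalgamation for isomorphisms. -/
def congr {Ω' X' : Type u} [MulAction G₁ Ω'] [MulAction G₂ X'] (e : GEquiv G₁ Ω Ω')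
    (f : GEquiv G₂ X X') : GEquiv A (Amalg α β Ω X) (Amalg α β Ω' X') where
  toFun := lift (fun ω x => mk (e.toEquiv ω) (f.toEquiv x)) (by
    intro ω x u
    rw [e.map_smul, f.map_smul]; exact mk_eq_mk.2 ⟨u, rfl, rfl⟩)
  invFun := lift (fun ω x => mk (e.symm.toEquiv ω) (f.symm.toEquiv x)) (by
    intro ω x u
    rw [e.symm.map_smul, f.symm.map_smul]; exact mk_eq_mk.2 ⟨u, rfl, rfl⟩)
  left_inv := ind fun ω x => by
    change mk (e.toEquiv.symm (e.toEquiv ω)) (f.toEquiv.symm (f.toEquiv x)) = _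
    simp
  right_inv := ind fun ω x => by
    change mk (e.toEquiv (e.toEquiv.symm ω)) (f.toEquiv (f.toEquiv.symm x)) = _
    simp
  map_smul' a := ind fun ω x => by
    change mk (e.toEquiv (α (a, 1) • ω)) (f.toEquiv (β (a, 1) • x)) =
      mk (α (a, 1) • e.toEquiv ω) (β (a, 1) • f.toEquiv x)
    rw [e.map_smul, f.map_smul]

/-- Distributivity on the left. -/
def sigmaLeft {ι : Type u} {Ω : ι → Type u} [∀ i, MulAction G₁ (Ω i)] :
    GEquiv A (Amalg α β (Σ i, Ω i) X) (Σ i, Amalg α β (Ω i) X) where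
  toFun := lift (fun ω x => ⟨ω.1, mk ω.2 x⟩) (by
    rintro ⟨i, ω⟩ x u
    simp only [Sigma.smul_mk]
    congr 1
    exact mk_eq_mk.2 ⟨u, rfl, rfl⟩)
  invFun a := lift (fun ω x => mk ⟨a.1, ω⟩ x) (by
    intro ω x u
    exact mk_eq_mk.2 ⟨u, rfl, rfl⟩) a.2
  left_inv := ind fun ω x => rfl
  right_inv := by
    rintro ⟨i, a⟩
    induction a using ind
    rfl
  map_smul' a := ind fun ω x => rfl

/-- Distributivity on the right. -/
def sigmaRight {ι : Type u} {X : ι → Type u} [∀ i, MulAction G₂ (X i)] :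
    GEquiv A (Amalg α β Ω (Σ i, X i)) (Σ i, Amalg α β Ω (X i)) where
  toFun := lift (fun ω x => ⟨x.1, mk ω x.2⟩) (by
    rintro ω ⟨i, x⟩ u
    simp only [Sigma.smul_mk]
    congr 1
    exact mk_eq_mk.2 ⟨u, rfl, rfl⟩)
  invFun a := lift (fun ω x => mk ω ⟨a.1, x⟩) (by
    intro ω x u
    exact mk_eq_mk.2 ⟨u, rfl, rfl⟩) a.2
  left_inv := ind fun ω x => rfl
  right_inv := by
    rintro ⟨i, a⟩
    induction a using ind
    rfl
  map_smul' a := ind fun ω x => rfl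

end Amalg

end Amalgamation

namespace Burn

/-- The bilinear map induced by the amalgamation of sets. -/
def amalg {A H G₁ G₂ : Type u} [Group A] [Group H] [Group G₁] [Group G₂]
    (α : A × H →* G₁) (β : A × H →* G₂) : Burn G₁ →ₗ[ℤ] Burn G₂ →ₗ[ℤ] Burn A :=
  ext2 fun K L => cls A (Amalg α β (G₁ ⧸ K) (G₂ ⧸ L))

theorem amalg_cls {A H G₁ G₂ : Type u} [Group A] [Group H] [Group G₁] [Group G₂]
    [Finite G₁] [Finite G₂] (α : A × H →* G₁) (β : A × H →* G₂) (Ω X : Type u)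
    [MulAction G₁ Ω] [MulAction G₂ X] [Finite Ω] [Finite X] :
    amalg α β (cls G₁ Ω) (cls G₂ X) = cls A (Amalg α β Ω X) := by
  have h := ext2_cls (G := G₁) (H := G₂) (M := Burn A)
    (fun Ω X [MulAction G₁ Ω] [MulAction G₂ X] => cls A (Amalg α β Ω X)) ?_ ?_ ?_ Ω X
  · exact h
  · intro X X' Y Y' _ _ _ _ e f
    exact cls_congr (Amalg.congr e f)
  · intro ι _ X _ _ Y _ _
    rw [← cls_sigma]
    exact cls_congr Amalg.sigmaLeft
  · intro ι _ X _ _ Y _ _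
    rw [← cls_sigma]
    exact cls_congr Amalg.sigmaRight

section Composition

variable {G H K L : Type u} [Group G] [Group H] [Group K] [Group L]

/-- The homomorphism `((g, k), h) ↦ (g, h)`. -/
def outerLeft (G H K : Type u) [Group G] [Group H] [Group K] : (G × K) × H →* G × H where
  toFun a := (a.1.1, a.2)
  map_one' := rfl
  map_mul' _ _ := rfl

/-- The homomorphism `((g, k), h) ↦ (h, k)`. -/
def outerRight (G H K : Type u) [Group G] [Group H] [Group K] : (G × K) × H →* H × K where
  toFun a := (a.2, a.1.2)
  map_one' := rfl
  map_mul' _ _ := rfl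

/-- For a `G × H`-set `Ω` and an `H × K`-set `Ω'`, the `G × K`-set `Ω ×_H Ω'` of the orbits of `H`
on `Ω × Ω'` for the action `u • (ω, ω') = ((1, u) • ω, (u, 1) • ω')`, with
`(g, k) • [ω, ω'] = [(g, 1) • ω, (1, k) • ω']`. -/
abbrev BTensor (G H K : Type u) [Group G] [Group H] [Group K] (Ω Ω' : Type u)
    [MulAction (G × H) Ω] [MulAction (H × K) Ω'] : Type u :=
  Amalg (outerLeft G H K) (outerRight G H K) Ω Ω'

/-- For a `G × H`-set `Ω` and an `H`-set `X`, the `G`-set `Ω ×_H X` of the orbits of `H` on `Ω × X`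
for the action `u • (ω, x) = ((1, u) • ω, u • x)`, with `g • [ω, x] = [(g, 1) • ω, x]`: the image
of `X` under the functor determined by `Ω`. -/
abbrev ATensor (G H : Type u) [Group G] [Group H] (Ω X : Type u)
    [MulAction (G × H) Ω] [MulAction H X] : Type u :=
  Amalg (MonoidHom.id (G × H)) (MonoidHom.snd G H) Ω X

/-- The bilinear map induced by `(Ω, Ω') ↦ Ω ×_H Ω'`, that is, by the composition of the functors
determined by bisets. -/
def comp : Burn (G × H) →ₗ[ℤ] Burn (H × K) →ₗ[ℤ] Burn (G × K) :=
  ext2 fun D E => cls (G × K) (BTensor G H K ((G × H) ⧸ D) ((H × K) ⧸ E))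

/-- The bilinear map induced by `(Ω, X) ↦ Ω ×_H X`: the action of `Burn (G × H)` by functors from
`H`-sets to `G`-sets. -/
def act : Burn (G × H) →ₗ[ℤ] Burn H →ₗ[ℤ] Burn G :=
  ext2 fun D E => cls G (ATensor G H ((G × H) ⧸ D) (H ⧸ E))

theorem comp_cls [Finite G] [Finite H] [Finite K] (Ω Ω' : Type u) [MulAction (G × H) Ω]
    [MulAction (H × K) Ω'] [Finite Ω] [Finite Ω'] :
    comp (cls (G × H) Ω) (cls (H × K) Ω') = cls (G × K) (BTensor G H K Ω Ω') :=
  amalg_cls _ _ Ω Ω'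

theorem act_cls [Finite G] [Finite H] (Ω X : Type u) [MulAction (G × H) Ω]
    [MulAction H X] [Finite Ω] [Finite X] :
    act (cls (G × H) Ω) (cls H X) = cls G (ATensor G H Ω X) :=
  amalg_cls _ _ Ω X

/-- The `G × K`-sets `(Ω ×_H Ω') ×_K Ω''` and `Ω ×_H (Ω' ×_K Ω'')` are isomorphic. -/
def tensorAssoc (Ω Ω' Ω'' : Type u) [MulAction (G × H) Ω] [MulAction (H × K) Ω']
    [MulAction (K × L) Ω''] : GEquiv (G × L) (BTensor G K L (BTensor G H K Ω Ω') Ω'')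
      (BTensor G H L Ω (BTensor H K L Ω' Ω'')) where
  toFun := Amalg.lift (fun a x => Amalg.lift (fun ω ω' => Amalg.mk ω (Amalg.mk ω' x)) (by
      intro ω ω' u
      refine Amalg.mk_eq_mk.2 ⟨u, rfl, ?_⟩
      change Amalg.mk ((u, (1 : K)) • ω') x =
        Amalg.mk ((u, (1 : K)) • ω') ((1 : K × L) • x)
      rw [one_smul]) a) (by
    intro a x u
    induction a using Amalg.ind
    rename_i ω ω'
    change Amalg.mk ω (Amalg.mk ω' x) = Amalg.mk ((1 : G × H) • ω)
      (Amalg.mk (((1 : H), u) • ω') ((u, (1 : L)) • x))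
    rw [one_smul]
    congr 1
    exact Amalg.mk_eq_mk.2 ⟨u, rfl, rfl⟩)
  invFun := Amalg.lift (fun ω a => Amalg.lift (fun ω' x => Amalg.mk (Amalg.mk ω ω') x) (by
      intro ω' x u
      refine Amalg.mk_eq_mk.2 ⟨u, ?_, rfl⟩
      change Amalg.mk ω (((1 : H), u) • ω') =
        Amalg.mk ((1 : G × H) • ω) (((1 : H), u) • ω')
      rw [one_smul]) a) (by
    intro ω a u
    induction a using Amalg.ind
    rename_i ω' x
    change Amalg.mk (Amalg.mk ω ω') x = Amalg.mk (Amalg.mk (((1 : G), u) • ω) ((u, (1 : K)) • ω'))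
      ((1 : K × L) • x)
    rw [one_smul]
    congr 1
    exact Amalg.mk_eq_mk.2 ⟨u, rfl, rfl⟩)
  left_inv := by
    intro a
    induction a using Amalg.ind
    rename_i a x
    induction a using Amalg.ind
    rfl
  right_inv := by
    intro a
    induction a using Amalg.ind
    rename_i x a
    induction a using Amalg.ind
    rfl
  map_smul' g := by
    intro a
    induction a using Amalg.ind
    rename_i a x
    induction a using Amalg.ind
    rfl

theorem comp_assoc [Finite G] [Finite H] [Finite K] [Finite L] (a : Burn (G × H))
    (b : Burn (H × K)) (c : Burn (K × L)) : comp (comp a b) c = comp a (comp b c) := by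
  induction a using induction_on with
  | zero => simp only [map_zero, LinearMap.zero_apply]
  | add a a' h h' => simp only [map_add, LinearMap.add_apply, h, h']
  | neg a h => simp only [map_neg, LinearMap.neg_apply, h]
  | basis q =>
  induction b using induction_on with
  | zero => simp only [map_zero, LinearMap.zero_apply]
  | add a a' h h' => simp only [map_add, LinearMap.add_apply, h, h']
  | neg a h => simp only [map_neg, LinearMap.neg_apply, h]
  | basis r =>
  induction c using induction_on with
  | zero => simp only [map_zero]
  | add a a' h h' => simp only [map_add, h, h']
  | neg a h => simp only [map_neg, h]
  | basis s =>
  rw [← cls_out q, ← cls_out r, ← cls_out s, comp_cls, comp_cls, comp_cls, comp_cls]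
  exact cls_congr (tensorAssoc _ _ _)

end Composition

/-- For a homomorphism `φ : Q → P`, the `Q × P`-set `P` with `(q, u) • v = φ q * v * u⁻¹`; it
determines the restriction functor from `P`-sets to `Q`-sets. -/
@[ext]
structure ResSet {Q P : Type u} [Group Q] [Group P] (φ : Q →* P) : Type u where
  val : P

section ResSet

variable {Q P K : Type u} [Group Q] [Group P] [Group K]

instance (φ : Q →* P) : MulAction (Q × P) (ResSet φ) where
  smul a v := ⟨φ a.1 * v.val * a.2⁻¹⟩
  one_smul v := by ext; change φ 1 * v.val * 1⁻¹ = v.val; simp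
  mul_smul a b v := by
    ext
    change φ (a.1 * b.1) * v.val * (a.2 * b.2)⁻¹ = φ a.1 * (φ b.1 * v.val * b.2⁻¹) * a.2⁻¹
    simp [mul_assoc]

instance [Finite P] (φ : Q →* P) : Finite (ResSet φ) :=
  Finite.of_injective ResSet.val fun _ _ h => ResSet.ext h

theorem resSet_smul (φ : Q →* P) (a : Q × P) (v : ResSet φ) :
    a • v = ⟨φ a.1 * v.val * a.2⁻¹⟩ := rfl

/-- The element `res_φ` determined by the restriction through `φ`. -/
def res (φ : Q →* P) : Burn (Q × P) := cls (Q × P) (ResSet φ)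

/-- The identity functor is a left unit. -/
def idTensor (Ω : Type u) [MulAction (P × K) Ω] :
    GEquiv (P × K) (BTensor P P K (ResSet (MonoidHom.id P)) Ω) Ω where
  toFun := Amalg.lift (fun v ω => (v.val, (1 : K)) • ω) (by
    intro v ω u
    change (v.val, (1 : K)) • ω = ((1 : P) * v.val * u⁻¹, (1 : K)) • ((u, (1 : K)) • ω)
    rw [← mul_smul]; simp)
  invFun ω := Amalg.mk ⟨1⟩ ω
  left_inv := by
    intro a
    induction a using Amalg.ind
    rename_i v ω
    refine Amalg.mk_eq_mk.2 ⟨v.val⁻¹, ?_, ?_⟩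
    · ext
      change v.val = (1 : P) * 1 * (v.val⁻¹)⁻¹
      simp
    · change ω = (v.val⁻¹, (1 : K)) • (v.val, (1 : K)) • ω
      rw [← mul_smul, Prod.mk_mul_mk, inv_mul_cancel, one_mul]
      exact (one_smul (P × K) ω).symm
  right_inv ω := one_smul (P × K) ω
  map_smul' g := by
    intro a
    induction a using Amalg.ind
    rename_i v ω
    change (g.1 * v.val * (1 : P)⁻¹, (1 : K)) • (((1 : P), g.2) • ω) = g • (v.val, (1 : K)) • ω
    rw [← mul_smul, ← mul_smul]
    congr 1
    simp [Prod.ext_iff]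

/-- The identity functor is a right unit. -/
def tensorId (Ω : Type u) [MulAction (K × P) Ω] :
    GEquiv (K × P) (BTensor K P P Ω (ResSet (MonoidHom.id P))) Ω where
  toFun := Amalg.lift (fun ω v => ((1 : K), v.val⁻¹) • ω) (by
    intro ω v u
    change ((1 : K), v.val⁻¹) • ω = ((1 : K), (u * v.val * 1⁻¹)⁻¹) • (((1 : K), u) • ω)
    rw [← mul_smul]; simp)
  invFun ω := Amalg.mk ω ⟨1⟩
  left_inv := by
    intro a
    induction a using Amalg.ind
    rename_i ω v
    refine Amalg.mk_eq_mk.2 ⟨v.val, ?_, ?_⟩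
    · change ω = ((1 : K), v.val) • ((1 : K), v.val⁻¹) • ω
      rw [← mul_smul, Prod.mk_mul_mk, mul_inv_cancel, one_mul]
      exact (one_smul (K × P) ω).symm
    · ext
      change v.val = v.val * 1 * (1 : P)⁻¹
      simp
  right_inv ω := by
    change ((1 : K), (1 : P)⁻¹) • ω = ω
    rw [inv_one]
    exact one_smul (K × P) ω
  map_smul' g := by
    intro a
    induction a using Amalg.ind
    rename_i ω v
    change ((1 : K), (1 * v.val * g.2⁻¹)⁻¹) • ((g.1, (1 : P)) • ω) = g • ((1 : K), v.val⁻¹) • ω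
    rw [← mul_smul, ← mul_smul]
    congr 1
    simp [Prod.ext_iff]

theorem res_id_comp [Finite P] [Finite K] (a : Burn (P × K)) :
    comp (res (MonoidHom.id P)) a = a := by
  induction a using induction_on with
  | zero => simp only [map_zero]
  | add a a' h h' => simp only [map_add, h, h']
  | neg a h => simp only [map_neg, h]
  | basis q =>
  rw [← cls_out q, res, comp_cls]
  exact cls_congr (idTensor _)

theorem comp_res_id [Finite P] [Finite K] (a : Burn (K × P)) :
    comp a (res (MonoidHom.id P)) = a := by
  induction a using induction_on with
  | zero => simp only [map_zero, LinearMap.zero_apply]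
  | add a a' h h' => simp only [map_add, LinearMap.add_apply, h, h']
  | neg a h => simp only [map_neg, LinearMap.neg_apply, h]
  | basis q =>
  rw [← cls_out q, res, comp_cls]
  exact cls_congr (tensorId _)

end ResSet

/-- The opposite of a `G × H`-set: the `H × G`-set obtained by exchanging the factors. -/
@[ext]
structure OppSet (G H Ω : Type u) : Type u where
  val : Ω

instance {G H Ω : Type u} [Group G] [Group H] [MulAction (G × H) Ω] :
    MulAction (H × G) (OppSet G H Ω) where
  smul a ω := ⟨(a.2, a.1) • ω.val⟩
  one_smul ω := OppSet.ext (one_smul (G × H) ω.val)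
  mul_smul a b ω := OppSet.ext (mul_smul (a.2, a.1) (b.2, b.1) ω.val)

/-- The linear map `t`, `f ↦ f°`, induced by the opposite of bisets. -/
def opp {G H : Type u} [Group G] [Group H] : Burn (G × H) →ₗ[ℤ] Burn (H × G) :=
  ext1 fun D => cls (H × G) (OppSet G H ((G × H) ⧸ D))

/-- For a `P`-set `X`, the `P × P`-set `X × P` with `(a, b) • (x, v) = (a • x, a * v * b⁻¹)`; it
determines the functor `Y ↦ X × Y` from `P`-sets to `P`-sets. -/
@[ext]
structure MulSet (P X : Type u) : Type u where
  pt : X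
  val : P

instance {P X : Type u} [Group P] [MulAction P X] : MulAction (P × P) (MulSet P X) where
  smul a z := ⟨a.1 • z.pt, a.1 * z.val * a.2⁻¹⟩
  one_smul z := by
    ext
    · exact one_smul P z.pt
    · change (1 : P) * z.val * (1 : P)⁻¹ = z.val
      simp
  mul_smul a b z := by
    ext
    · exact mul_smul a.1 b.1 z.pt
    · change (a.1 * b.1) * z.val * (a.2 * b.2)⁻¹ = a.1 * (b.1 * z.val * b.2⁻¹) * a.2⁻¹
      simp [mul_assoc]

instance {P X : Type u} [Finite P] [Finite X] : Finite (MulSet P X) :=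
  Finite.of_injective (fun z => (z.pt, z.val)) fun _ _ h =>
    MulSet.ext (congrArg Prod.fst h) (congrArg Prod.snd h)

/-- The map `m^P`, sending the class of a `P`-set `X` to the class of the functor `Y ↦ X × Y`. -/
def mulMap (P : Type u) [Group P] : Burn P →ₗ[ℤ] Burn (P × P) :=
  ext1 fun K => cls (P × P) (MulSet P (P ⧸ K))

end Burn

/-- The double Burnside algebra of `P`: the free `ℤ`-module over the isomorphism classes of
indecomposable `P × P`-sets, with the product induced by the composition `Ω ×_P Ω'`. -/
def DBurn (P : Type u) [Group P] : Type u := Burn (P × P)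

namespace DBurn

variable {P : Type u} [Group P]

instance : AddCommGroup (DBurn P) := inferInstanceAs (AddCommGroup (Burn (P × P)))

/-- The identification of the double Burnside algebra with `Burn (P × P)` as a module. -/
def toBurn : DBurn P ≃ₗ[ℤ] Burn (P × P) := LinearEquiv.refl ℤ (Burn (P × P))

instance : Mul (DBurn P) := ⟨fun a b => toBurn.symm (Burn.comp (toBurn a) (toBurn b))⟩

/-- The unit is the class of the `P × P`-set `P`, that is, of the identity functor. -/
instance : One (DBurn P) := ⟨toBurn.symm (Burn.res (MonoidHom.id P))⟩

theorem mul_def (a b : DBurn P) : a * b = toBurn.symm (Burn.comp (toBurn a) (toBurn b)) := rfl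

theorem one_def : (1 : DBurn P) = toBurn.symm (Burn.res (MonoidHom.id P)) := rfl

instance [Finite P] : Ring (DBurn P) where
  left_distrib a b c := by simp only [mul_def, map_add]
  right_distrib a b c := by simp only [mul_def, map_add, LinearMap.add_apply]
  zero_mul a := by simp only [mul_def, map_zero, LinearMap.zero_apply]
  mul_zero a := by simp only [mul_def, map_zero]
  mul_assoc a b c := by
    simp only [mul_def, LinearEquiv.apply_symm_apply, Burn.comp_assoc]
  one_mul a := by
    simp only [mul_def, one_def, LinearEquiv.apply_symm_apply, Burn.res_id_comp,
      LinearEquiv.symm_apply_apply]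
  mul_one a := by
    simp only [mul_def, one_def, LinearEquiv.apply_symm_apply, Burn.comp_res_id,
      LinearEquiv.symm_apply_apply]
  zsmul := (· • ·)
  zsmul_zero' := zero_zsmul
  zsmul_succ' n a := SubNegMonoid.zsmul_succ' n a
  zsmul_neg' n a := SubNegMonoid.zsmul_neg' n a
  neg_add_cancel := neg_add_cancel
  nsmul := (· • ·)
  nsmul_zero := zero_nsmul
  nsmul_succ n a := succ_nsmul a n
  sub_eq_add_neg := sub_eq_add_neg

end DBurn

/-! ### Divisible and Frobenius `P`-categories -/

/-- A divisible `P`-category: a subcategory of the category of finite groups, with the subgroups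
of `P` as objects, whose morphisms are injective, which contains all the homomorphisms between
subgroups of `P` induced by conjugation by elements of `P`, and such that a group homomorphism
`θ : R → Q` is a morphism as soon as `φ` and `φ ∘ θ` are morphisms for some `φ : Q → T`. -/
structure DivisibleCategory (P : Type u) [Group P] where
  /-- `Hom Q R` is the set of morphisms from `Q` to `R`. -/
  Hom : (Q R : Subgroup P) → Set (Q →* R)
  id_mem : ∀ Q, MonoidHom.id Q ∈ Hom Q Q
  comp_mem : ∀ {Q R T : Subgroup P} {ψ : R →* T} {φ : Q →* R},
    ψ ∈ Hom R T → φ ∈ Hom Q R → ψ.comp φ ∈ Hom Q T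
  injective : ∀ {Q R : Subgroup P} {φ : Q →* R}, φ ∈ Hom Q R → Function.Injective φ
  conj_mem : ∀ {Q R : Subgroup P} (φ : Q →* R) (x : P),
    (∀ u : Q, (φ u : P) = x * u * x⁻¹) → φ ∈ Hom Q R
  divisible : ∀ {Q R T : Subgroup P} {φ : Q →* T} (θ : R →* Q),
    φ ∈ Hom Q T → φ.comp θ ∈ Hom R T → θ ∈ Hom R Q

namespace DivisibleCategory

variable {P : Type u} [Group P] (F : DivisibleCategory P)

/-- A homomorphism `φ : Q → P` that is a morphism of the category (with target the object `P`). -/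
def IsMor {Q : Subgroup P} (φ : Q →* P) : Prop :=
  (Subgroup.topEquiv (G := P)).symm.toMonoidHom.comp φ ∈ F.Hom Q ⊤

/-- The group `F(Q)` of automorphisms of an object `Q`. -/
def aut (Q : Subgroup P) : Subgroup (MulAut Q) where
  carrier := {σ | σ.toMonoidHom ∈ F.Hom Q Q}
  mul_mem' {σ τ} hσ hτ := F.comp_mem (φ := τ.toMonoidHom) (ψ := σ.toMonoidHom) hσ hτ
  one_mem' := F.id_mem Q
  inv_mem' {σ} hσ := by
    refine F.divisible (φ := σ.toMonoidHom) _ hσ ?_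
    convert F.id_mem Q
    ext u
    exact congrArg Subtype.val (σ.apply_symm_apply u)

end DivisibleCategory

/-- The group `F_P(Q)` of automorphisms of `Q` induced by conjugation by elements of `P`. -/
def conjAut {P : Type u} [Group P] (Q : Subgroup P) : Subgroup (MulAut Q) :=
  (Subgroup.normalizerMonoidHom Q).range

/-- For an injective homomorphism `φ : Q → P`, the converse image in `N_P(Q)` of the intersection
of `F_P(Q)` with the image of `F_P(φ(Q))` in `Aut(Q)` by the inverse of `Q ≅ φ(Q)`: the elements
`x` of `N_P(Q)` such that for some `y ∈ N_P(φ(Q))` one has `φ (x u x⁻¹) = y (φ u) y⁻¹` for all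
`u ∈ Q`. -/
def extDomain {P : Type u} [Group P] {Q : Subgroup P} (φ : Q →* P) : Subgroup P where
  carrier := {x | x ∈ Subgroup.normalizer (Q : Set P) ∧
    ∃ y ∈ Subgroup.normalizer (φ.range : Set P),
      ∀ u v : Q, (v : P) = x * u * x⁻¹ → φ v = y * φ u * y⁻¹}
  one_mem' := ⟨one_mem _, 1, one_mem _, fun u v h => by
    have : v = u := Subtype.ext (by simpa using h)
    simp [this]⟩
  mul_mem' := by
    rintro x x' ⟨hx, y, hy, h⟩ ⟨hx', y', hy', h'⟩
    refine ⟨mul_mem hx hx', y * y', mul_mem hy hy', fun u v huv => ?_⟩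
    have hw := (Subgroup.mem_normalizer_iff.1 hx' u).1 u.2
    rw [h ⟨_, hw⟩ v (by rw [huv]; group), h' u ⟨_, hw⟩ rfl]
    group
  inv_mem' := by
    rintro x ⟨hx, y, hy, h⟩
    refine ⟨inv_mem hx, y⁻¹, inv_mem hy, fun u v huv => ?_⟩
    rw [h v u (by rw [huv]; group)]
    group

theorem le_extDomain {P : Type u} [Group P] {Q : Subgroup P} (φ : Q →* P) : Q ≤ extDomain φ := by
  intro x hx
  refine ⟨Subgroup.le_normalizer hx, φ ⟨x, hx⟩, Subgroup.le_normalizer ⟨_, rfl⟩, fun u v h => ?_⟩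
  have : v = ⟨x, hx⟩ * u * ⟨x, hx⟩⁻¹ := Subtype.ext h
  rw [this]; simp

namespace DivisibleCategory

variable {P : Type u} [Group P] (F : DivisibleCategory P)

/-- `F` is a Frobenius `P`-category when `F_P(P)` is a Sylow `p`-subgroup of `F(P)` and any
morphism `φ : Q → P` such that `ζ(C_P(φ(Q))) = C_P(ζ(φ(Q)))` for every morphism
`ζ : φ(Q) C_P(φ(Q)) → P` can be extended to a morphism from `extDomain φ` to `P`. -/
structure IsFrobenius (p : ℕ) : Prop where
  sylow : ∃ S : Sylow p (F.aut ⊤), (S : Subgroup (F.aut ⊤)) = (conjAut ⊤).subgroupOf (F.aut ⊤)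
  extend : ∀ (Q : Subgroup P) (φ : Q →* P), F.IsMor φ →
    (∀ ζ : (φ.range ⊔ Subgroup.centralizer (φ.range : Set P) : Subgroup P) →* P, F.IsMor ζ →
      ((Subgroup.centralizer (φ.range : Set P)).subgroupOf
          (φ.range ⊔ Subgroup.centralizer (φ.range : Set P))).map ζ =
        Subgroup.centralizer ((φ.range.subgroupOf
          (φ.range ⊔ Subgroup.centralizer (φ.range : Set P))).map ζ : Set P)) →
    ∃ ψ : extDomain φ →* P, F.IsMor ψ ∧ ψ.comp (Subgroup.inclusion (le_extDomain φ)) = φ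

end DivisibleCategory

/-- The subgroup `Δ_φ(Q) = {(φ u, u) | u ∈ Q}` of `P × P`. -/
def graphSubgroup {P : Type u} [Group P] {Q : Subgroup P} (φ : Q →* P) : Subgroup (P × P) :=
  (φ.prod Q.subtype).range

theorem mem_graphSubgroup {P : Type u} [Group P] {Q : Subgroup P} {φ : Q →* P} {a : P × P} :
    a ∈ graphSubgroup φ ↔ ∃ h : a.2 ∈ Q, φ ⟨a.2, h⟩ = a.1 := by
  constructor
  · rintro ⟨u, rfl⟩
    exact ⟨u.2, rfl⟩
  · rintro ⟨h, h'⟩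
    exact ⟨⟨a.2, h⟩, Prod.ext h' rfl⟩

/-- The isomorphism class `f_{Q,φ}` of the `P × P`-set `(P × P) ⧸ Δ_φ(Q)`. -/
def indecElt {P : Type u} [Group P] {Q : Subgroup P} (φ : Q →* P) : DBurn P :=
  DBurn.toBurn.symm (Burn.cls (P × P) ((P × P) ⧸ graphSubgroup φ))

namespace DivisibleCategory

variable {P : Type u} [Group P] (F : DivisibleCategory P)

/-- `D = Δ_φ(Q)` for some morphism `φ : Q → P`. -/
def IsGraph (D : Subgroup (P × P)) : Prop :=
  ∃ (Q : Subgroup P) (φ : Q →* P), F.IsMor φ ∧ D = graphSubgroup φ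

variable {F} in
theorem isMor_comp {Q R : Subgroup P} {φ : Q →* P} {ψ : R →* Q} (hφ : F.IsMor φ)
    (hψ : ψ ∈ F.Hom R Q) : F.IsMor (φ.comp ψ) := F.comp_mem hφ hψ

theorem isMor_subtype (Q : Subgroup P) : F.IsMor Q.subtype :=
  F.conj_mem _ 1 fun u => by simp

variable {F} in
theorem isGraph_star {D E C : Subgroup (P × P)} (hD : F.IsGraph D) (hE : F.IsGraph E)
    (h : ∀ a b : P, (a, b) ∈ C ↔ ∃ u, (a, u) ∈ D ∧ (u, b) ∈ E) : F.IsGraph C := by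
  obtain ⟨Q, φ, hφ, rfl⟩ := hD
  obtain ⟨R, ψ, hψ, rfl⟩ := hE
  let U : Subgroup P := (Q.comap ψ).map R.subtype
  have hUR : U ≤ R := by rintro _ ⟨u, _, rfl⟩; exact u.2
  have hU : ∀ u : U, ψ (Subgroup.inclusion hUR u) ∈ Q := by
    rintro ⟨_, v, hv, rfl⟩
    exact hv
  let ψ' : U →* Q := (ψ.comp (Subgroup.inclusion hUR)).codRestrict Q hU
  have hι : Subgroup.inclusion hUR ∈ F.Hom U R := F.conj_mem _ 1 fun u => by simp
  have hψ' : ψ' ∈ F.Hom U Q := by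
    refine F.divisible ψ' (F.isMor_subtype Q) ?_
    exact isMor_comp hψ hι
  refine ⟨U, φ.comp ψ', isMor_comp hφ hψ', ?_⟩
  ext ⟨a, b⟩
  rw [h]
  simp only [mem_graphSubgroup]
  constructor
  · rintro ⟨u, ⟨hu, hua⟩, ⟨hb, hbu⟩⟩
    have hbU : b ∈ U := ⟨⟨b, hb⟩, by change ψ ⟨b, hb⟩ ∈ Q; rw [hbu]; exact hu, rfl⟩
    refine ⟨hbU, Eq.trans (congrArg φ ?_) hua⟩
    exact Subtype.ext hbu
  · rintro ⟨hb, hba⟩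
    exact ⟨ψ' ⟨b, hb⟩, ⟨(ψ' ⟨b, hb⟩).2, hba⟩, hUR hb, rfl⟩

theorem isGraph_conj (x : P) :
    F.IsGraph (graphSubgroup ((MulAut.conj x).toMonoidHom.comp (⊤ : Subgroup P).subtype)) :=
  ⟨⊤, _, F.conj_mem _ x fun _ => rfl, rfl⟩

variable {F} in
theorem isGraph_stabilizer {D : Subgroup (P × P)} (hD : F.IsGraph D) (ω : (P × P) ⧸ D) :
    F.IsGraph (MulAction.stabilizer (P × P) ω) := by
  induction ω using Quotient.inductionOn'
  rename_i g
  let C : Subgroup (P × P) := D.map (MulAut.conj ((1 : P), g.2)).toMonoidHom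
  have hC : F.IsGraph C := by
    refine isGraph_star hD (F.isGraph_conj g.2⁻¹) fun a b => ?_
    simp only [mem_graphSubgroup]
    constructor
    · rintro ⟨d, hd, he⟩
      refine ⟨d.2, ?_, trivial, ?_⟩
      · have : a = d.1 := by simpa using (congrArg Prod.fst he).symm
        rwa [this]
      · have : b = g.2 * d.2 * g.2⁻¹ := by simpa using (congrArg Prod.snd he).symm
        simp [this, mul_assoc]
    · rintro ⟨u, hu, _, he⟩
      refine ⟨(a, u), hu, ?_⟩
      simp at he
      simp [← he, mul_assoc]
  refine isGraph_star (F.isGraph_conj g.1) hC fun a b => ?_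
  rw [MulAction.mem_stabilizer_iff]
  change (((a, b) * g : P × P) : (P × P) ⧸ D) = (g : (P × P) ⧸ D) ↔ _
  rw [eq_comm, QuotientGroup.eq]
  simp only [mem_graphSubgroup]
  constructor
  · intro h
    refine ⟨g.1⁻¹ * a * g.1, ⟨trivial, by simp [mul_assoc]⟩, ⟨_, h, ?_⟩⟩
    ext <;> simp [mul_assoc]
  · rintro ⟨u, ⟨_, he⟩, d, hd, he'⟩
    have h1 : d.1 = u := by simpa using congrArg Prod.fst he'
    have h2 : g.2 * d.2 * g.2⁻¹ = b := by simpa using congrArg Prod.snd he'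
    have h3 : g.1 * u * g.1⁻¹ = a := by simpa using he
    have h4 : g⁻¹ * ((a, b) * g) = d := by
      ext
      · simp [← h3, ← h1, mul_assoc]
      · simp [← h2, mul_assoc]
    rw [h4]
    exact hd

/-- The `ℤ`-module freely generated by the classes `f_{Q,φ}`, with `φ : Q → P` a morphism. -/
def heckeModule : Submodule ℤ (DBurn P) :=
  Submodule.span ℤ {f | ∃ (Q : Subgroup P) (φ : Q →* P), F.IsMor φ ∧ f = indecElt φ}

theorem cls_mem_heckeModule {Ω : Type u} [MulAction (P × P) Ω] [Finite Ω]
    (h : ∀ ω : Ω, F.IsGraph (MulAction.stabilizer (P × P) ω)) :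
    DBurn.toBurn.symm (Burn.cls (P × P) Ω) ∈ F.heckeModule := by
  have : Finite (MulAction.orbitRel.Quotient (P × P) Ω) := Quotient.finite _
  let _ : Fintype (MulAction.orbitRel.Quotient (P × P) Ω) := Fintype.ofFinite _
  rw [Burn.cls, finsum_eq_sum_of_fintype, map_sum]
  refine Submodule.sum_mem _ fun ω _ => Submodule.subset_span ?_
  obtain ⟨Q, φ, hφ, hD⟩ := h (Quotient.out ω)
  exact ⟨Q, φ, hφ, by rw [indecElt, Burn.cls_quotient, hD]⟩

variable [Finite P]

theorem mul_mem_heckeModule {a b : DBurn P} (ha : a ∈ F.heckeModule) (hb : b ∈ F.heckeModule) :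
    a * b ∈ F.heckeModule := by
  induction ha using Submodule.span_induction with
  | zero => simp
  | add x y _ _ hx hy => rw [add_mul]; exact add_mem hx hy
  | smul n x _ hx => rw [smul_mul_assoc]; exact Submodule.smul_mem _ _ hx
  | mem x hx =>
  induction hb using Submodule.span_induction with
  | zero => simp
  | add x y _ _ hx hy => rw [mul_add]; exact add_mem hx hy
  | smul n x _ hx => rw [mul_smul_comm]; exact Submodule.smul_mem _ _ hx
  | mem y hy =>
  obtain ⟨Q, φ, hφ, rfl⟩ := hx
  obtain ⟨R, ψ, hψ, rfl⟩ := hy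
  rw [DBurn.mul_def, indecElt, indecElt, LinearEquiv.apply_symm_apply,
    LinearEquiv.apply_symm_apply, Burn.comp_cls]
  refine F.cls_mem_heckeModule fun ω => ?_
  induction ω using Amalg.ind
  rename_i ω ω'
  refine isGraph_star (isGraph_stabilizer ⟨Q, φ, hφ, rfl⟩ ω)
    (isGraph_stabilizer ⟨R, ψ, hψ, rfl⟩ ω') fun a b => ?_
  simp only [MulAction.mem_stabilizer_iff]
  rw [Amalg.smul_mk, Amalg.mk_eq_mk]
  change (∃ u : P, ω = ((1 : P), u) • (a, (1 : P)) • ω ∧ ω' = (u, (1 : P)) • ((1 : P), b) • ω') ↔ _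
  simp only [← mul_smul, Prod.mk_mul_mk, one_mul, mul_one]
  simp only [eq_comm]

theorem one_mem_heckeModule : (1 : DBurn P) ∈ F.heckeModule := by
  refine F.cls_mem_heckeModule fun v => ?_
  have h := F.isGraph_conj v.val
  convert h using 1
  ext ⟨a, b⟩
  rw [MulAction.mem_stabilizer_iff, Burn.resSet_smul, mem_graphSubgroup, Burn.ResSet.ext_iff]
  change a * v.val * b⁻¹ = v.val ↔ ∃ _ : b ∈ (⊤ : Subgroup P), v.val * b * v.val⁻¹ = a
  rw [mul_inv_eq_iff_eq_mul, ← eq_mul_inv_iff_mul_eq]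
  exact ⟨fun h => ⟨trivial, h.symm⟩, fun ⟨_, h⟩ => h.symm⟩

/-- The Hecke algebra of `F`. -/
def hecke : Subalgebra ℤ (DBurn P) where
  carrier := F.heckeModule
  mul_mem' := F.mul_mem_heckeModule
  add_mem' := F.heckeModule.add_mem
  algebraMap_mem' n := by
    rw [Algebra.algebraMap_eq_smul_one]
    exact F.heckeModule.smul_mem n F.one_mem_heckeModule

theorem mulMap_mem (s : Burn P) : DBurn.toBurn.symm (Burn.mulMap P s) ∈ F.hecke := by
  change _ ∈ F.heckeModule
  induction s using Burn.induction_on with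
  | zero => simp
  | add a b ha hb => rw [map_add, map_add]; exact add_mem ha hb
  | neg a ha => rw [map_neg, map_neg]; exact neg_mem ha
  | basis q =>
  rw [Burn.mulMap, Burn.ext1_basisElt]
  refine F.cls_mem_heckeModule fun z => ?_
  let Q : Subgroup P := MulAction.stabilizer P (z.val⁻¹ • z.pt)
  refine ⟨Q, (MulAut.conj z.val).toMonoidHom.comp Q.subtype, F.conj_mem _ z.val fun _ => rfl, ?_⟩
  ext ⟨a, b⟩
  rw [MulAction.mem_stabilizer_iff, mem_graphSubgroup, Burn.MulSet.ext_iff]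
  change a • z.pt = z.pt ∧ a * z.val * b⁻¹ = z.val ↔
    ∃ _ : b • (z.val⁻¹ • z.pt) = z.val⁻¹ • z.pt, z.val * b * z.val⁻¹ = a
  rw [mul_inv_eq_iff_eq_mul, ← eq_mul_inv_iff_mul_eq, exists_prop, eq_comm (a := a)]
  refine and_congr_left fun h => ?_
  rw [← h, mul_smul, mul_smul, smul_eq_iff_eq_inv_smul]

/-- The map `m^P`, which takes its values in the Hecke algebra. -/
def mulHecke : Burn P →ₗ[ℤ] F.hecke :=
  (DBurn.toBurn.symm.toLinearMap ∘ₗ Burn.mulMap P).codRestrict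
    (Subalgebra.toSubmodule F.hecke) F.mulMap_mem

/-- The evaluation `v_H : H → Burn P`, `f ↦ f(1)`, at the trivial `P`-set. -/
def eval : F.hecke →ₗ[ℤ] Burn P :=
  (Burn.act.flip 1) ∘ₗ DBurn.toBurn.toLinearMap ∘ₗ (Subalgebra.toSubmodule F.hecke).subtype

/-- The kernel `K_H` of the evaluation. -/
def kerEval : Submodule ℤ F.hecke := LinearMap.ker F.eval

/-- `H^F`: the elements `f` of the Hecke algebra such that `res_φ · f = res_ι · f` and
`res_φ · f° = res_ι · f°` for any subgroup `Q` of `P` and any morphism `φ : Q → P`, where `ι` is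
the inclusion of `Q` in `P`. -/
def heckeInv : Submodule ℤ F.hecke where
  carrier := {f | ∀ (Q : Subgroup P) (φ : Q →* P), F.IsMor φ →
    Burn.comp (Burn.res φ) (DBurn.toBurn (f : DBurn P)) =
      Burn.comp (Burn.res Q.subtype) (DBurn.toBurn (f : DBurn P)) ∧
    Burn.comp (Burn.res φ) (Burn.opp (DBurn.toBurn (f : DBurn P))) =
      Burn.comp (Burn.res Q.subtype) (Burn.opp (DBurn.toBurn (f : DBurn P)))}
  add_mem' {f g} hf hg Q φ hφ := by
    simp only [AddMemClass.coe_add, map_add, (hf Q φ hφ).1, (hf Q φ hφ).2, (hg Q φ hφ).1,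
      (hg Q φ hφ).2, and_self]
  zero_mem' Q φ hφ := by simp
  smul_mem' n f hf Q φ hφ := by
    simp only [SetLike.val_smul, map_smul, (hf Q φ hφ).1, (hf Q φ hφ).2, and_self]

/-- `(B_P)^F`: the elements `s` of the Burnside algebra such that `res_φ s = res_ι s` for any
subgroup `Q` of `P` and any morphism `φ : Q → P`, where `ι` is the inclusion of `Q` in `P`. -/
def burnInv : Submodule ℤ (Burn P) where
  carrier := {s | ∀ (Q : Subgroup P) (φ : Q →* P), F.IsMor φ →
    Burn.act (Burn.res φ) s = Burn.act (Burn.res Q.subtype) s}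
  add_mem' {f g} hf hg Q φ hφ := by simp only [map_add, hf Q φ hφ, hg Q φ hφ]
  zero_mem' Q φ hφ := by simp
  smul_mem' n f hf Q φ hφ := by simp only [map_smul, hf Q φ hφ]

end DivisibleCategory

instance isPrime_span_natCast (p : ℕ) [hp : Fact p.Prime] :
    (Ideal.span {(p : ℤ)}).IsPrime :=
  (Ideal.span_singleton_prime (by exact_mod_cast hp.out.ne_zero)).2
    (Nat.prime_iff_prime_int.1 hp.out)

end

/-! An element of a Burnside group is determined by its marks, the numbers of fixed points of the
subgroups, and an element of the Hecke algebra `H` has nonzero marks only at graphs of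
`F`-morphisms. Every statement reduces to marks and to two facts.

The first is an identity. A basis element factors as f_{Q,φ} = res_φ° · res_ι, while res_φ° · res_φ
= m_{P/φ(Q)} and f_{Q,φ}(1) = P/φ(Q). If f is in H^F, then res_ι · f = res_φ · f, hence h · f =
m_{h(1)} · f for every h in H (`mul_eq_mulHecke_eval_mul`). So the kernel K of evaluation
annihilates H^F from the left, H^F is closed under products, and evaluation is multiplicative on it.
Lying in H^F means that marks are invariant under pairs of morphisms (`mem_heckeInv_iff`). Counting
fixed points then gives |P| · mark_R(f(1)) = |F(P,R)| · mark_{Δ(R)}(f) on H^F, so evaluation is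
injective there.

The second is the existence of w in H^F with w(1) = n prime to p (`exists_heckeInv_eval_eq`). Once n
is inverted, n⁻¹ m_s w lies over any invariant s, and 1 and m_s are in K + H^F. To get w, an element
with invariant marks is built by descending induction on the order of the graphs
(`exists_hecke_transport`), starting with the value |Z(P)| at graphs of automorphisms of P. At each
order the marks must be corrected by multiples of |N(D) : D|. The needed congruence
(`mark_self_dvd_sub`) comes from Burnside's orbit count for N(D), acting once by inclusion and once
through a pair of morphisms that carries D to a diagonal. Such a pair exists because every class of
subgroups of a Frobenius category has a representative onto which normalizers extend
(`exists_mor_receptive`). The evaluation s of the resulting element has mark |F(P) : F_P(P)| at P,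
prime to p. As P is a p-group, all marks of s are then prime to p, and the polynomial with these
marks as roots yields an invariant r with r s an integer prime to p. -/

noncomputable section

/-! ### Marks: triangularity, separation of elements, Burnside's congruence. -/

namespace Burn

section Mark

variable {G : Type u} [Group G]

/-- The points of `X` fixed by all the elements of `K`. -/
def fixSet (K : Subgroup G) (X : Type*) [MulAction G X] : Set X := {x | ∀ k ∈ K, k • x = x}

theorem mem_fixSet {K : Subgroup G} {X : Type*} [MulAction G X] {x : X} :
    x ∈ fixSet K X ↔ ∀ k ∈ K, k • x = x := Iff.rfl

/-- The number of fixed points of a subgroup `K`, extended linearly to `Burn G`. -/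
def mark (K : Subgroup G) : Burn G →ₗ[ℤ] ℤ := ext1 fun L => (Nat.card (fixSet K (G ⧸ L)) : ℤ)

theorem card_fixSet_congr {H : Type*} [Group H] {X Y : Type*} [MulAction G X] [MulAction H Y]
    (K : Subgroup G) (L : Subgroup H) (e : X ≃ Y)
    (h : ∀ x, (∀ k ∈ K, k • x = x) ↔ ∀ l ∈ L, l • e x = e x) :
    Nat.card (fixSet K X) = Nat.card (fixSet L Y) :=
  Nat.card_congr (e.subtypeEquiv h)

theorem card_fixSet_gequiv {X Y : Type*} [MulAction G X] [MulAction G Y] (K : Subgroup G)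
    (e : GEquiv G X Y) : Nat.card (fixSet K X) = Nat.card (fixSet K Y) :=
  card_fixSet_congr K K e.toEquiv fun x => by
    simp only [← e.map_smul, e.toEquiv.injective.eq_iff]

theorem card_fixSet_sigma {ι : Type u} [Fintype ι] {X : ι → Type u} [∀ i, MulAction G (X i)]
    [∀ i, Finite (X i)] (K : Subgroup G) :
    Nat.card (fixSet K (Σ i, X i)) = ∑ i, Nat.card (fixSet K (X i)) := by
  rw [← Nat.card_sigma]
  refine Nat.card_congr ⟨fun x => ⟨x.1.1, x.1.2, fun k hk => ?_⟩,
    fun x => ⟨⟨x.1, x.2.1⟩, fun k hk => ?_⟩, fun _ => rfl, fun _ => rfl⟩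
  · have := x.2 k hk
    rw [← Sigma.eta x.1, Sigma.smul_mk] at this
    exact eq_of_heq (Sigma.mk.inj this).2
  · rw [Sigma.smul_mk, x.2.2 k hk]

theorem mark_cls [Finite G] (K : Subgroup G) (X : Type u) [MulAction G X] [Finite X] :
    mark K (cls G X) = Nat.card (fixSet K X) :=
  ext1_cls (fun X [MulAction G X] => (Nat.card (fixSet K X) : ℤ))
    (fun X Y _ _ e => by rw [card_fixSet_gequiv K e])
    (fun ι _ X _ _ => by rw [card_fixSet_sigma, Nat.cast_sum]) X

/-- Two linear maps on `Burn G` are equal when they agree on the classes of finite `G`-sets. -/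
theorem hom_ext_cls {M : Type*} [AddCommGroup M] {φ ψ : Burn G →ₗ[ℤ] M}
    (h : ∀ (K : Subgroup G), φ (cls G (G ⧸ K)) = ψ (cls G (G ⧸ K))) : φ = ψ :=
  hom_ext fun q => by rw [← cls_out q]; exact h _

theorem mem_fixSet_mk {K L : Subgroup G} {g : G} :
    (g : G ⧸ L) ∈ fixSet K (G ⧸ L) ↔ ∀ k ∈ K, g⁻¹ * k * g ∈ L := by
  refine forall₂_congr fun k _ => ?_
  change ((k * g : G) : G ⧸ L) = g ↔ _
  rw [eq_comm, QuotientGroup.eq, mul_assoc]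

theorem mk_indec_conj (g : G) (L : Subgroup G) :
    Quotient.mk (indecSetoid G) (L.map (MulAut.conj g).toMonoidHom) =
      Quotient.mk (indecSetoid G) L := by
  have h := mk_stabilizer_smul (X := G ⧸ L) g ((1 : G) : G ⧸ L)
  rwa [MulAction.stabilizer_smul_eq_stabilizer_map_conj, MulAction.stabilizer_quotient] at h

variable [Finite G]

theorem mark_mul (K : Subgroup G) (a b : Burn G) : mark K (a * b) = mark K a * mark K b := by
  have h : (ext2 fun K L => cls G ((G ⧸ K) × (G ⧸ L))).compr₂ (mark K) =
      (LinearMap.mul ℤ ℤ).compl₁₂ (mark K) (mark K) := by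
    refine hom_ext_cls fun L => hom_ext_cls fun L' => ?_
    simp only [LinearMap.compr₂_apply, LinearMap.compl₁₂_apply, LinearMap.mul_apply', ← mul_def,
      cls_mul_cls, mark_cls]
    rw [← Nat.cast_mul, ← Nat.card_prod]
    congr 1
    refine Nat.card_congr ⟨fun x => (⟨x.1.1, fun k hk => congrArg Prod.fst (x.2 k hk)⟩,
      ⟨x.1.2, fun k hk => congrArg Prod.snd (x.2 k hk)⟩), fun x => ⟨(x.1, x.2), fun k hk =>
      Prod.ext (x.1.2 k hk) (x.2.2 k hk)⟩, fun _ => rfl, fun _ => rfl⟩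
  exact LinearMap.congr_fun (LinearMap.congr_fun h a) b

theorem mark_one (K : Subgroup G) : mark K (1 : Burn G) = 1 := by
  rw [one_eq, mark_cls]
  have : Subsingleton (G ⧸ (⊤ : Subgroup G)) := QuotientGroup.subsingleton_quotient_top
  have h : fixSet K (G ⧸ (⊤ : Subgroup G)) = Set.univ :=
    Set.eq_univ_of_forall fun x k _ => Subsingleton.elim _ _
  rw [h]
  simp [Nat.card_unique]

/-- The mark at `K` as a ring homomorphism. -/
def markHom (K : Subgroup G) : Burn G →+* ℤ where
  toFun := mark K
  map_one' := mark_one K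
  map_mul' := mark_mul K
  map_zero' := map_zero _
  map_add' := map_add _

/-- A coset gL fixed by K gives g⁻¹Kg ≤ L. This is the triangularity of the table of marks; the next
lemma treats its diagonal blocks. -/
theorem card_le_of_mark_ne_zero {K L : Subgroup G} (h : mark K (cls G (G ⧸ L)) ≠ 0) :
    ∃ g : G, K.map (MulAut.conj g).toMonoidHom ≤ L := by
  rw [mark_cls] at h
  have h' : Nat.card (fixSet K (G ⧸ L)) ≠ 0 := by exact_mod_cast h
  obtain ⟨⟨x, hx⟩⟩ : Nonempty (fixSet K (G ⧸ L)) := (Nat.card_ne_zero.1 h').1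
  induction x using Quotient.inductionOn'
  rename_i g
  refine ⟨g⁻¹, ?_⟩
  rintro _ ⟨k, hk, rfl⟩
  have := mem_fixSet_mk.1 hx k hk
  simpa using this

theorem mk_eq_of_mark_ne_zero {K L : Subgroup G} (h : mark K (cls G (G ⧸ L)) ≠ 0)
    (hc : Nat.card L ≤ Nat.card K) :
    Quotient.mk (indecSetoid G) K = Quotient.mk (indecSetoid G) L := by
  obtain ⟨g, hg⟩ := card_le_of_mark_ne_zero h
  have hcard : Nat.card (K.map (MulAut.conj g).toMonoidHom) = Nat.card K :=
    Subgroup.card_map_of_injective (MulAut.conj g).injective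
  have := Subgroup.eq_of_le_of_card_ge hg (by rw [hcard]; exact hc)
  rw [← this, mk_indec_conj]

theorem mem_normalizer_iff_fixSet {K : Subgroup G} {g : G} :
    g ∈ Subgroup.normalizer (K : Set G) ↔ (g : G ⧸ K) ∈ fixSet K (G ⧸ K) := by
  rw [mem_fixSet_mk]
  constructor
  · intro h k hk
    have := (Subgroup.mem_normalizer_iff.1 (inv_mem h) k).1 hk
    simpa using this
  · intro h
    have h1 : K.map (MulAut.conj g⁻¹).toMonoidHom ≤ K := by
      rintro _ ⟨k, hk, rfl⟩
      simpa using h k hk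
    have hcard : Nat.card (K.map (MulAut.conj g⁻¹).toMonoidHom) = Nat.card K :=
      Subgroup.card_map_of_injective (MulAut.conj g⁻¹).injective
    have h2 := Subgroup.eq_of_le_of_card_ge h1 hcard.ge
    rw [← inv_mem_iff, Subgroup.mem_normalizer_iff]
    intro k
    constructor
    · intro hk; simpa using h k hk
    · intro hk
      rw [← h2] at hk
      obtain ⟨k', hk', he⟩ := hk
      have : k' = k := by simpa using he
      rwa [← this]

/-- The coset gK is fixed by K exactly when g normalizes K, so the diagonal mark is the index |N(K)
: K|. The product form allows a congruence modulo |N(K)| to be divided by |K|. -/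
theorem card_mul_mark_self (K : Subgroup G) :
    (Nat.card K : ℤ) * mark K (cls G (G ⧸ K)) =
      Nat.card (Subgroup.normalizer (K : Set G)) := by
  rw [mark_cls, ← Nat.cast_mul, Nat.cast_inj]
  have hle : K ≤ Subgroup.normalizer (K : Set G) := Subgroup.le_normalizer
  rw [← Subgroup.card_mul_index (K.subgroupOf (Subgroup.normalizer (K : Set G))),
    Nat.card_congr (Subgroup.subgroupOfEquivOfLe hle).toEquiv, Subgroup.index]
  congr 1
  symm
  refine Nat.card_congr (Equiv.ofBijective (fun x => Quotient.liftOn' x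
    (fun n => (⟨((n : G) : G ⧸ K), mem_normalizer_iff_fixSet.1 n.2⟩ : fixSet K (G ⧸ K))) ?_)
    ⟨?_, ?_⟩)
  · intro a b hab
    apply Subtype.ext
    rw [QuotientGroup.leftRel_apply, Subgroup.mem_subgroupOf] at hab
    exact QuotientGroup.eq.2 hab
  · intro x y h
    induction x using Quotient.inductionOn'
    induction y using Quotient.inductionOn'
    have h := QuotientGroup.eq.1 (congrArg Subtype.val h)
    apply Quotient.sound'
    rw [QuotientGroup.leftRel_apply, Subgroup.mem_subgroupOf]
    exact h
  · rintro ⟨x, hx⟩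
    induction x using Quotient.inductionOn'
    rename_i g
    exact ⟨Quotient.mk'' ⟨g, mem_normalizer_iff_fixSet.2 hx⟩, rfl⟩

theorem mark_self_pos (K : Subgroup G) : 0 < mark K (cls G (G ⧸ K)) := by
  have h := card_mul_mark_self K
  have h1 : (0 : ℤ) < Nat.card K := by exact_mod_cast Nat.card_pos
  have h2 : (0 : ℤ) < Nat.card (Subgroup.normalizer (K : Set G)) := by exact_mod_cast Nat.card_pos
  rw [← h] at h2
  exact pos_of_mul_pos_right h2 h1.le

/-- Triangularity: at a subgroup of largest order in the support, only its own class contributes to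
the mark, with a positive factor. -/
theorem eq_zero_of_mark {a : Burn G} (h : ∀ K, mark K a = 0) : a = 0 := by
  by_contra ha
  let s : Finset (IndecClass G) := Finsupp.support (show IndecClass G →₀ ℤ from a)
  have hs : s.Nonempty := Finsupp.support_nonempty_iff.2 ha
  obtain ⟨q, hq, hmax⟩ := s.exists_max_image
    (fun q => Nat.card (Quotient.out q : Subgroup G)) hs
  have hm : mark (Quotient.out q) a = ∑ r ∈ s, (show IndecClass G →₀ ℤ from a) r •
      mark (Quotient.out q) (cls G (G ⧸ Quotient.out r)) := by
    have h1 : ∀ r : IndecClass G, mark (Quotient.out q) (cls G (G ⧸ Quotient.out r)) =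
        Nat.card (fixSet (Quotient.out q) (G ⧸ Quotient.out r)) :=
      fun r => mark_cls _ (G ⧸ Quotient.out r)
    simp only [h1]
    rfl
  rw [h, Finset.sum_eq_single q] at hm
  · have h1 := (mark_self_pos (Quotient.out q)).ne'
    have h2 := Finsupp.mem_support_iff.1 hq
    rcases mul_eq_zero.1 hm.symm with h3 | h3
    · exact h2 h3
    · exact h1 h3
  · intro r hr hrq
    by_contra hne
    refine hrq ?_
    have := mk_eq_of_mark_ne_zero (right_ne_zero_of_smul hne) (hmax r hr)
    rw [← Quotient.out_eq q, ← Quotient.out_eq r]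
    exact this.symm
  · intro h'; exact absurd hq h'

theorem ext_mark {a b : Burn G} (h : ∀ K, mark K a = mark K b) : a = b :=
  sub_eq_zero.1 (eq_zero_of_mark fun K => by rw [map_sub, h, sub_self])

theorem mark_conj (g : G) (K : Subgroup G) (a : Burn G) :
    mark (K.map (MulAut.conj g).toMonoidHom) a = mark K a := by
  have h : mark (K.map (MulAut.conj g).toMonoidHom) = mark K := by
    refine hom_ext_cls fun L => ?_
    rw [mark_cls, mark_cls, Nat.cast_inj]
    symm
    refine card_fixSet_congr _ _ (MulAction.toPerm g) fun x => ?_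
    simp only [Subgroup.mem_map, forall_exists_index, and_imp, forall_apply_eq_imp_iff₂]
    refine forall₂_congr fun k _ => ?_
    change _ ↔ (g * k * g⁻¹) • g • x = g • x
    rw [← mul_smul, inv_mul_cancel_right, mul_smul, smul_left_cancel_iff]
  rw [h]

/-- Burnside's congruence: for a normal subgroup `D` of a group `N` acting through `χ`. -/
theorem card_dvd_sum_mark {N : Type*} [Group N] [Fintype N] (χ : N →* G) (D : Subgroup N)
    [D.Normal] (a : Burn G) :
    (Nat.card N : ℤ) ∣ ∑ n : N, mark ((D ⊔ Subgroup.zpowers n).map χ) a := by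
  have key : ∀ K : Subgroup G,
      (Nat.card N : ℤ) ∣ ∑ n : N, mark ((D ⊔ Subgroup.zpowers n).map χ) (cls G (G ⧸ K)) := by
    intro K
    -- As D is normal, N acts on the D-fixed points of G/K. An element n fixes there exactly the
    -- points fixed by the image of ⟨D, n⟩, so the sum counts the fixed points of all n and equals
    -- |N| times the number of orbits.
    let _ : MulAction N (G ⧸ K) := MulAction.compHom (G ⧸ K) χ
    have hsm : ∀ (n : N) (x : G ⧸ K), n • x = χ n • x := fun _ _ => rfl
    have hst : ∀ (n : N) (x : fixSet D (G ⧸ K)), n • (x : G ⧸ K) ∈ fixSet D (G ⧸ K) := by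
      intro n x d hd
      have h := x.2 (n⁻¹ * d * n) (by
        simpa using Subgroup.Normal.conj_mem ‹D.Normal› d hd n⁻¹)
      rw [← mul_smul]
      conv_rhs => rw [← h]
      rw [← mul_smul]
      congr 1
      group
    let _ : MulAction N (fixSet D (G ⧸ K)) :=
      { smul n x := ⟨n • (x : G ⧸ K), hst n x⟩
        one_smul x := Subtype.ext (one_smul N (x : G ⧸ K))
        mul_smul m n x := Subtype.ext (mul_smul m n (x : G ⧸ K)) }
    classical
    let _ : Fintype (fixSet D (G ⧸ K)) := Fintype.ofFinite _
    let _ : Fintype (Quotient (MulAction.orbitRel N (fixSet D (G ⧸ K)))) := Fintype.ofFinite _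
    let _ : ∀ n : N, Fintype (MulAction.fixedBy (fixSet D (G ⧸ K)) n) := fun n => Fintype.ofFinite _
    have hB := MulAction.sum_card_fixedBy_eq_card_orbits_mul_card_group N (fixSet D (G ⧸ K))
    refine ⟨(Fintype.card (Quotient (MulAction.orbitRel N (fixSet D (G ⧸ K)))) : ℤ), ?_⟩
    rw [Nat.card_eq_fintype_card, mul_comm, ← Nat.cast_mul, ← hB, Nat.cast_sum]
    refine Finset.sum_congr rfl fun n _ => ?_
    rw [mark_cls, ← Nat.card_eq_fintype_card, Nat.cast_inj]
    refine Nat.card_congr ⟨fun x => ⟨⟨x.1, fun d hd => x.2 _ ⟨d, ?_, rfl⟩⟩, Subtype.ext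
      (x.2 _ ⟨n, ?_, rfl⟩)⟩, fun x => ⟨x.1.1, ?_⟩, fun _ => rfl, fun _ => rfl⟩
    · exact (le_sup_left : D ≤ _) hd
    · exact (le_sup_right : Subgroup.zpowers n ≤ _) (Subgroup.mem_zpowers n)
    · have hle : D ⊔ Subgroup.zpowers n ≤ MulAction.stabilizer N (x.1.1 : G ⧸ K) := by
        refine sup_le (fun d hd => x.1.2 d hd) ?_
        rw [Subgroup.zpowers_le]
        exact congrArg Subtype.val x.2
      rintro _ ⟨m, hm, rfl⟩
      exact hle hm
  induction a using induction_on with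
  | zero => simp
  | add a b ha hb => simp only [map_add, Finset.sum_add_distrib]; exact dvd_add ha hb
  | neg a ha => simp only [map_neg, Finset.sum_neg_distrib]; exact (dvd_neg).2 ha
  | basis q => rw [← cls_out q]; exact key _

/-- For a `p`-group all marks are congruent modulo `p`. -/
theorem mark_modEq_mark_bot {p : ℕ} [Fact p.Prime] (hG : IsPGroup p G) (K : Subgroup G)
    (a : Burn G) : (p : ℤ) ∣ mark ⊥ a - mark K a := by
  have key : ∀ L : Subgroup G, (p : ℤ) ∣ mark ⊥ (cls G (G ⧸ L)) - mark K (cls G (G ⧸ L)) := by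
    intro L
    have h := (hG.to_subgroup K).card_modEq_card_fixedPoints (G ⧸ L)
    rw [mark_cls, mark_cls]
    have h1 : fixSet (⊥ : Subgroup G) (G ⧸ L) = Set.univ := by
      refine Set.eq_univ_of_forall fun x k hk => ?_
      rw [Subgroup.mem_bot.1 hk, one_smul]
    have h2 : Nat.card (MulAction.fixedPoints (↥K) (G ⧸ L)) = Nat.card (fixSet K (G ⧸ L)) :=
      Nat.card_congr (Equiv.subtypeEquivRight fun x =>
        ⟨fun h k hk => h ⟨k, hk⟩, fun h k => h k.1 k.2⟩)
    rw [h1, Nat.card_univ, ← h2]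
    exact (Nat.modEq_iff_dvd.1 h.symm)
  induction a using induction_on with
  | zero => simp
  | add a b ha hb =>
    rw [map_add, map_add, add_sub_add_comm]; exact dvd_add ha hb
  | neg a ha =>
    rw [map_neg, map_neg, neg_sub_neg, ← neg_sub]; exact (dvd_neg).2 ha
  | basis q => rw [← cls_out q]; exact key _

end Mark

end Burn

/-! ### Marks of opposites, restrictions and products with `mulMap`. -/

namespace Burn

/-- A transitive `G`-set is the quotient of `G` by the stabilizer of a point. -/
theorem cls_eq_of_transitive {G : Type u} [Group G] {X : Type u} [MulAction G X] (x : X)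
    (hx : ∀ y : X, ∃ g : G, g • x = y) {K : Subgroup G} (hK : MulAction.stabilizer G x = K) :
    cls G X = cls G (G ⧸ K) := by
  subst hK
  refine (cls_congr ⟨Equiv.ofBijective (MulAction.ofQuotientStabilizer G x)
    ⟨MulAction.injective_ofQuotientStabilizer G x, fun y => ?_⟩, fun g y =>
      MulAction.ofQuotientStabilizer_smul G x g y⟩).symm
  obtain ⟨g, rfl⟩ := hx y
  exact ⟨QuotientGroup.mk g, rfl⟩

section Formulas

variable {G H K P Q : Type u} [Group G] [Group H] [Group K] [Group P] [Group Q]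

instance {Ω : Type u} [Finite Ω] : Finite (OppSet G H Ω) :=
  Finite.of_injective OppSet.val fun _ _ h => OppSet.ext h

theorem opp_cls [Finite G] [Finite H] (Ω : Type u) [MulAction (G × H) Ω] [Finite Ω] :
    opp (cls (G × H) Ω) = cls (H × G) (OppSet G H Ω) := by
  refine ext1_cls (fun Ω [MulAction (G × H) Ω] => cls (H × G) (OppSet G H Ω)) ?_ ?_ Ω
  · intro X Y _ _ e
    exact cls_congr ⟨⟨fun x => ⟨e.toEquiv x.val⟩, fun x => ⟨e.toEquiv.symm x.val⟩,
      fun x => OppSet.ext (e.toEquiv.symm_apply_apply _),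
      fun x => OppSet.ext (e.toEquiv.apply_symm_apply _)⟩,
      fun g x => OppSet.ext (e.map_smul (g.2, g.1) x.val)⟩
  · intro ι _ X _ _
    rw [← cls_sigma]
    exact cls_congr ⟨⟨fun x => ⟨x.val.1, ⟨x.val.2⟩⟩, fun x => ⟨⟨x.1, x.2.val⟩⟩,
      fun _ => rfl, fun _ => rfl⟩, fun _ _ => rfl⟩

theorem mark_opp [Finite G] [Finite H] (D : Subgroup (H × G)) (f : Burn (G × H)) :
    mark D (opp f) = mark (D.map (MulEquiv.prodComm : H × G ≃* G × H).toMonoidHom) f := by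
  have h : mark D ∘ₗ opp =
      mark (D.map (MulEquiv.prodComm : H × G ≃* G × H).toMonoidHom) := by
    refine hom_ext_cls fun L => ?_
    rw [LinearMap.comp_apply, opp_cls, mark_cls, mark_cls, Nat.cast_inj]
    refine card_fixSet_congr _ _ ⟨OppSet.val, OppSet.mk, fun _ => rfl, fun _ => rfl⟩ fun x => ?_
    simp only [Subgroup.mem_map, forall_exists_index, and_imp, forall_apply_eq_imp_iff₂]
    refine forall₂_congr fun k _ => ?_
    rw [OppSet.ext_iff]
    rfl
  exact LinearMap.congr_fun h f

/-- The set `res_φ ×_P Ω` is `Ω` itself, with the action restricted through `φ`. -/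
def resTensor (φ : Q →* P) (Ω : Type u) [MulAction (P × K) Ω] :
    BTensor Q P K (ResSet φ) Ω ≃ Ω where
  toFun := Amalg.lift (fun v ω => (v.val, (1 : K)) • ω) (by
    intro v ω u
    change (v.val, (1 : K)) • ω = (φ 1 * v.val * u⁻¹, (1 : K)) • ((u, (1 : K)) • ω)
    rw [← mul_smul]; simp)
  invFun ω := Amalg.mk ⟨1⟩ ω
  left_inv := by
    intro a
    induction a using Amalg.ind
    rename_i v ω
    refine Amalg.mk_eq_mk.2 ⟨v.val⁻¹, ?_, ?_⟩
    · ext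
      change v.val = φ 1 * 1 * (v.val⁻¹)⁻¹
      simp
    · change ω = (v.val⁻¹, (1 : K)) • (v.val, (1 : K)) • ω
      rw [← mul_smul, Prod.mk_mul_mk, inv_mul_cancel, one_mul]
      exact (one_smul (P × K) ω).symm
  right_inv ω := one_smul (P × K) ω

theorem resTensor_smul (φ : Q →* P) (Ω : Type u) [MulAction (P × K) Ω] (g : Q × K)
    (x : BTensor Q P K (ResSet φ) Ω) :
    resTensor φ Ω (g • x) = (φ g.1, g.2) • resTensor φ Ω x := by
  induction x using Amalg.ind
  rename_i v ω
  change (φ g.1 * v.val * (1 : P)⁻¹, (1 : K)) • (((1 : P), g.2) • ω) =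
    (φ g.1, g.2) • (v.val, (1 : K)) • ω
  rw [← mul_smul, ← mul_smul]
  congr 1
  simp

/-- Composing with res_φ does not change the underlying set, only the action, which is pulled back
along φ × id; hence the fixed points of D are those of its image. -/
theorem mark_comp_res [Finite P] [Finite Q] [Finite K] (φ : Q →* P) (D : Subgroup (Q × K))
    (g : Burn (P × K)) :
    mark D (comp (res φ) g) = mark (D.map (φ.prodMap (MonoidHom.id K))) g := by
  have h : mark D ∘ₗ comp (res φ) = mark (D.map (φ.prodMap (MonoidHom.id K))) := by
    refine hom_ext_cls fun L => ?_
    rw [LinearMap.comp_apply, res, comp_cls, mark_cls, mark_cls, Nat.cast_inj]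
    refine card_fixSet_congr _ _ (resTensor φ _) fun x => ?_
    simp only [Subgroup.mem_map, forall_exists_index, and_imp, forall_apply_eq_imp_iff₂]
    refine forall₂_congr fun k _ => ?_
    rw [← (resTensor φ _).injective.eq_iff, resTensor_smul]
    rfl
  exact LinearMap.congr_fun h g

/-- The `Q`-set `res_φ ×_P X` is `X` itself, with the action restricted through `φ`. -/
def resATensor (φ : Q →* P) (X : Type u) [MulAction P X] :
    ATensor Q P (ResSet φ) X ≃ X where
  toFun := Amalg.lift (fun v ω => v.val • ω) (by
    intro v ω u
    change v.val • ω = (φ 1 * v.val * u⁻¹) • (u • ω)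
    rw [← mul_smul]; simp)
  invFun ω := Amalg.mk ⟨1⟩ ω
  left_inv := by
    intro a
    induction a using Amalg.ind
    rename_i v ω
    refine Amalg.mk_eq_mk.2 ⟨v.val⁻¹, ?_, ?_⟩
    · ext
      change v.val = φ 1 * 1 * (v.val⁻¹)⁻¹
      simp
    · change ω = v.val⁻¹ • v.val • ω
      rw [inv_smul_smul]
  right_inv ω := one_smul P ω

theorem resATensor_smul (φ : Q →* P) (X : Type u) [MulAction P X] (g : Q)
    (x : ATensor Q P (ResSet φ) X) :
    resATensor φ X (g • x) = φ g • resATensor φ X x := by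
  induction x using Amalg.ind
  rename_i v ω
  change (φ g * v.val * (1 : P)⁻¹) • ((1 : P) • ω) = φ g • v.val • ω
  rw [one_smul, inv_one, mul_one, mul_smul]

theorem mark_act_res [Finite P] [Finite Q] (φ : Q →* P) (R : Subgroup Q) (s : Burn P) :
    mark R (act (res φ) s) = mark (R.map φ) s := by
  have h : mark R ∘ₗ act (res φ) = mark (R.map φ) := by
    refine hom_ext_cls fun L => ?_
    rw [LinearMap.comp_apply, res, act_cls, mark_cls, mark_cls, Nat.cast_inj]
    refine card_fixSet_congr _ _ (resATensor φ _) fun x => ?_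
    simp only [Subgroup.mem_map, forall_exists_index, and_imp, forall_apply_eq_imp_iff₂]
    refine forall₂_congr fun k _ => ?_
    rw [← (resATensor φ _).injective.eq_iff, resATensor_smul]
  exact LinearMap.congr_fun h s

theorem mulMap_cls [Finite P] (X : Type u) [MulAction P X] [Finite X] :
    mulMap P (cls P X) = cls (P × P) (MulSet P X) := by
  refine ext1_cls (fun X [MulAction P X] => cls (P × P) (MulSet P X)) ?_ ?_ X
  · intro X Y _ _ e
    exact cls_congr ⟨⟨fun x => ⟨e.toEquiv x.pt, x.val⟩, fun x => ⟨e.toEquiv.symm x.pt, x.val⟩,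
      fun x => MulSet.ext (e.toEquiv.symm_apply_apply _) rfl,
      fun x => MulSet.ext (e.toEquiv.apply_symm_apply _) rfl⟩,
      fun g x => MulSet.ext (e.map_smul g.1 x.pt) rfl⟩
  · intro ι _ X _ _
    rw [← cls_sigma]
    exact cls_congr ⟨⟨fun x => ⟨x.pt.1, ⟨x.pt.2, x.val⟩⟩, fun x => ⟨⟨x.1, x.2.pt⟩, x.2.val⟩,
      fun _ => rfl, fun _ => rfl⟩, fun _ _ => rfl⟩

/-- The set `m_X ×_P Ω` is `X × Ω`. -/
def mulTensor (X Ω : Type u) [MulAction P X] [MulAction (P × K) Ω] :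
    BTensor P P K (MulSet P X) Ω ≃ X × Ω where
  toFun := Amalg.lift (fun z ω => (z.pt, (z.val, (1 : K)) • ω)) (by
    intro z ω u
    change (z.pt, (z.val, (1 : K)) • ω) =
      ((1 : P) • z.pt, ((1 : P) * z.val * u⁻¹, (1 : K)) • ((u, (1 : K)) • ω))
    rw [← mul_smul, one_smul]; simp)
  invFun x := Amalg.mk ⟨x.1, 1⟩ x.2
  left_inv := by
    intro a
    induction a using Amalg.ind
    rename_i z ω
    refine Amalg.mk_eq_mk.2 ⟨z.val⁻¹, ?_, ?_⟩
    · ext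
      · change z.pt = (1 : P) • z.pt
        rw [one_smul]
      · change z.val = 1 * 1 * (z.val⁻¹)⁻¹
        simp
    · change ω = (z.val⁻¹, (1 : K)) • (z.val, (1 : K)) • ω
      rw [← mul_smul, Prod.mk_mul_mk, inv_mul_cancel, one_mul]
      exact (one_smul (P × K) ω).symm
  right_inv x := Prod.ext rfl (one_smul (P × K) x.2)

theorem mulTensor_smul (X Ω : Type u) [MulAction P X] [MulAction (P × K) Ω] (g : P × K)
    (x : BTensor P P K (MulSet P X) Ω) :
    mulTensor X Ω (g • x) = (g.1 • (mulTensor X Ω x).1, g • (mulTensor X Ω x).2) := by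
  induction x using Amalg.ind
  rename_i v ω
  change (g.1 • v.pt, (g.1 * v.val * (1 : P)⁻¹, (1 : K)) • (((1 : P), g.2) • ω)) =
    (g.1 • v.pt, g • (v.val, (1 : K)) • ω)
  rw [← mul_smul, ← mul_smul]
  congr 2
  simp [Prod.ext_iff]

/-- On m_X ×_P Ω ≅ X × Ω the group acts on X through its first component. -/
theorem mark_mulMap_comp [Finite P] [Finite K] (D : Subgroup (P × K)) (s : Burn P)
    (f : Burn (P × K)) : mark D (comp (mulMap P s) f) =
      mark (D.map (MonoidHom.fst P K)) s * mark D f := by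
  have h : (comp ∘ₗ mulMap P).compr₂ (mark D) =
      (LinearMap.mul ℤ ℤ).compl₁₂ (mark (D.map (MonoidHom.fst P K))) (mark D) := by
    refine hom_ext_cls fun L => hom_ext_cls fun L' => ?_
    simp only [LinearMap.compr₂_apply, LinearMap.compl₁₂_apply, LinearMap.mul_apply',
      LinearMap.comp_apply, mulMap_cls, comp_cls, mark_cls]
    rw [← Nat.cast_mul, ← Nat.card_prod, Nat.cast_inj]
    refine Nat.card_congr (Equiv.trans ((mulTensor _ _).subtypeEquiv
      (q := fun x => x.1 ∈ fixSet (D.map (MonoidHom.fst P K)) _ ∧ x.2 ∈ fixSet D _) fun x => ?_)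
      (Equiv.subtypeProdEquivProd))
    simp only [mem_fixSet, Subgroup.mem_map, forall_exists_index, and_imp,
      forall_apply_eq_imp_iff₂, ← forall_and]
    refine forall₂_congr fun k _ => ?_
    rw [← (mulTensor _ _).injective.eq_iff, mulTensor_smul, Prod.ext_iff]
    rfl
  exact LinearMap.congr_fun (LinearMap.congr_fun h s) f

/-- The set `Ω ×_P m_X` is `X × Ω`. -/
def tensorMul (X Ω : Type u) [MulAction P X] [MulAction (K × P) Ω] :
    BTensor K P P Ω (MulSet P X) ≃ X × Ω where
  -- Each orbit has a unique representative whose `val` is 1, obtained by acting with the inverse of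
  -- `z.val`.
  toFun := Amalg.lift (fun ω z => (z.val⁻¹ • z.pt, ((1 : K), z.val⁻¹) • ω)) (by
    intro ω z u
    change (z.val⁻¹ • z.pt, ((1 : K), z.val⁻¹) • ω) =
      ((u * z.val * (1 : P)⁻¹)⁻¹ • u • z.pt,
        ((1 : K), (u * z.val * (1 : P)⁻¹)⁻¹) • (((1 : K), u) • ω))
    rw [← mul_smul, ← mul_smul]; simp)
  invFun x := Amalg.mk x.2 ⟨x.1, 1⟩
  left_inv := by
    intro a
    induction a using Amalg.ind
    rename_i ω z
    refine Amalg.mk_eq_mk.2 ⟨z.val, ?_, ?_⟩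
    · change ω = ((1 : K), z.val) • ((1 : K), z.val⁻¹) • ω
      rw [← mul_smul, Prod.mk_mul_mk, mul_inv_cancel, one_mul]
      exact (one_smul (K × P) ω).symm
    · ext
      · change z.pt = z.val • z.val⁻¹ • z.pt
        rw [smul_inv_smul]
      · change z.val = z.val * 1 * (1 : P)⁻¹
        simp
  right_inv x := by
    change ((1 : P)⁻¹ • x.1, ((1 : K), (1 : P)⁻¹) • x.2) = x
    rw [inv_one, one_smul]
    exact Prod.ext rfl (one_smul (K × P) x.2)

theorem tensorMul_smul (X Ω : Type u) [MulAction P X] [MulAction (K × P) Ω] (g : K × P)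
    (x : BTensor K P P Ω (MulSet P X)) :
    tensorMul X Ω (g • x) = (g.2 • (tensorMul X Ω x).1, g • (tensorMul X Ω x).2) := by
  induction x using Amalg.ind
  rename_i ω z
  change (((1 : P) * z.val * g.2⁻¹)⁻¹ • (1 : P) • z.pt,
    ((1 : K), ((1 : P) * z.val * g.2⁻¹)⁻¹) • ((g.1, (1 : P)) • ω)) =
    (g.2 • z.val⁻¹ • z.pt, g • ((1 : K), z.val⁻¹) • ω)
  rw [← mul_smul, ← mul_smul, ← mul_smul, ← mul_smul]
  congr 2
  · simp
  · simp [Prod.ext_iff]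

/-- Multiplying on the right makes the second projection of D act on X. This is the only difference
from left multiplication, so commutation with m_s amounts to comparing the marks of s at the two
projections. -/
theorem mark_comp_mulMap [Finite P] [Finite K] (D : Subgroup (K × P)) (s : Burn P)
    (f : Burn (K × P)) : mark D (comp f (mulMap P s)) =
      mark (D.map (MonoidHom.snd K P)) s * mark D f := by
  have h : (comp.flip ∘ₗ mulMap P).compr₂ (mark D) =
      (LinearMap.mul ℤ ℤ).compl₁₂ (mark (D.map (MonoidHom.snd K P))) (mark D) := by
    refine hom_ext_cls fun L => hom_ext_cls fun L' => ?_
    simp only [LinearMap.compr₂_apply, LinearMap.compl₁₂_apply, LinearMap.mul_apply',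
      LinearMap.comp_apply, LinearMap.flip_apply, mulMap_cls, comp_cls, mark_cls]
    rw [← Nat.cast_mul, ← Nat.card_prod, Nat.cast_inj]
    refine Nat.card_congr (Equiv.trans ((tensorMul _ _).subtypeEquiv
      (q := fun x => x.1 ∈ fixSet (D.map (MonoidHom.snd K P)) _ ∧ x.2 ∈ fixSet D _) fun x => ?_)
      (Equiv.subtypeProdEquivProd))
    simp only [mem_fixSet, Subgroup.mem_map, forall_exists_index, and_imp,
      forall_apply_eq_imp_iff₂, ← forall_and]
    refine forall₂_congr fun k _ => ?_
    rw [← (tensorMul _ _).injective.eq_iff, tensorMul_smul, Prod.ext_iff]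
    rfl
  exact LinearMap.congr_fun (LinearMap.congr_fun h s) f

/-- The `G`-sets `(Ω ×_H Ω') ×_K X` and `Ω ×_H (Ω' ×_K X)` are isomorphic. -/
def actAssoc (Ω Ω' X : Type u) [MulAction (G × H) Ω] [MulAction (H × K) Ω']
    [MulAction K X] : GEquiv G (ATensor G K (BTensor G H K Ω Ω') X)
      (ATensor G H Ω (ATensor H K Ω' X)) where
  toFun := Amalg.lift (fun a x => Amalg.lift (fun ω ω' => Amalg.mk ω (Amalg.mk ω' x)) (by
      intro ω ω' u
      refine Amalg.mk_eq_mk.2 ⟨u, rfl, ?_⟩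
      change Amalg.mk ((u, (1 : K)) • ω') x = Amalg.mk ((u, (1 : K)) • ω') ((1 : K) • x)
      rw [one_smul]) a) (by
    intro a x u
    induction a using Amalg.ind
    rename_i ω ω'
    change Amalg.mk ω (Amalg.mk ω' x) = Amalg.mk ((1 : G × H) • ω)
      (Amalg.mk (((1 : H), u) • ω') (u • x))
    rw [one_smul]
    congr 1
    exact Amalg.mk_eq_mk.2 ⟨u, rfl, rfl⟩)
  invFun := Amalg.lift (fun ω a => Amalg.lift (fun ω' x => Amalg.mk (Amalg.mk ω ω') x) (by
      intro ω' x u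
      refine Amalg.mk_eq_mk.2 ⟨u, ?_, rfl⟩
      change Amalg.mk ω (((1 : H), u) • ω') =
        Amalg.mk ((1 : G × H) • ω) (((1 : H), u) • ω')
      rw [one_smul]) a) (by
    intro ω a u
    induction a using Amalg.ind
    rename_i ω' x
    change Amalg.mk (Amalg.mk ω ω') x = Amalg.mk (Amalg.mk (((1 : G), u) • ω) ((u, (1 : K)) • ω'))
      ((1 : K) • x)
    rw [one_smul]
    congr 1
    exact Amalg.mk_eq_mk.2 ⟨u, rfl, rfl⟩)
  left_inv := by
    intro a
    induction a using Amalg.ind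
    rename_i a x
    induction a using Amalg.ind
    rfl
  right_inv := by
    intro a
    induction a using Amalg.ind
    rename_i x a
    induction a using Amalg.ind
    rfl
  map_smul' g := by
    intro a
    induction a using Amalg.ind
    rename_i a x
    induction a using Amalg.ind
    rename_i ω ω'
    change Amalg.mk ((g, (1 : H)) • ω) (Amalg.mk ((1 : H × K) • ω') ((1 : K) • x)) =
      Amalg.mk ((g, (1 : H)) • ω) (Amalg.mk (((1 : H), (1 : K)) • ω') ((1 : K) • x))
    rfl

theorem act_comp [Finite G] [Finite H] [Finite K] (a : Burn (G × H)) (b : Burn (H × K))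
    (s : Burn K) : act (comp a b) s = act a (act b s) := by
  induction a using induction_on with
  | zero => simp only [map_zero, LinearMap.zero_apply]
  | add a a' h h' => simp only [map_add, LinearMap.add_apply, h, h']
  | neg a h => simp only [map_neg, LinearMap.neg_apply, h]
  | basis q =>
  induction b using induction_on with
  | zero => simp only [map_zero, LinearMap.zero_apply]
  | add a a' h h' => simp only [map_add, LinearMap.add_apply, h, h']
  | neg a h => simp only [map_neg, LinearMap.neg_apply, h]
  | basis r =>
  induction s using induction_on with
  | zero => simp only [map_zero]
  | add a a' h h' => simp only [map_add, h, h']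
  | neg a h => simp only [map_neg, h]
  | basis s =>
  rw [← cls_out q, ← cls_out r, ← cls_out s, comp_cls, act_cls, act_cls, act_cls]
  exact cls_congr (actAssoc _ _ _)

/-- The `P`-set `m_X ×_P Y` is `X × Y`. -/
def mulATensor (X Y : Type u) [MulAction P X] [MulAction P Y] :
    GEquiv P (ATensor P P (MulSet P X) Y) (X × Y) where
  toFun := Amalg.lift (fun z y => (z.pt, z.val • y)) (by
    intro z y u
    change (z.pt, z.val • y) = ((1 : P) • z.pt, ((1 : P) * z.val * u⁻¹) • (u • y))
    rw [← mul_smul, one_smul]; simp)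
  invFun x := Amalg.mk ⟨x.1, 1⟩ x.2
  left_inv := by
    intro a
    induction a using Amalg.ind
    rename_i z y
    refine Amalg.mk_eq_mk.2 ⟨z.val⁻¹, ?_, ?_⟩
    · ext
      · change z.pt = (1 : P) • z.pt
        rw [one_smul]
      · change z.val = 1 * 1 * (z.val⁻¹)⁻¹
        simp
    · change y = z.val⁻¹ • z.val • y
      rw [inv_smul_smul]
  right_inv x := Prod.ext rfl (one_smul P x.2)
  map_smul' g := by
    intro a
    induction a using Amalg.ind
    rename_i z y
    change (g • z.pt, (g * z.val * (1 : P)⁻¹) • (1 : P) • y) = (g • z.pt, g • z.val • y)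
    rw [← mul_smul, ← mul_smul]; simp

theorem act_mulMap [Finite P] (s t : Burn P) : act (mulMap P s) t = s * t := by
  have h : act ∘ₗ mulMap P = ext2 fun K L => cls P ((P ⧸ K) × (P ⧸ L)) := by
    refine hom_ext_cls fun L => hom_ext_cls fun L' => ?_
    rw [LinearMap.comp_apply, mulMap_cls, act_cls, ← mul_def, cls_mul_cls]
    exact cls_congr (mulATensor _ _)
  exact LinearMap.congr_fun (LinearMap.congr_fun h s) t

end Formulas

end Burn

/-! ### Fixed points of Ω ×_P 1 and factorization of the basis elements. -/

namespace Burn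

section

variable {P : Type u} [Group P]

/-- The graph `{(u, ψ u)}` of a homomorphism from `R`. -/
def coGraph {R : Subgroup P} (ψ : R →* P) : Subgroup (P × P) := (R.subtype.prod ψ).range

/-- Both sides count the set T of those ω such that every u in R has some v with (u, v)ω = ω. The
right action is free, so T is the union of the R-fixed right orbits, each of order |P|. By freeness
v is unique, hence u ↦ v is a homomorphism ψ, and T is the disjoint union of the sets fixed by the
graphs `coGraph ψ`. -/
theorem card_mul_card_fixSet_atensor (Ω : Type u) [MulAction (P × P) Ω] [Finite Ω]
    (hfree : ∀ (v : P) (ω : Ω), ((1 : P), v) • ω = ω → v = 1) (R : Subgroup P)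
    [Fintype (R →* P)] :
    Nat.card P * Nat.card (fixSet R (ATensor P P Ω (P ⧸ (⊤ : Subgroup P)))) =
      ∑ ψ : R →* P, Nat.card (fixSet (coGraph ψ) Ω) := by
  have hsub : Subsingleton (P ⧸ (⊤ : Subgroup P)) := QuotientGroup.subsingleton_quotient_top
  let T : Set Ω := {ω | ∀ u ∈ R, ∃ v : P, (u, v) • ω = ω}
  let pt : P ⧸ (⊤ : Subgroup P) := ((1 : P) : P ⧸ (⊤ : Subgroup P))
  have hmk : ∀ ω ω' : Ω, (Amalg.mk ω pt : ATensor P P Ω (P ⧸ (⊤ : Subgroup P))) = Amalg.mk ω' pt ↔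
      ∃ v : P, ω' = ((1 : P), v) • ω := fun ω ω' => by
    rw [Amalg.mk_eq_mk]
    exact exists_congr fun u => ⟨fun h => h.1, fun h => ⟨h, Subsingleton.elim _ _⟩⟩
  have hfix : ∀ ω : Ω, (Amalg.mk ω pt : ATensor P P Ω (P ⧸ (⊤ : Subgroup P))) ∈ fixSet R _ ↔
      ω ∈ T := by
    intro ω
    refine forall₂_congr fun u hu => ?_
    have h : u • (Amalg.mk ω pt : ATensor P P Ω (P ⧸ (⊤ : Subgroup P))) =
        Amalg.mk ((u, (1 : P)) • ω) pt := by
      rw [Amalg.smul_mk]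
      exact congrArg _ (Subsingleton.elim _ _)
    rw [h, hmk]
    refine exists_congr fun v => ?_
    rw [← mul_smul, Prod.mk_mul_mk, one_mul, mul_one, eq_comm]
  have hT1 : Nat.card T =
      Nat.card P * Nat.card (fixSet R (ATensor P P Ω (P ⧸ (⊤ : Subgroup P)))) := by
    have hsec : ∀ x : ATensor P P Ω (P ⧸ (⊤ : Subgroup P)), ∃ ω : Ω, Amalg.mk ω pt = x := by
      intro x
      induction x using Amalg.ind
      rename_i ω y
      exact ⟨ω, by rw [Subsingleton.elim pt y]⟩
    choose σ hσ using hsec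
    rw [← Nat.card_prod]
    symm
    refine Nat.card_congr (Equiv.ofBijective
      (fun a => ⟨((1 : P), a.1) • σ a.2.1, (hfix _).1 ?_⟩) ⟨?_, ?_⟩)
    · have h : (Amalg.mk (((1 : P), a.1) • σ a.2.1) pt :
          ATensor P P Ω (P ⧸ (⊤ : Subgroup P))) = a.2.1 := by
        rw [← hσ a.2.1]
        symm
        rw [hmk, hσ]
        exact ⟨a.1, rfl⟩
      rw [h]
      exact a.2.2
    · rintro ⟨v, x, hx⟩ ⟨v', x', hx'⟩ h
      have h : ((1 : P), v) • σ x = ((1 : P), v') • σ x' := congrArg Subtype.val h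
      have hxx : x = x' := by
        rw [← hσ x, ← hσ x', hmk]
        refine ⟨v'⁻¹ * v, ?_⟩
        have : ((1 : P), v'⁻¹ * v) = ((1 : P), v')⁻¹ * ((1 : P), v) := by simp
        rw [this, mul_smul, h, inv_smul_smul]
      subst hxx
      have : v'⁻¹ * v = 1 := hfree _ (σ x) (by
        have : ((1 : P), v'⁻¹ * v) = ((1 : P), v')⁻¹ * ((1 : P), v) := by simp
        rw [this, mul_smul, h, inv_smul_smul])
      rw [inv_mul_eq_one] at this
      subst this
      rfl
    · rintro ⟨ω, hω⟩
      have hx := (hfix ω).2 hω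
      obtain ⟨v, hv⟩ := (hmk (σ (Amalg.mk ω pt)) ω).1 (hσ _)
      exact ⟨⟨v, Amalg.mk ω pt, hx⟩, Subtype.ext hv.symm⟩
  rw [← hT1, ← Nat.card_sigma]
  -- Uniqueness makes the sets fixed by different graphs disjoint, and below it turns the choice of
  -- v for each u into a homomorphism.
  have huniq : ∀ (ω : Ω) (u v v' : P), (u, v) • ω = ω → (u, v') • ω = ω → v = v' := by
    intro ω u v v' h h'
    have : v'⁻¹ * v = 1 := hfree _ ω (by
      have : ((1 : P), v'⁻¹ * v) = (u, v')⁻¹ * (u, v) := by simp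
      rw [this, mul_smul, h, inv_smul_eq_iff, h'])
    rw [inv_mul_eq_one] at this
    exact this.symm
  symm
  refine Nat.card_congr (Equiv.ofBijective (fun a => ⟨a.2.1, fun u hu => ⟨a.1 ⟨u, hu⟩,
    a.2.2 _ ⟨⟨u, hu⟩, rfl⟩⟩⟩) ⟨?_, ?_⟩)
  · rintro ⟨ψ, ω, h⟩ ⟨ψ', ω', h'⟩ he
    have he : ω = ω' := congrArg Subtype.val he
    subst he
    have : ψ = ψ' := by
      ext u
      exact huniq ω u _ _ (h _ ⟨u, rfl⟩) (h' _ ⟨u, rfl⟩)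
    subst this
    rfl
  · rintro ⟨ω, hω⟩
    have hω' : ∀ u ∈ R, ∃ v : P, (u, v) • ω = ω := hω
    choose g hg using hω'
    refine ⟨⟨⟨⟨fun u => g u u.2, ?_⟩, ?_⟩, ω, ?_⟩, rfl⟩
    · exact huniq ω 1 _ _ (hg _ _) (one_smul (P × P) ω)
    · intro u v
      refine huniq ω (u * v) _ _ (hg _ _) ?_
      change (((u : P) * v, g u u.2 * g v v.2) : P × P) • ω = ω
      have : (((u : P) * v, g u u.2 * g v v.2) : P × P) =
        ((u : P), g u u.2) * ((v : P), g v v.2) := rfl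
      rw [this, mul_smul, hg, hg]
    · rintro _ ⟨u, rfl⟩
      exact hg _ u.2

end

variable {P : Type u} [Group P] [Finite P]

/-- `P × P` is transitive on res_φ° ×_Q res_ι, and the stabilizer of the class of (1, 1) consists of
the pairs (φ(u), u). -/
theorem toBurn_indecElt {Q : Subgroup P} (φ : Q →* P) :
    DBurn.toBurn (indecElt φ) = comp (opp (res φ)) (res Q.subtype) := by
  rw [indecElt, LinearEquiv.apply_symm_apply, res, res, opp_cls, comp_cls]
  symm
  refine cls_eq_of_transitive (Amalg.mk (OppSet.mk ⟨1⟩) ⟨1⟩) (fun y => ?_) ?_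
  · induction y using Amalg.ind
    rename_i v w
    refine ⟨(v.val.val⁻¹, w.val⁻¹), Amalg.mk_eq_mk.2 ⟨1, ?_, ?_⟩⟩
    · refine OppSet.ext (ResSet.ext ?_)
      change v.val.val = φ 1 * (φ 1 * 1 * v.val.val⁻¹⁻¹) * (1 : P)⁻¹
      simp
    · refine ResSet.ext ?_
      change w.val = Q.subtype 1 * (Q.subtype 1 * 1 * w.val⁻¹⁻¹) * (1 : P)⁻¹
      simp
  · ext ⟨a, b⟩
    rw [MulAction.mem_stabilizer_iff, Amalg.smul_mk, Amalg.mk_eq_mk, mem_graphSubgroup]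
    have : ∀ u : Q, ((OppSet.mk ⟨1⟩ : OppSet Q P (ResSet φ)) =
        outerLeft P Q P (1, u) • outerLeft P Q P ((a, b), 1) • OppSet.mk ⟨1⟩ ∧
        (⟨1⟩ : ResSet Q.subtype) =
        outerRight P Q P (1, u) • outerRight P Q P ((a, b), 1) • ⟨1⟩) ↔ φ u = a ∧ (u : P) = b := by
      intro u
      rw [OppSet.ext_iff, ResSet.ext_iff, ResSet.ext_iff]
      change (1 = φ u * (φ 1 * 1 * a⁻¹) * (1 : P)⁻¹ ∧
        1 = (u : P) * (Q.subtype 1 * 1 * b⁻¹) * (1 : P)⁻¹) ↔ _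
      simp only [map_one, one_mul, inv_one, mul_one]
      rw [eq_comm, mul_inv_eq_one, eq_comm (b := (u : P) * b⁻¹), mul_inv_eq_one]
    simp only [this]
    constructor
    · rintro ⟨u, h1, rfl⟩
      exact ⟨u.2, h1⟩
    · rintro ⟨h1, h2⟩
      exact ⟨⟨b, h1⟩, h2, rfl⟩

/-- The orbits of Q on pairs (v, w), under simultaneous left multiplication by φ(u), are separated
by the invariants v⁻¹φ(Q) and v⁻¹w. -/
theorem comp_opp_res_res {Q : Subgroup P} (φ : Q →* P) :
    comp (opp (res φ)) (res φ) = mulMap P (cls P (P ⧸ φ.range)) := by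
  rw [mulMap_cls, res, opp_cls, comp_cls]
  have hinv : ∀ (v : OppSet Q P (ResSet φ)) (w : ResSet φ) (u : Q),
      (⟨((v.val.val⁻¹ : P) : P ⧸ φ.range), v.val.val⁻¹ * w.val⟩ : MulSet P (P ⧸ φ.range)) =
      ⟨((φ u * v.val.val * (1 : P)⁻¹)⁻¹ : P),
        (φ u * v.val.val * (1 : P)⁻¹)⁻¹ * (φ u * w.val * (1 : P)⁻¹)⟩ := by
    intro v w u
    refine MulSet.ext ?_ ?_
    · rw [QuotientGroup.eq]
      refine ⟨u⁻¹, ?_⟩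
      simp
    · simp [mul_assoc]
  refine cls_congr ⟨Equiv.ofBijective (Amalg.lift (fun v w => ⟨((v.val.val⁻¹ : P) : P ⧸ φ.range),
    v.val.val⁻¹ * w.val⟩) hinv) ⟨?_, ?_⟩, ?_⟩
  · intro x y h
    induction x using Amalg.ind
    induction y using Amalg.ind
    rename_i v w v' w'
    obtain ⟨h1, h2⟩ := MulSet.ext_iff.1 h
    obtain ⟨u, hu⟩ := QuotientGroup.eq.1 h1
    change v.val.val⁻¹ * w.val = v'.val.val⁻¹ * w'.val at h2
    have hv : v'.val.val = φ u⁻¹ * v.val.val := by rw [map_inv, hu]; simp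
    have hw : w'.val = φ u⁻¹ * w.val := by
      rw [hv] at h2
      have := congrArg (fun z => φ u⁻¹ * v.val.val * z) h2
      simpa [mul_assoc] using this.symm
    refine Amalg.mk_eq_mk.2 ⟨u⁻¹, OppSet.ext (ResSet.ext ?_), ResSet.ext ?_⟩
    · change v'.val.val = φ u⁻¹ * v.val.val * (1 : P)⁻¹
      simp [hv]
    · change w'.val = φ u⁻¹ * w.val * (1 : P)⁻¹
      simp [hw]
  · rintro ⟨x, y⟩
    induction x using Quotient.inductionOn'
    rename_i x
    refine ⟨Amalg.mk ⟨⟨x⁻¹⟩⟩ ⟨x⁻¹ * y⟩, MulSet.ext ?_ ?_⟩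
    · change (((x⁻¹)⁻¹ : P) : P ⧸ φ.range) = (x : P ⧸ φ.range)
      rw [inv_inv]
    · change (x⁻¹)⁻¹ * (x⁻¹ * y) = y
      simp
  · rintro ⟨a, b⟩ x
    induction x using Amalg.ind
    rename_i v w
    refine MulSet.ext ?_ ?_
    · change ((((φ 1 * v.val.val * a⁻¹)⁻¹ : P)) : P ⧸ φ.range) =
        ((a * v.val.val⁻¹ : P) : P ⧸ φ.range)
      simp
    · change (φ 1 * v.val.val * a⁻¹)⁻¹ * (φ 1 * w.val * b⁻¹) = a * (v.val.val⁻¹ * w.val) * b⁻¹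
      simp [mul_assoc]

/-- Dividing (P × P)/Δ_φ(Q) by the right action of P leaves a transitive P-set, in which the class
of 1 is stabilized by the a with (a, u) in the graph for some u. -/
theorem act_indecElt_one {Q : Subgroup P} (φ : Q →* P) :
    act (DBurn.toBurn (indecElt φ)) 1 = cls P (P ⧸ φ.range) := by
  have : Subsingleton (P ⧸ (⊤ : Subgroup P)) := QuotientGroup.subsingleton_quotient_top
  rw [indecElt, LinearEquiv.apply_symm_apply, one_eq, act_cls]
  refine cls_eq_of_transitive (Amalg.mk ((1 : P × P) : (P × P) ⧸ graphSubgroup φ)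
    ((1 : P) : P ⧸ (⊤ : Subgroup P))) (fun y => ?_) ?_
  · induction y using Amalg.ind
    rename_i x y
    induction x using Quotient.inductionOn'
    rename_i x
    refine ⟨x.1, Amalg.mk_eq_mk.2 ⟨x.2, ?_, Subsingleton.elim _ _⟩⟩
    change (x : (P × P) ⧸ graphSubgroup φ) =
      (((1, x.2) * ((x.1, 1) * 1) : P × P) : (P × P) ⧸ graphSubgroup φ)
    congr 1
    simp
  · ext a
    rw [MulAction.mem_stabilizer_iff, Amalg.smul_mk, Amalg.mk_eq_mk]
    have : ∀ u : P, (((1 : P × P) : (P × P) ⧸ graphSubgroup φ) = MonoidHom.id (P × P) (1, u) •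
        MonoidHom.id (P × P) (a, 1) • ((1 : P × P) : (P × P) ⧸ graphSubgroup φ) ∧
        ((1 : P) : P ⧸ (⊤ : Subgroup P)) = MonoidHom.snd P P (1, u) •
        MonoidHom.snd P P (a, 1) • ((1 : P) : P ⧸ (⊤ : Subgroup P))) ↔
        (a, u) ∈ graphSubgroup φ := by
      intro u
      rw [and_iff_left (Subsingleton.elim _ _)]
      change ((1 : P × P) : (P × P) ⧸ graphSubgroup φ) =
        (((1, u) * ((a, 1) * 1) : P × P) : (P × P) ⧸ graphSubgroup φ) ↔ _
      rw [QuotientGroup.eq]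
      simp
    simp only [this, mem_graphSubgroup]
    exact ⟨fun ⟨u, h, e⟩ => ⟨_, e⟩, fun ⟨u, e⟩ => ⟨u, u.2, e⟩⟩

end Burn

/-! ### The identity h · f = m_{h(1)} · f, and marks away from graphs. -/

namespace DivisibleCategory

variable {P : Type u} [Group P] (F : DivisibleCategory P)

open Burn

variable {F} in
-- D is the composite of the graph E with the diagonal of the second projection of D, and graphs are
-- closed under composition.
theorem isGraph_of_le {D E : Subgroup (P × P)} (hE : F.IsGraph E) (h : D ≤ E) : F.IsGraph D := by
  refine isGraph_star (E := graphSubgroup (D.map (MonoidHom.snd P P)).subtype) hE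
    ⟨_, _, F.isMor_subtype _, rfl⟩ fun a b => ?_
  simp only [mem_graphSubgroup]
  constructor
  · intro hab
    exact ⟨b, h hab, ⟨(a, b), hab, rfl⟩, rfl⟩
  · rintro ⟨u, hu, ⟨⟨a', b'⟩, hab, rfl⟩, he⟩
    change b' = u at he
    subst he
    obtain ⟨Q, φ, -, rfl⟩ := hE
    obtain ⟨h1, h2⟩ := mem_graphSubgroup.1 hu
    obtain ⟨h3, h4⟩ := mem_graphSubgroup.1 (h hab)
    have : a = a' := h2.symm.trans h4
    rw [this]
    exact hab

variable [Finite P]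

theorem hecke_induction {F : DivisibleCategory P} {p : DBurn P → Prop} (f : F.hecke)
    (basis : ∀ (Q : Subgroup P) (φ : Q →* P), F.IsMor φ → p (indecElt φ))
    (zero : p 0) (add : ∀ a b, p a → p b → p (a + b)) (smul : ∀ (n : ℤ) a, p a → p (n • a)) :
    p (f : DBurn P) := by
  obtain ⟨f, hf⟩ := f
  change f ∈ F.heckeModule at hf
  change p f
  induction hf using Submodule.span_induction with
  | zero => exact zero
  | add x y _ _ hx hy => exact add _ _ hx hy
  | smul n x _ hx => exact smul n x hx
  | mem x hx =>
    obtain ⟨Q, φ, hφ, rfl⟩ := hx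
    exact basis Q φ hφ

/-- By linearity a basis element suffices. There the right action of P is free, because stabilizers
are graphs of injective homomorphisms and so contain no (1, v) with v ≠ 1. -/
theorem card_mul_mark_eval (f : F.hecke) (R : Subgroup P) [Fintype (R →* P)] :
    (Nat.card P : ℤ) * mark R (F.eval f) =
      ∑ ψ : R →* P, mark (coGraph ψ) (DBurn.toBurn (f : DBurn P)) := by
  change (Nat.card P : ℤ) * mark R (act (DBurn.toBurn (f : DBurn P)) 1) = _
  refine hecke_induction (F := F)
    (p := fun f => (Nat.card P : ℤ) * mark R (act (DBurn.toBurn f) 1) =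
      ∑ ψ : R →* P, mark (coGraph ψ) (DBurn.toBurn f)) f ?_ ?_ ?_ ?_
  · intro Q φ hφ
    rw [indecElt, LinearEquiv.apply_symm_apply, one_eq, act_cls, mark_cls]
    simp only [mark_cls]
    rw [← Nat.cast_mul, ← Nat.cast_sum, Nat.cast_inj]
    refine card_mul_card_fixSet_atensor _ ?_ R
    intro v ω h
    have := isGraph_stabilizer ⟨Q, φ, hφ, rfl⟩ ω
    obtain ⟨Q', φ', hφ', he⟩ := this
    have hm : ((1 : P), v) ∈ MulAction.stabilizer (P × P) ω := h
    rw [he, mem_graphSubgroup] at hm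
    obtain ⟨h1, h2⟩ := hm
    have hinj := F.injective hφ'
    have : (⟨v, h1⟩ : Q') = 1 := hinj (by simp [h2])
    exact congrArg Subtype.val this
  · simp
  · intro a b ha hb
    simp only [map_add, LinearMap.add_apply, mul_add, ha, hb, Finset.sum_add_distrib]
  · intro n a ha
    simp only [map_smul, LinearMap.smul_apply, mul_smul_comm, ha, Finset.smul_sum]

/-- For h = f_{Q,φ}: h f = res_φ° res_ι f = res_φ° res_φ f = m_{P/φ(Q)} f, and P/φ(Q) = h(1).
Multiplication on the left of H^F thus depends only on the evaluation; the algebra structure in the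
theorem follows from this. -/
theorem mul_eq_mulHecke_eval_mul (h f : F.hecke) (hf : f ∈ F.heckeInv) :
    h * f = F.mulHecke (F.eval h) * f := by
  apply Subtype.ext
  apply DBurn.toBurn.injective
  change comp (DBurn.toBurn (h : DBurn P)) (DBurn.toBurn (f : DBurn P)) =
    comp (mulMap P (act (DBurn.toBurn (h : DBurn P)) 1)) (DBurn.toBurn (f : DBurn P))
  refine hecke_induction (F := F)
    (p := fun h => comp (DBurn.toBurn h) (DBurn.toBurn (f : DBurn P)) =
    comp (mulMap P (act (DBurn.toBurn h) 1)) (DBurn.toBurn (f : DBurn P))) h ?_ ?_ ?_ ?_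
  · intro Q φ hφ
    rw [act_indecElt_one, ← comp_opp_res_res, comp_assoc, (hf Q φ hφ).1, ← comp_assoc,
      toBurn_indecElt]
  · simp
  · intro a b ha hb
    simp only [map_add, LinearMap.add_apply, ha, hb]
  · intro n a ha
    simp only [map_smul, LinearMap.smul_apply, ha]

/-- A subgroup with a fixed point in (P × P)/Δ_φ(Q) lies in a stabilizer, which is a graph, and
subgroups of graphs are graphs. -/
theorem mark_eq_zero_of_not_isGraph (f : F.hecke) {D : Subgroup (P × P)} (hD : ¬ F.IsGraph D) :
    mark D (DBurn.toBurn (f : DBurn P)) = 0 := by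
  refine hecke_induction (F := F) (p := fun f => mark D (DBurn.toBurn f) = 0) f ?_ ?_ ?_ ?_
  · intro Q φ hφ
    by_contra hne
    rw [indecElt, LinearEquiv.apply_symm_apply, mark_cls] at hne
    have h' : Nat.card (fixSet D ((P × P) ⧸ graphSubgroup φ)) ≠ 0 := by exact_mod_cast hne
    obtain ⟨⟨x, hx⟩⟩ := (Nat.card_ne_zero.1 h').1
    exact hD (isGraph_of_le (isGraph_stabilizer ⟨Q, φ, hφ, rfl⟩ x) fun d hd => hx d hd)
  · simp
  · intro a b ha hb
    simp only [map_add, ha, hb, add_zero]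
  · intro n a ha
    simp only [map_smul, ha, smul_zero]

end DivisibleCategory

/-! ### Two facts on finite groups: a Sylow criterion and powers of p-power order. -/

/-- If a `p`-subgroup `S` of `A` contains all the `p`-elements of `A` which normalize it, then any
`p`-subgroup of `A` has a conjugate contained in `S`. -/
theorem exists_conj_le_of_normalizing {G : Type*} [Group G] [Finite G] {p : ℕ} [Fact p.Prime]
    {A S : Subgroup G} (hSA : S ≤ A) (hS : IsPGroup p S)
    (h : ∀ τ ∈ A, (∀ s ∈ S, τ * s * τ⁻¹ ∈ S) → (∃ k, τ ^ p ^ k = 1) → τ ∈ S)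
    {T : Subgroup G} (hTA : T ≤ A) (hT : IsPGroup p T) :
    ∃ θ ∈ A, ∀ t ∈ T, θ * t * θ⁻¹ ∈ S := by
  have hS' : IsPGroup p (S.subgroupOf A) :=
    hS.of_equiv (Subgroup.subgroupOfEquivOfLe hSA).symm
  have hT' : IsPGroup p (T.subgroupOf A) :=
    hT.of_equiv (Subgroup.subgroupOfEquivOfLe hTA).symm
  obtain ⟨X, hX⟩ := hS'.exists_le_sylow
  obtain ⟨Y, hY⟩ := hT'.exists_le_sylow
  have hXS : (X : Subgroup A) ≤ S.subgroupOf A := by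
    -- Otherwise S is proper in the nilpotent group X, so some x in X outside S normalizes S; it is
    -- a p-element, against the hypothesis. Hence S is itself Sylow in A.
    by_contra hne
    have hlt : (S.subgroupOf A).subgroupOf X < ⊤ := by
      rw [lt_top_iff_ne_top, Ne, Subgroup.subgroupOf_eq_top]
      exact hne
    have hnil : Group.IsNilpotent X := X.isPGroup'.isNilpotent
    obtain ⟨x, hx, hx'⟩ := SetLike.exists_of_lt (Group.normalizerCondition_of_isNilpotent _ hlt)
    apply hx'
    rw [Subgroup.mem_subgroupOf, Subgroup.mem_subgroupOf]
    refine h _ x.1.2 (fun s hs => ?_) ?_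
    · have hsX : (⟨s, hSA hs⟩ : A) ∈ X := hX hs
      exact (Subgroup.mem_normalizer_iff.1 hx ⟨⟨s, hSA hs⟩, hsX⟩).1 hs
    · obtain ⟨k, hk⟩ := X.isPGroup' x
      exact ⟨k, by
        have := congrArg (fun z : X => ((z : A) : G)) hk
        simpa using this⟩
  obtain ⟨θ, hθ⟩ := MulAction.exists_smul_eq A Y X
  refine ⟨θ, θ.2, fun t ht => ?_⟩
  have h1 : (⟨t, hTA ht⟩ : A) ∈ Y := hY ht
  have h2 : θ * ⟨t, hTA ht⟩ * θ⁻¹ ∈ X := by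
    rw [← hθ]
    exact ⟨_, h1, rfl⟩
  exact hXS h2

/-- Any element of a finite group has a power of `p`-power order which is equal to the element
modulo any prescribed power of `p`. -/
theorem exists_pow_isPElement {G : Type*} [Group G] [Finite G] {p : ℕ} (hp : p.Prime) (g : G)
    (a : ℕ) : ∃ k : ℕ, k ≡ 1 [MOD p ^ a] ∧ ∃ b, (g ^ k) ^ p ^ b = 1 := by
  -- With the order of g equal to p^b m and m prime to p, the Chinese remainder theorem gives k ≡ 1
  -- modulo p^a and k ≡ 0 modulo m.
  obtain ⟨b, m, hm, hb⟩ := Nat.exists_eq_pow_mul_and_not_dvd (orderOf_pos g).ne' p hp.ne_one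
  have hco : Nat.Coprime (p ^ a) m :=
    Nat.Coprime.pow_left a ((Nat.Prime.coprime_iff_not_dvd hp).2 hm)
  obtain ⟨k, hk1, hk2⟩ := Nat.chineseRemainder hco 1 0
  refine ⟨k, hk1, b, ?_⟩
  rw [← pow_mul, ← orderOf_dvd_iff_pow_eq_one, hb, mul_comm]
  exact Nat.mul_dvd_mul ((Nat.modEq_zero_iff_dvd).1 hk2) dvd_rfl

/-! ### Morphisms as maps on `P`, and the extension axiom. -/

namespace DivisibleCategory

variable {P : Type u} [Group P] (F : DivisibleCategory P)

/-- The restriction of the map `f` to the subgroup `Q` is a morphism from `Q` to `P`. -/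
def Mor (Q : Subgroup P) (f : P → P) : Prop :=
  ∃ φ : Q →* P, F.IsMor φ ∧ ∀ u : Q, φ u = f u

/-- The extension by `1` of a map on the subgroup `Q`. -/
def extFun {Q : Subgroup P} (φ : Q → P) (x : P) : P :=
  open Classical in if hx : x ∈ Q then φ ⟨x, hx⟩ else 1

theorem extFun_apply {Q : Subgroup P} (φ : Q → P) (u : Q) : extFun φ u = φ u := dif_pos u.2

/-- The subgroup generated by the image of `Q`. -/
def im (Q : Subgroup P) (f : P → P) : Subgroup P := Subgroup.closure (f '' Q)

variable {F}

theorem isMor_of_hom {Q R : Subgroup P} {φ : Q →* R} (h : φ ∈ F.Hom Q R) :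
    F.IsMor (R.subtype.comp φ) := isMor_comp (F.isMor_subtype R) h

theorem hom_of_isMor {Q R : Subgroup P} {φ : Q →* R} (h : F.IsMor (R.subtype.comp φ)) :
    φ ∈ F.Hom Q R := F.divisible φ (F.isMor_subtype R) h

namespace Mor

variable {Q R : Subgroup P} {f g : P → P}

theorem map_mul (hf : F.Mor Q f) {x y : P} (hx : x ∈ Q) (hy : y ∈ Q) : f (x * y) = f x * f y := by
  obtain ⟨φ, -, h⟩ := hf
  have := _root_.map_mul φ ⟨x, hx⟩ ⟨y, hy⟩
  rwa [h, h, h] at this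

theorem map_one (hf : F.Mor Q f) : f 1 = 1 := by
  obtain ⟨φ, -, h⟩ := hf
  have := _root_.map_one φ
  rwa [h] at this

theorem map_inv (hf : F.Mor Q f) {x : P} (hx : x ∈ Q) : f x⁻¹ = (f x)⁻¹ := by
  obtain ⟨φ, -, h⟩ := hf
  have := _root_.map_inv φ ⟨x, hx⟩
  rwa [h, h] at this

theorem injOn (hf : F.Mor Q f) : Set.InjOn f Q := by
  obtain ⟨φ, hφ, h⟩ := hf
  intro x hx y hy hxy
  have hinj := F.injective hφ
  have : (⟨x, hx⟩ : Q) = ⟨y, hy⟩ := hinj (by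
    change (Subgroup.topEquiv (G := P)).symm (φ _) = (Subgroup.topEquiv (G := P)).symm (φ _)
    rw [h, h]
    exact congrArg _ hxy)
  exact congrArg Subtype.val this

theorem congr (hf : F.Mor Q f) (h : ∀ u ∈ Q, f u = g u) : F.Mor Q g := by
  obtain ⟨φ, hφ, h'⟩ := hf
  exact ⟨φ, hφ, fun u => (h' u).trans (h u u.2)⟩

theorem mono (hf : F.Mor Q f) (h : R ≤ Q) : F.Mor R f := by
  obtain ⟨φ, hφ, h'⟩ := hf
  exact ⟨φ.comp (Subgroup.inclusion h), isMor_comp hφ (F.conj_mem _ 1 fun u => by simp),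
    fun u => h' _⟩

theorem comp (hg : F.Mor R g) (hf : F.Mor Q f) (h : ∀ u ∈ Q, f u ∈ R) :
    F.Mor Q (fun u => g (f u)) := by
  obtain ⟨φ, hφ, h1⟩ := hf
  obtain ⟨ψ, hψ, h2⟩ := hg
  have h3 : ∀ u : Q, φ u ∈ R := fun u => by rw [h1]; exact h u u.2
  refine ⟨ψ.comp (φ.codRestrict R h3), isMor_comp hψ (hom_of_isMor hφ), fun u => ?_⟩
  change ψ (φ.codRestrict R h3 u) = _
  rw [h2]
  change g (φ u) = _
  rw [h1]

theorem conj (Q : Subgroup P) (x : P) : F.Mor Q (fun u => x * u * x⁻¹) :=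
  ⟨(MulAut.conj x).toMonoidHom.comp Q.subtype, F.conj_mem _ x fun _ => rfl, fun _ => rfl⟩

theorem id (Q : Subgroup P) : F.Mor Q (fun u => u) := ⟨Q.subtype, F.isMor_subtype Q, fun _ => rfl⟩

theorem coe_im (hf : F.Mor Q f) : (im Q f : Set P) = f '' Q := by
  obtain ⟨φ, hφ, h⟩ := hf
  have h1 : f '' Q = (φ.range : Set P) := by
    ext y
    constructor
    · rintro ⟨x, hx, rfl⟩
      exact ⟨⟨x, hx⟩, h _⟩
    · rintro ⟨x, rfl⟩
      exact ⟨x, x.2, (h x).symm⟩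
  rw [im, h1, Subgroup.closure_eq]

theorem mem_im (hf : F.Mor Q f) {y : P} : y ∈ im Q f ↔ ∃ x ∈ Q, f x = y := by
  rw [← SetLike.mem_coe, hf.coe_im]; rfl

theorem apply_mem_im (hf : F.Mor Q f) {x : P} (hx : x ∈ Q) : f x ∈ im Q f :=
  hf.mem_im.2 ⟨x, hx, rfl⟩

theorem exists_equiv (hf : F.Mor Q f) : ∃ e : Q ≃* im Q f, (∀ u, (e u : P) = f u) ∧
    e.toMonoidHom ∈ F.Hom Q (im Q f) ∧ e.symm.toMonoidHom ∈ F.Hom (im Q f) Q := by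
  have hm := fun y => hf.mem_im (y := y)
  have hi := hf.injOn
  obtain ⟨φ, hφ, h⟩ := hf
  have h3 : ∀ u : Q, φ u ∈ im Q f := fun u => (hm _).2 ⟨u, u.2, (h u).symm⟩
  let e : Q ≃* im Q f := MulEquiv.ofBijective (φ.codRestrict _ h3) (by
    constructor
    · intro x y hxy
      have : φ x = φ y := congrArg Subtype.val hxy
      rw [h, h] at this
      exact Subtype.ext (hi x.2 y.2 this)
    · rintro ⟨y, hy⟩
      obtain ⟨x, hx, rfl⟩ := (hm _).1 hy
      exact ⟨⟨x, hx⟩, Subtype.ext (h _)⟩)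
  have he : e.toMonoidHom ∈ F.Hom Q (im Q f) := hom_of_isMor hφ
  -- Divisibility, applied to e and to e ∘ e⁻¹ = id, puts the inverse into the category.
  refine ⟨e, fun u => h u, he, F.divisible _ he ?_⟩
  convert F.id_mem (im Q f)
  ext u
  exact congrArg Subtype.val (e.apply_symm_apply u)

theorem exists_inverse (hf : F.Mor Q f) : ∃ g, F.Mor (im Q f) g ∧ ∀ u ∈ Q, g (f u) = u := by
  obtain ⟨e, he, -, h⟩ := hf.exists_equiv
  refine ⟨extFun fun y => e.symm y, ⟨Q.subtype.comp e.symm.toMonoidHom, isMor_of_hom h, fun u =>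
    (extFun_apply (fun y => (e.symm y : P)) u).symm⟩, fun u hu => ?_⟩
  rw [← he ⟨u, hu⟩, extFun_apply, e.symm_apply_apply]

theorem of_hom {φ : Q →* R} (h : φ ∈ F.Hom Q R) (hf : ∀ u, (φ u : P) = f u) : F.Mor Q f :=
  ⟨R.subtype.comp φ, isMor_of_hom h, hf⟩

theorem exists_aut [Finite P] (hf : F.Mor Q f) (h : ∀ u ∈ Q, f u ∈ Q) :
    ∃ σ ∈ F.aut Q, ∀ u, (σ u : P) = f u := by
  have hi := hf.injOn
  obtain ⟨φ, hφ, h'⟩ := hf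
  have h3 : ∀ u : Q, φ u ∈ Q := fun u => by rw [h']; exact h u u.2
  have hinj : Function.Injective (φ.codRestrict Q h3) := by
    intro x y hxy
    have : φ x = φ y := congrArg Subtype.val hxy
    rw [h', h'] at this
    exact Subtype.ext (hi x.2 y.2 this)
  exact ⟨MulEquiv.ofBijective (φ.codRestrict Q h3) (Finite.injective_iff_bijective.1 hinj),
    hom_of_isMor hφ, h'⟩

end Mor

/-- An automorphism extended to a map on `P`. -/
def extAut {Q : Subgroup P} (σ : MulAut Q) : P → P := extFun fun u => σ u

theorem extAut_apply {Q : Subgroup P} (σ : MulAut Q) (u : Q) : extAut σ u = σ u := extFun_apply _ u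

theorem mor_extAut {Q : Subgroup P} {σ : MulAut Q} (hσ : σ ∈ F.aut Q) : F.Mor Q (extAut σ) :=
  Mor.of_hom (φ := σ.toMonoidHom) hσ fun u => (extAut_apply σ u).symm

theorem mem_conjAut {Q : Subgroup P} {σ : MulAut Q} : σ ∈ conjAut Q ↔
    ∃ x ∈ Subgroup.normalizer (Q : Set P), ∀ u : Q, (σ u : P) = x * u * x⁻¹ := by
  constructor
  · rintro ⟨x, rfl⟩
    exact ⟨x, x.2, fun u => rfl⟩
  · rintro ⟨x, hx, h⟩
    refine ⟨⟨x, hx⟩, ?_⟩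
    ext u
    exact (h u).symm

theorem conjAut_le_aut (Q : Subgroup P) : conjAut Q ≤ F.aut Q := by
  intro σ hσ
  obtain ⟨x, -, h⟩ := mem_conjAut.1 hσ
  exact F.conj_mem _ x h

variable (F) in
/-- The centralizer of the image of `Q` under `f` has the largest possible order. -/
def MaxCentralizer (Q : Subgroup P) (f : P → P) : Prop :=
  ∀ g, F.Mor Q g →
    Nat.card (Subgroup.centralizer (g '' Q)) ≤ Nat.card (Subgroup.centralizer (f '' Q))

/-- A usable form of the extension axiom. A morphism ζ maps C_P(f(Q)) injectively into C_P(ζ(f(Q))),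
whose order is not larger because ζ ∘ f is again a morphism from Q; so equality holds, as the axiom
requires. That y normalizes f(Q) need not be assumed: it follows from the relation between x and y.
-/
theorem Mor.extend [Finite P] {p : ℕ} (hF : F.IsFrobenius p) {Q N : Subgroup P} {f : P → P}
    (hf : F.Mor Q f) (hc : F.MaxCentralizer Q f) (hQN : Q ≤ N)
    (hN : ∀ x ∈ N, x ∈ Subgroup.normalizer (Q : Set P) ∧
      ∃ y, ∀ u ∈ Q, f (x * u * x⁻¹) = y * f u * y⁻¹) :
    ∃ g, F.Mor N g ∧ ∀ u ∈ Q, g u = f u := by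
  obtain ⟨φ, hφ, h⟩ := hf
  have hrange : (φ.range : Set P) = f '' Q := by
    ext y
    constructor
    · rintro ⟨x, rfl⟩
      exact ⟨x, x.2, (h x).symm⟩
    · rintro ⟨x, hx, rfl⟩
      exact ⟨⟨x, hx⟩, h _⟩
  obtain ⟨ψ, hψ, hψφ⟩ := hF.extend Q φ hφ (by
    intro ζ hζ
    have hζi : Function.Injective ζ := fun x y hxy => F.injective hζ (by
      change (Subgroup.topEquiv (G := P)).symm (ζ _) = (Subgroup.topEquiv (G := P)).symm (ζ _)
      rw [hxy])
    refine Subgroup.eq_of_le_of_card_ge ?_ ?_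
    · rintro _ ⟨c, hcC, rfl⟩
      rw [Subgroup.mem_centralizer_iff]
      rintro _ ⟨r, hr, rfl⟩
      rw [← _root_.map_mul, ← _root_.map_mul]
      congr 1
      exact Subtype.ext (Subgroup.mem_centralizer_iff.1 hcC r hr)
    · rw [Subgroup.card_map_of_injective hζi,
        Nat.card_congr (Subgroup.subgroupOfEquivOfLe 
          (le_sup_right : Subgroup.centralizer (φ.range : Set P) ≤ φ.range ⊔ _)).toEquiv]
      have hle : φ.range ≤ φ.range ⊔ Subgroup.centralizer (φ.range : Set P) := le_sup_left
      -- The composite ζ ∘ φ, to which maximality of the centralizer is applied.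
      let χ : Q →* P := ζ.comp ((Subgroup.inclusion hle).comp φ.rangeRestrict)
      have hχ : F.IsMor χ := isMor_comp hζ (hom_of_isMor hφ)
      have hχg : F.Mor Q (extFun χ) := ⟨χ, hχ, fun u => (extFun_apply χ u).symm⟩
      have := hc _ hχg
      rw [← hrange] at this
      refine le_trans (le_of_eq (congrArg (fun s : Set P =>
        Nat.card (Subgroup.centralizer s)) ?_)) this
      ext y
      constructor
      · rintro ⟨⟨_, hz⟩, ⟨u, rfl⟩, rfl⟩
        exact ⟨u, u.2, extFun_apply χ u⟩
      · rintro ⟨x, hx, rfl⟩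
        exact ⟨⟨φ ⟨x, hx⟩, hle ⟨_, rfl⟩⟩, ⟨_, rfl⟩, (extFun_apply χ ⟨x, hx⟩).symm⟩)
  have hle : N ≤ extDomain φ := by
    intro x hx
    obtain ⟨hx1, y, hy⟩ := hN x hx
    refine ⟨hx1, y, ?_, ?_⟩
    · rw [Subgroup.mem_normalizer_iff]
      intro r
      constructor
      · rintro ⟨u, rfl⟩
        refine ⟨⟨x * u * x⁻¹, (Subgroup.mem_normalizer_iff.1 hx1 u).1 u.2⟩, ?_⟩
        rw [h, h, hy u u.2]
      · rintro ⟨u, hu⟩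
        have hxu := (Subgroup.mem_normalizer_iff.1 (inv_mem hx1) u).1 u.2
        rw [inv_inv] at hxu
        refine ⟨⟨x⁻¹ * u * x, hxu⟩, ?_⟩
        have := hy _ hxu
        rw [h] at hu
        have e1 : x * (x⁻¹ * u * x) * x⁻¹ = u := by group
        rw [e1, hu] at this
        rw [h]
        simpa using this.symm
    · intro u v huv
      rw [h, h, huv, hy u u.2]
  refine ⟨extFun ψ, Mor.mono ⟨ψ, hψ, fun u => (extFun_apply ψ u).symm⟩ hle, fun u hu =>
    (extFun_apply ψ ⟨u, hle (hQN hu)⟩).trans ?_⟩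
  have := DFunLike.congr_fun hψφ ⟨u, hu⟩
  rw [h] at this
  exact this

variable (F) in
/-- Any `p`-subgroup of `F(Q)` is conjugate to a subgroup of `F_P(Q)`. -/
def AutSylow (p : ℕ) (Q : Subgroup P) : Prop :=
  ∀ T : Subgroup (MulAut Q), T ≤ F.aut Q → IsPGroup p T →
    ∃ θ ∈ F.aut Q, ∀ t ∈ T, θ * t * θ⁻¹ ∈ conjAut Q

theorem autSylow_top [Finite P] {p : ℕ} [Fact p.Prime] (hF : F.IsFrobenius p) :
    F.AutSylow p (⊤ : Subgroup P) := by
  obtain ⟨S, hS⟩ := hF.sylow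
  intro T hT hTp
  have hT' : IsPGroup p (T.subgroupOf (F.aut ⊤)) :=
    hTp.of_equiv (Subgroup.subgroupOfEquivOfLe hT).symm
  obtain ⟨Y, hY⟩ := hT'.exists_le_sylow
  obtain ⟨θ, hθ⟩ := MulAction.exists_smul_eq (F.aut ⊤) Y S
  refine ⟨θ, θ.2, fun t ht => ?_⟩
  have h1 : (⟨t, hT ht⟩ : F.aut ⊤) ∈ Y := hY ht
  have h2 : θ * ⟨t, hT ht⟩ * θ⁻¹ ∈ (S : Subgroup (F.aut ⊤)) := by
    rw [← hθ]
    exact ⟨_, h1, rfl⟩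
  rw [hS] at h2
  exact h2

/-- Carry T to automorphisms of the image through f, conjugate it into F_P by some θ, and take g = θ
∘ f. This replaces an isomorphism onto the image by one that turns T into conjugations by elements
of P. -/
theorem AutSylow.exists_conj {p : ℕ} {Q : Subgroup P} {f : P → P} (hf : F.Mor Q f)
    (h : F.AutSylow p (im Q f)) (T : Subgroup (MulAut Q)) (hT : T ≤ F.aut Q) (hTp : IsPGroup p T) :
    ∃ g, F.Mor Q g ∧ g '' Q = f '' Q ∧ ∀ τ ∈ T, ∃ x ∈ Subgroup.normalizer (f '' Q),
      ∀ u : Q, g (τ u) = x * g u * x⁻¹ := by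
  obtain ⟨e, he, h1, h2⟩ := hf.exists_equiv
  have hT' : T.map (MulAut.congr e).toMonoidHom ≤ F.aut (im Q f) := by
    rintro _ ⟨τ, hτ, rfl⟩
    have : ((MulAut.congr e τ).toMonoidHom : im Q f →* im Q f) =
      e.toMonoidHom.comp (τ.toMonoidHom.comp e.symm.toMonoidHom) := rfl
    change (MulAut.congr e τ).toMonoidHom ∈ F.Hom _ _
    rw [this]
    exact F.comp_mem h1 (F.comp_mem (hT hτ) h2)
  obtain ⟨θ, hθ, hc⟩ := h _ hT' (hTp.map _)
  have hval : ∀ u : Q, extAut θ (f u) = θ (e u) := fun u => by rw [← he, extAut_apply]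
  refine ⟨fun u => extAut θ (f u), (mor_extAut hθ).comp hf fun u hu => hf.apply_mem_im hu, ?_, ?_⟩
  · ext y
    constructor
    · rintro ⟨u, hu, rfl⟩
      change extAut θ (f (⟨u, hu⟩ : Q)) ∈ _
      rw [hval, ← hf.coe_im]
      exact (θ _).2
    · intro hy
      rw [← hf.coe_im] at hy
      refine ⟨e.symm (θ⁻¹ ⟨y, hy⟩), (e.symm (θ⁻¹ ⟨y, hy⟩)).2, ?_⟩
      change extAut θ (f _) = y
      rw [hval, e.apply_symm_apply]
      exact congrArg Subtype.val (θ.apply_symm_apply _)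
  · intro τ hτ
    obtain ⟨x, hx, hxu⟩ := mem_conjAut.1 (hc _ ⟨τ, hτ, rfl⟩)
    rw [hf.coe_im] at hx
    refine ⟨x, hx, fun u => ?_⟩
    change extAut θ (f _) = x * extAut θ (f _) * x⁻¹
    rw [hval, hval, ← hxu]
    congr 1
    change _ = θ (e (τ (e.symm (θ⁻¹ (θ (e u))))))
    have : θ⁻¹ (θ (e u)) = e u := θ.symm_apply_apply _
    rw [this, e.symm_apply_apply]

end DivisibleCategory

/-! ### Representatives of isomorphism classes to which normalizers extend. -/

namespace DivisibleCategory

variable {P : Type u} [Group P] {F : DivisibleCategory P}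

theorem Mor.map_conj {N : Subgroup P} {f : P → P} (hf : F.Mor N f) {x u : P} (hx : x ∈ N)
    (hu : u ∈ N) : f (x * u * x⁻¹) = f x * f u * (f x)⁻¹ := by
  rw [hf.map_mul (mul_mem hx hu) (inv_mem hx), hf.map_mul hx hu, hf.map_inv hx]

theorem Mor.apply_mem_normalizer [Finite P] {Q N : Subgroup P} {f : P → P} (hf : F.Mor N f)
    (hQN : Q ≤ N) {x : P} (hx : x ∈ N) (hxQ : x ∈ Subgroup.normalizer (Q : Set P)) :
    f x ∈ Subgroup.normalizer (f '' Q) := by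
  refine Subgroup.mem_normalizer_fintype ?_
  rintro _ ⟨u, hu, rfl⟩
  exact ⟨x * u * x⁻¹, (Subgroup.mem_normalizer_iff.1 hxQ u).1 hu, hf.map_conj hx (hQN hu)⟩

theorem Mor.card_image {Q : Subgroup P} {f : P → P} (hf : F.Mor Q f) :
    Nat.card (f '' Q) = Nat.card Q :=
  Nat.card_image_of_injOn hf.injOn

theorem Mor.card_im {Q : Subgroup P} {f : P → P} (hf : F.Mor Q f) :
    Nat.card (im Q f) = Nat.card Q := by
  have h := hf.card_image
  rw [← hf.coe_im] at h
  exact h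

theorem Mor.card_centralizer_le [Finite P] {Q N : Subgroup P} {f : P → P} (hf : F.Mor N f)
    (hQN : Q ≤ N) (hCN : Subgroup.centralizer (Q : Set P) ≤ N) :
    Nat.card (Subgroup.centralizer (Q : Set P)) ≤ Nat.card (Subgroup.centralizer (f '' Q)) := by
  rw [← (hf.mono hCN).card_im]
  refine Subgroup.card_le_of_le fun y hy => ?_
  obtain ⟨c, hc, rfl⟩ := (hf.mono hCN).mem_im.1 hy
  rw [Subgroup.mem_centralizer_iff]
  rintro _ ⟨u, hu, rfl⟩
  rw [← hf.map_mul (hQN hu) (hCN hc), ← hf.map_mul (hCN hc) (hQN hu),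
    Subgroup.mem_centralizer_iff.1 hc u hu]

/-- By `exists_conj_le_of_normalizing` it suffices that a p-element τ of F(Q) normalizing F_P(Q)
lies in F_P(Q). Such a τ extends to an automorphism of N_P(Q), which a suitable power makes a
p-element without changing its restriction to Q. By `hN` some σ turns it into conjugation by an x,
which normalizes σ(Q). Maximality of the normalizer gives N_P(σ(Q)) = σ(N_P(Q)), so x = σ(n) and τ
is conjugation by n. The hypothesis `hN` will come from induction on larger subgroups. -/
theorem autSylow_of_maximal [Finite P] {p : ℕ} [hp : Fact p.Prime] (hP : IsPGroup p P)
    (hF : F.IsFrobenius p) {Q : Subgroup P} (hc : F.MaxCentralizer Q fun u => u)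
    (hn : ∀ g, F.Mor Q g →
      Nat.card (Subgroup.centralizer (Q : Set P)) ≤ Nat.card (Subgroup.centralizer (g '' Q)) →
      Nat.card (Subgroup.normalizer (g '' Q)) ≤ Nat.card (Subgroup.normalizer (Q : Set P)))
    (hN : ∀ τ ∈ F.aut (Subgroup.normalizer (Q : Set P)), (∃ k, τ ^ p ^ k = 1) →
      ∃ σ x, F.Mor (Subgroup.normalizer (Q : Set P)) σ ∧
        ∀ u : Subgroup.normalizer (Q : Set P), σ (τ u) = x * σ u * x⁻¹) :
    F.AutSylow p Q := by
  intro T hT hTp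
  have hQN : Q ≤ Subgroup.normalizer (Q : Set P) := Subgroup.le_normalizer
  have hCN : Subgroup.centralizer (Q : Set P) ≤ Subgroup.normalizer (Q : Set P) :=
    Subgroup.centralizer_le_normalizer _
  have hmem : ∀ {x u : P}, x ∈ Subgroup.normalizer (Q : Set P) → u ∈ Q → x * u * x⁻¹ ∈ Q :=
    fun hx hu => (Subgroup.mem_normalizer_iff.1 hx _).1 hu
  have hSp : IsPGroup p (conjAut Q) :=
    (hP.to_subgroup (Subgroup.normalizer (Q : Set P))).of_surjective
      (Subgroup.normalizerMonoidHom Q).rangeRestrict (MonoidHom.rangeRestrict_surjective _)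
  refine exists_conj_le_of_normalizing (conjAut_le_aut Q) hSp ?_ hT hTp
  rintro τ hτ hnorm ⟨a, ha⟩
  have hτm := mor_extAut hτ
  have hτQ : ∀ u ∈ Q, extAut τ u ∈ Q := fun u hu => by
    rw [extAut_apply τ ⟨u, hu⟩]; exact (τ _).2
  have hτim : extAut τ '' Q = Q := by
    refine Set.eq_of_subset_of_ncard_le (by rintro _ ⟨u, hu, rfl⟩; exact hτQ u hu) ?_
      (Set.toFinite _)
    rw [hτm.injOn.ncard_image]
  have hτc : F.MaxCentralizer Q (extAut τ) := by
    intro g hg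
    rw [hτim]
    simpa using hc g hg
  -- Since τ normalizes F_P(Q), conjugation by x becomes under τ conjugation by some y, so τ extends
  -- to all of N_P(Q).
  obtain ⟨g, hg, hgτ⟩ := hτm.extend hF hτc hQN (fun x hx => ⟨hx, by
    obtain ⟨y, hy, hyu⟩ := mem_conjAut.1 (hnorm _ (mem_conjAut.2
      ⟨x, hx, fun u => rfl⟩ : Subgroup.normalizerMonoidHom Q ⟨x, hx⟩ ∈ conjAut Q))
    refine ⟨y, fun u hu => ?_⟩
    have h1 : x * u * x⁻¹ = ((Subgroup.normalizerMonoidHom Q ⟨x, hx⟩ ⟨u, hu⟩ : Q) : P) := rfl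
    have h2 : τ⁻¹ (τ ⟨u, hu⟩) = ⟨u, hu⟩ := τ.symm_apply_apply _
    rw [h1, extAut_apply, extAut_apply τ ⟨u, hu⟩, ← hyu (τ ⟨u, hu⟩), MulAut.mul_apply,
      MulAut.mul_apply, h2]⟩)
  have hgN : ∀ x ∈ Subgroup.normalizer (Q : Set P), g x ∈ Subgroup.normalizer (Q : Set P) := by
    intro x hx
    have h := hg.apply_mem_normalizer hQN hx hx
    rwa [Set.image_congr hgτ, hτim] at h
  obtain ⟨γ, hγ, hγg⟩ := hg.exists_aut hgN
  -- As k ≡ 1 modulo p^a and τ^(p^a) = 1, the power γ^k still restricts to τ.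
  obtain ⟨k, hk, hb⟩ := exists_pow_isPElement hp.out γ a
  have hτk : τ ^ k = τ := by
    have h := (pow_eq_pow_iff_modEq (x := τ)).2 (hk.of_dvd (orderOf_dvd_of_pow_eq_one ha))
    rw [h, pow_one]
  have hγτ : ∀ (n : ℕ) (u : Q), (((γ ^ n) ⟨u, hQN u.2⟩ : Subgroup.normalizer (Q : Set P)) : P) =
      (τ ^ n) u := by
    intro n
    induction n with
    | zero => intro u; rfl
    | succ n ih =>
      intro u
      rw [pow_succ, pow_succ]
      change ((γ ^ n) (γ ⟨u, hQN u.2⟩) : P) = (τ ^ n) (τ u)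
      rw [← ih]
      congr 2
      refine Subtype.ext ?_
      rw [hγg]
      exact (hgτ u u.2).trans (extAut_apply τ u)
  obtain ⟨σ, x, hσ, hσx⟩ := hN (γ ^ k) (pow_mem hγ k) hb
  have hστ : ∀ u : Q, σ (τ u) = x * σ u * x⁻¹ := by
    intro u
    have h := hσx ⟨u, hQN u.2⟩
    rwa [hγτ, hτk] at h
  have hx : x ∈ Subgroup.normalizer (σ '' Q) := by
    refine Subgroup.mem_normalizer_fintype ?_
    rintro _ ⟨u, hu, rfl⟩
    exact ⟨τ ⟨u, hu⟩, (τ ⟨u, hu⟩).2, hστ ⟨u, hu⟩⟩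
  have heq : im (Subgroup.normalizer (Q : Set P)) σ = Subgroup.normalizer (σ '' Q) := by
    refine Subgroup.eq_of_le_of_card_ge (fun y hy => ?_) ?_
    · obtain ⟨n, hn, rfl⟩ := hσ.mem_im.1 hy
      exact hσ.apply_mem_normalizer hQN hn hn
    · rw [hσ.card_im]
      exact hn σ (hσ.mono hQN) (hσ.card_centralizer_le hQN hCN)
  rw [← heq] at hx
  obtain ⟨n, hnN, rfl⟩ := hσ.mem_im.1 hx
  refine mem_conjAut.2 ⟨n, hnN, fun u => hσ.injOn (hQN (τ u).2) (hQN (hmem hnN u.2)) ?_⟩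
  rw [hστ, hσ.map_conj hnN (hQN u.2)]

/-- Any subgroup has an image `R` under a morphism such that the centralizer of `R` has the
largest possible order and `F_P(R)` is a Sylow `p`-subgroup of `F(R)`. -/
theorem exists_mor_autSylow [Finite P] {p : ℕ} [hp : Fact p.Prime] (hP : IsPGroup p P)
    (hF : F.IsFrobenius p) (Q : Subgroup P) :
    ∃ f, F.Mor Q f ∧ F.MaxCentralizer Q f ∧ F.AutSylow p (im Q f) := by
  induction hd : Nat.card P - Nat.card Q using Nat.strong_induction_on generalizing Q with
  | _ d ih =>
  by_cases hQ : Q = ⊤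
  · subst hQ
    have him : im (⊤ : Subgroup P) (fun u => u) = ⊤ := by
      rw [eq_top_iff]
      intro u hu
      exact (Mor.id (F := F) ⊤).mem_im.2 ⟨u, hu, rfl⟩
    refine ⟨fun u => u, Mor.id ⊤, fun g hg => ?_, ?_⟩
    · refine le_of_eq (congrArg (fun s : Set P => Nat.card (Subgroup.centralizer s)) ?_)
      rw [Set.image_id']
      refine Set.eq_of_subset_of_ncard_le (Set.subset_univ _) ?_ (Set.toFinite _)
      rw [hg.injOn.ncard_image]
    · rw [him]
      exact autSylow_top hF
  -- Lexicographic maximum: first the order of the centralizer, then that of the normalizer. The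
  -- factor |P| + 1 exceeds the order of any normalizer.
  let m : (P → P) → ℕ := fun f => Nat.card (Subgroup.centralizer (f '' Q)) * (Nat.card P + 1) +
    Nat.card (Subgroup.normalizer (f '' Q))
  obtain ⟨f, hf, hmax⟩ := Set.exists_max_image {f | F.Mor Q f} m (Set.toFinite _)
    ⟨fun u => u, Mor.id Q⟩
  have hNle : ∀ s : Set P, Nat.card (Subgroup.normalizer s) ≤ Nat.card P := fun s =>
    Nat.card_le_card_of_injective _ Subtype.val_injective
  have hfc : F.MaxCentralizer Q f := by
    intro g hg
    by_contra! hlt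
    have h1 := hmax g hg
    have h2 := hNle (f '' Q)
    simp only [m] at h1
    nlinarith
  refine ⟨f, hf, hfc, ?_⟩
  have hcoe := hf.coe_im
  have himg : ∀ g, F.Mor (im Q f) g → F.Mor Q (fun u => g (f u)) ∧
      (fun u => g (f u)) '' Q = g '' (im Q f) := by
    intro g hg
    refine ⟨hg.comp hf fun u hu => hf.apply_mem_im hu, ?_⟩
    rw [hcoe, Set.image_image]
  refine autSylow_of_maximal hP hF ?_ ?_ ?_
  · intro g hg
    obtain ⟨h1, h2⟩ := himg g hg
    rw [← h2, Set.image_id', hcoe]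
    exact hfc _ h1
  · intro g hg hle
    obtain ⟨h1, h2⟩ := himg g hg
    rw [← h2, hcoe] at hle ⊢
    have := hmax (fun u => g (f u)) h1
    simp only [m] at this
    have h3 := hfc _ h1
    rw [le_antisymm h3 hle] at this
    omega
  · have hne : im Q f < ⊤ := by
      rw [lt_top_iff_ne_top]
      intro htop
      have h := hf.card_im
      rw [htop, Subgroup.card_top] at h
      exact hQ (Subgroup.eq_top_of_card_eq Q h.symm)
    have hnil : Group.IsNilpotent P := hP.isNilpotent
    have hlt := Group.normalizerCondition_of_isNilpotent _ hne
    have hcard : Nat.card Q < Nat.card (Subgroup.normalizer (im Q f : Set P)) := by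
      rw [← hf.card_im]
      exact Set.ncard_lt_ncard hlt (Set.toFinite _)
    -- The image of Q is proper in the p-group P, so its normalizer is strictly larger and induction
    -- applies to it. The Sylow property so obtained is used on the cyclic p-group generated by τ.
    obtain ⟨g, hg, -, hgS⟩ := ih _ (by have := hNle (im Q f); omega)
      (Subgroup.normalizer (im Q f : Set P)) rfl
    rintro τ hτ ⟨k, hk⟩
    obtain ⟨σ, hσ, -, hσx⟩ := hgS.exists_conj hg (Subgroup.zpowers τ)
      (by rwa [Subgroup.zpowers_le]) (by
        rw [IsPGroup.iff_card]
        rw [Nat.card_zpowers]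
        obtain ⟨j, -, hj⟩ := (Nat.dvd_prime_pow hp.out).1 (orderOf_dvd_of_pow_eq_one hk)
        exact ⟨j, hj⟩)
    obtain ⟨x, -, hx⟩ := hσx τ (Subgroup.mem_zpowers τ)
    exact ⟨σ, x, hσ, hx⟩

/-- The condition depends only on the image: composing with g⁻¹ ∘ f turns any morphism from R into
one from Q with the same image. -/
theorem MaxCentralizer.of_image_eq {Q R : Subgroup P} {f g : P → P} (hf : F.Mor Q f)
    (hfc : F.MaxCentralizer Q f) (hg : F.Mor R g) (hgR : g '' R = f '' Q) :
    F.MaxCentralizer R g := by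
  have him : im R g = im Q f := SetLike.coe_injective (by rw [hg.coe_im, hf.coe_im, hgR])
  intro h hh
  rw [hgR]
  obtain ⟨e, he, hfe⟩ := hg.exists_inverse
  rw [him] at he
  have heR : ∀ u ∈ Q, e (f u) ∈ R := by
    intro u hu
    have : f u ∈ g '' R := by rw [hgR]; exact ⟨u, hu, rfl⟩
    obtain ⟨r, hr, hrr⟩ := this
    rw [← hrr, hfe r hr]
    exact hr
  have hm := hh.comp (he.comp hf fun u hu => hf.apply_mem_im hu) heR
  have := hfc _ hm
  refine le_trans (le_of_eq (congrArg (fun s : Set P =>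
    Nat.card (Subgroup.centralizer s)) ?_)) this
  ext y
  constructor
  · rintro ⟨r, hr, rfl⟩
    have : g r ∈ f '' Q := by rw [← hgR]; exact ⟨r, hr, rfl⟩
    obtain ⟨u, hu, hur⟩ := this
    exact ⟨u, hu, by simp only [hur, hfe r hr]⟩
  · rintro ⟨u, hu, rfl⟩
    exact ⟨_, heR u hu, rfl⟩

/-- Any subgroup has an image `R` under a morphism such that the centralizer of `R` has the
largest possible order and any isomorphic subgroup `R'` admits an isomorphism onto `R` which
can be extended to the normalizer of `R'`. -/
theorem exists_mor_receptive [Finite P] {p : ℕ} [hp : Fact p.Prime] (hP : IsPGroup p P)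
    (hF : F.IsFrobenius p) (Q : Subgroup P) :
    ∃ f, F.Mor Q f ∧ F.MaxCentralizer Q f ∧ ∀ R g, F.Mor R g → g '' R = f '' Q →
      ∃ α, F.Mor (Subgroup.normalizer (R : Set P)) α ∧ α '' R = f '' Q := by
  obtain ⟨f, hf, hfc, hS⟩ := exists_mor_autSylow hP hF Q
  refine ⟨f, hf, hfc, fun R g hg hgR => ?_⟩
  have him : im R g = im Q f := SetLike.coe_injective (by rw [hg.coe_im, hf.coe_im, hgR])
  rw [← him] at hS
  -- Once α carries the p-group F_P(R) into conjugations by elements of P, every x in N_P(R) meets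
  -- the extension condition.
  obtain ⟨α, hα, hαR, hαx⟩ := hS.exists_conj hg (conjAut R) (conjAut_le_aut R)
    ((hP.to_subgroup (Subgroup.normalizer (R : Set P))).of_surjective
      (Subgroup.normalizerMonoidHom R).rangeRestrict (MonoidHom.rangeRestrict_surjective _))
  rw [hgR] at hαR
  obtain ⟨β, hβ, hβα⟩ := hα.extend hF (hfc.of_image_eq hf hα hαR) (Subgroup.le_normalizer)
    (fun x hx => ⟨hx, by
      obtain ⟨y, -, hy⟩ := hαx (Subgroup.normalizerMonoidHom R ⟨x, hx⟩) ⟨⟨x, hx⟩, rfl⟩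
      exact ⟨y, fun u hu => hy ⟨u, hu⟩⟩⟩)
  exact ⟨β, hβ, by rw [Set.image_congr hβα, hαR]⟩

variable (F) in
/-- Subgroups of `P` are related when they are isomorphic in the category. -/
def isoSetoid : Setoid (Subgroup P) where
  r R R' := ∃ f, F.Mor R f ∧ f '' R = R'
  iseqv := by
    refine ⟨fun R => ⟨fun u => u, Mor.id R, Set.image_id' _⟩, ?_, ?_⟩
    · rintro R R' ⟨f, hf, h⟩
      obtain ⟨g, hg, hgf⟩ := hf.exists_inverse
      have him : im R f = R' := SetLike.coe_injective (by rw [hf.coe_im, h])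
      rw [him] at hg
      refine ⟨g, hg, ?_⟩
      rw [← h, Set.image_image, Set.image_congr (g := fun u => u) hgf, Set.image_id']
    · rintro R R' R'' ⟨f, hf, h⟩ ⟨g, hg, h'⟩
      refine ⟨fun u => g (f u), hg.comp hf fun u hu => ?_, ?_⟩
      · rw [← SetLike.mem_coe, ← h]
        exact ⟨u, hu, rfl⟩
      · rw [← h', ← h, Set.image_image]

/-- A choice of representatives of the isomorphism classes of subgroups. -/
theorem exists_representatives [Finite P] {p : ℕ} [hp : Fact p.Prime] (hP : IsPGroup p P)
    (hF : F.IsFrobenius p) : ∃ ρ : Subgroup P → Subgroup P,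
      (∀ R f, F.Mor R f → ρ (im R f) = ρ R) ∧
      (∀ R : Subgroup P, ∃ α, F.Mor (Subgroup.normalizer (R : Set P)) α ∧ α '' R = ρ R) ∧
      ∀ (R : Subgroup P) (g : P → P), F.Mor R g → g '' R = ρ R → F.MaxCentralizer R g := by
  choose f hf hfc hfr using fun Q => exists_mor_receptive (F := F) hP hF Q
  -- An arbitrary element of the class is chosen first and then replaced by its good image, so that
  -- ρ is constant on classes.
  let o : Subgroup P → Subgroup P := fun R => Quotient.out (Quotient.mk F.isoSetoid R)
  have ho : ∀ R, ∃ g, F.Mor R g ∧ g '' R = o R := fun R =>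
    F.isoSetoid.symm (Quotient.mk_out (s := F.isoSetoid) R)
  have hcoe : ∀ R, (im (o R) (f (o R)) : Set P) = f (o R) '' o R := fun R => (hf (o R)).coe_im
  refine ⟨fun R => im (o R) (f (o R)), fun R g hg => ?_, fun R => ?_, fun R g hg hgR => ?_⟩
  · have : o (im R g) = o R :=
      congrArg Quotient.out (Quotient.sound (F.isoSetoid.symm ⟨g, hg, hg.coe_im.symm⟩))
    simp only [this]
  · obtain ⟨g, hg, hgo⟩ := ho R
    obtain ⟨α, hα, h⟩ := hfr (o R) R (fun u => f (o R) (g u)) ((hf (o R)).comp hg fun u hu => by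
      rw [← SetLike.mem_coe, ← hgo]; exact ⟨u, hu, rfl⟩) (by rw [← hgo, Set.image_image])
    exact ⟨α, hα, h.trans (hcoe R).symm⟩
  · exact (hfc (o R)).of_image_eq (hf _) hg (hgR.trans (hcoe R))

end DivisibleCategory

/-! ### Moving graphs by pairs of morphisms, and the congruence for marks. -/

namespace DivisibleCategory

open Burn

variable {P : Type u} [Group P] {F : DivisibleCategory P}

theorem isGraph_iff_mor {D : Subgroup (P × P)} :
    F.IsGraph D ↔ ∃ Q f, F.Mor Q f ∧ ∀ z : P × P, z ∈ D ↔ z.2 ∈ Q ∧ f z.2 = z.1 := by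
  constructor
  · rintro ⟨Q, φ, hφ, rfl⟩
    refine ⟨Q, extFun φ, ⟨φ, hφ, fun u => (extFun_apply φ u).symm⟩, fun z => ?_⟩
    rw [mem_graphSubgroup]
    constructor
    · rintro ⟨h1, h2⟩
      exact ⟨h1, (extFun_apply φ ⟨_, h1⟩).trans h2⟩
    · rintro ⟨h1, h2⟩
      exact ⟨h1, (extFun_apply φ ⟨_, h1⟩).symm.trans h2⟩
  · rintro ⟨Q, f, ⟨φ, hφ, h⟩, hD⟩
    refine ⟨Q, φ, hφ, ?_⟩
    ext z
    rw [hD, mem_graphSubgroup]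
    constructor
    · rintro ⟨h1, h2⟩
      exact ⟨h1, (h _).trans h2⟩
    · rintro ⟨h1, h2⟩
      exact ⟨h1, (h _).symm.trans h2⟩

theorem isMor_iff_mor {R : Subgroup P} {ψ : R →* P} : F.IsMor ψ ↔ F.Mor R (extFun ψ) := by
  constructor
  · intro h
    exact ⟨ψ, h, fun u => (extFun_apply ψ u).symm⟩
  · rintro ⟨φ, hφ, h⟩
    have : φ = ψ := by
      ext u
      rw [h, extFun_apply]
    rwa [← this]

variable (F) in
/-- The subgroup `D'` of `P × P` is the image of `D` under a pair of morphisms. -/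
def Transport (D D' : Subgroup (P × P)) : Prop :=
  ∃ A B a b, F.Mor A a ∧ F.Mor B b ∧ (∀ d ∈ D, d.1 ∈ A ∧ d.2 ∈ B) ∧
    ∀ z, z ∈ D' ↔ ∃ d ∈ D, (a d.1, b d.2) = z

theorem Transport.symm {D D' : Subgroup (P × P)} (h : F.Transport D D') : F.Transport D' D := by
  obtain ⟨A, B, a, b, ha, hb, hD, hD'⟩ := h
  obtain ⟨a', ha', haa⟩ := ha.exists_inverse
  obtain ⟨b', hb', hbb⟩ := hb.exists_inverse
  refine ⟨_, _, a', b', ha', hb', fun z hz => ?_, fun d => ⟨fun hd => ?_, ?_⟩⟩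
  · obtain ⟨d, hd, rfl⟩ := (hD' z).1 hz
    exact ⟨ha.apply_mem_im (hD d hd).1, hb.apply_mem_im (hD d hd).2⟩
  · refine ⟨_, (hD' _).2 ⟨d, hd, rfl⟩, ?_⟩
    simp only
    rw [haa _ (hD d hd).1, hbb _ (hD d hd).2]
  · rintro ⟨z, hz, rfl⟩
    obtain ⟨d, hd, rfl⟩ := (hD' z).1 hz
    simp only
    rw [haa _ (hD d hd).1, hbb _ (hD d hd).2]
    exact hd

/-- The pair (a, b) sends the graph of f to the graph of a ∘ f ∘ b⁻¹. -/
theorem Transport.isGraph {D D' : Subgroup (P × P)} (h : F.Transport D D') (hD : F.IsGraph D) :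
    F.IsGraph D' := by
  obtain ⟨A, B, a, b, ha, hb, hAB, hD'⟩ := h
  obtain ⟨Q, f, hf, hQ⟩ := isGraph_iff_mor.1 hD
  have hmem : ∀ u ∈ Q, (f u, u) ∈ D := fun u hu => (hQ (f u, u)).2 ⟨hu, rfl⟩
  have hbQ : F.Mor Q b := hb.mono fun u hu => (hAB _ (hmem u hu)).2
  obtain ⟨b', hb', hbb⟩ := hbQ.exists_inverse
  have hbm : ∀ y ∈ im Q b, b' y ∈ Q := by
    intro y hy
    obtain ⟨u, hu, rfl⟩ := hbQ.mem_im.1 hy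
    rwa [hbb u hu]
  refine isGraph_iff_mor.2 ⟨im Q b, fun y => a (f (b' y)), (ha.comp hf fun u hu =>
    (hAB _ (hmem u hu)).1).comp hb' hbm, fun z => ?_⟩
  rw [hD']
  constructor
  · rintro ⟨d, hd, rfl⟩
    obtain ⟨h1, h2⟩ := (hQ d).1 hd
    refine ⟨hbQ.apply_mem_im h1, ?_⟩
    simp only
    rw [hbb _ h1, h2]
  · rintro ⟨h1, h2⟩
    obtain ⟨u, hu, hbu⟩ := hbQ.mem_im.1 h1
    refine ⟨_, hmem u hu, Prod.ext ?_ hbu⟩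
    rw [← h2, ← hbu]
    simp only [hbb u hu]

theorem Transport.card_eq {D D' : Subgroup (P × P)} (h : F.Transport D D') :
    Nat.card D' = Nat.card D := by
  obtain ⟨A, B, a, b, ha, hb, hAB, hD'⟩ := h
  have hinj : Set.InjOn (fun d : P × P => (a d.1, b d.2)) D := by
    intro d hd d' hd' he
    obtain ⟨h1, h2⟩ := Prod.ext_iff.1 he
    exact Prod.ext (ha.injOn (hAB d hd).1 (hAB d' hd').1 h1)
      (hb.injOn (hAB d hd).2 (hAB d' hd').2 h2)
  have h2 : (fun d : P × P => (a d.1, b d.2)) '' D = D' := by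
    ext z
    exact (hD' z).symm
  have h3 := Nat.card_image_of_injOn hinj
  rw [h2] at h3
  exact h3

theorem Transport.conj (D : Subgroup (P × P)) (g : P × P) :
    F.Transport D (D.map (MulAut.conj g).toMonoidHom) :=
  ⟨⊤, ⊤, _, _, Mor.conj ⊤ g.1, Mor.conj ⊤ g.2, fun _ _ => ⟨trivial, trivial⟩, fun _ => Iff.rfl⟩

/-- The diagonal subgroup `{(u, u) | u ∈ R}`. -/
def diag (R : Subgroup P) : Subgroup (P × P) := graphSubgroup R.subtype

theorem mem_diag {R : Subgroup P} {z : P × P} : z ∈ diag R ↔ z.2 ∈ R ∧ z.2 = z.1 := by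
  rw [diag, mem_graphSubgroup]
  exact ⟨fun ⟨h, e⟩ => ⟨h, e⟩, fun ⟨h, e⟩ => ⟨h, e⟩⟩

/-- The second projection of a transport. -/
theorem Transport.map_snd {D D' : Subgroup (P × P)} (h : F.Transport D D') :
    ∃ b, F.Mor (D.map (MonoidHom.snd P P)) b ∧
      D'.map (MonoidHom.snd P P) = im (D.map (MonoidHom.snd P P)) b := by
  obtain ⟨A, B, a, b, ha, hb, hAB, hD'⟩ := h
  have hm : F.Mor (D.map (MonoidHom.snd P P)) b := hb.mono (by
    rintro _ ⟨d, hd, rfl⟩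
    exact (hAB d hd).2)
  refine ⟨b, hm, ?_⟩
  ext y
  rw [hm.mem_im]
  constructor
  · rintro ⟨z, hz, rfl⟩
    obtain ⟨d, hd, rfl⟩ := (hD' z).1 hz
    exact ⟨d.2, ⟨d, hd, rfl⟩, rfl⟩
  · rintro ⟨_, ⟨d, hd, rfl⟩, rfl⟩
    exact ⟨_, (hD' _).2 ⟨d, hd, rfl⟩, rfl⟩

section Stabilization

variable [Finite P]

/-- The normalizer of a graph can be mapped by a pair of morphisms in such a way that the graph
is sent to the diagonal of the representative of its isomorphism class. -/
theorem exists_transport_normalizer {p : ℕ} (hF : F.IsFrobenius p) {ρ : Subgroup P → Subgroup P}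
    (hρ : ∀ R : Subgroup P, ∃ α, F.Mor (Subgroup.normalizer (R : Set P)) α ∧ α '' R = ρ R)
    (hρc : ∀ (R : Subgroup P) (g : P → P), F.Mor R g → g '' R = ρ R → F.MaxCentralizer R g)
    (hρi : ∀ R f, F.Mor R f → ρ (im R f) = ρ R)
    {D : Subgroup (P × P)} (hD : F.IsGraph D) :
    ∃ A B a b, F.Mor A a ∧ F.Mor B b ∧
      (∀ n ∈ Subgroup.normalizer (D : Set (P × P)), n.1 ∈ A ∧ n.2 ∈ B) ∧
      ∀ z, z ∈ diag (ρ (D.map (MonoidHom.snd P P))) ↔ ∃ d ∈ D, (a d.1, b d.2) = z := by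
  obtain ⟨R, ψ, hψ, hR⟩ := isGraph_iff_mor.1 hD
  have hmem : ∀ u ∈ R, (ψ u, u) ∈ D := fun u hu => (hR (ψ u, u)).2 ⟨hu, rfl⟩
  have hDR : D.map (MonoidHom.snd P P) = R := by
    ext u
    constructor
    · rintro ⟨d, hd, rfl⟩
      exact ((hR d).1 hd).1
    · intro hu
      exact ⟨_, hmem u hu, rfl⟩
  rw [hDR]
  obtain ⟨α, hα, hαR⟩ := hρ R
  have hRN : R ≤ Subgroup.normalizer (R : Set P) := Subgroup.le_normalizer
  have hconj : ∀ n ∈ Subgroup.normalizer (D : Set (P × P)), ∀ u ∈ R, n.2 * u * n.2⁻¹ ∈ R ∧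
      ψ (n.2 * u * n.2⁻¹) = n.1 * ψ u * n.1⁻¹ := by
    intro n hn u hu
    exact (hR _).1 ((Subgroup.mem_normalizer_iff.1 hn _).1 (hmem u hu))
  have hn2 : ∀ n ∈ Subgroup.normalizer (D : Set (P × P)),
      n.2 ∈ Subgroup.normalizer (R : Set P) := fun n hn =>
    Subgroup.mem_normalizer_fintype fun u hu => (hconj n hn u hu).1
  obtain ⟨ψ', hψ', hψψ⟩ := hψ.exists_inverse
  have hψR : ∀ y ∈ im R ψ, ψ' y ∈ R := by
    intro y hy
    obtain ⟨u, hu, rfl⟩ := hψ.mem_im.1 hy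
    rwa [hψψ u hu]
  -- D consists of the pairs (ψ(u), u), so (α ∘ ψ⁻¹, α) sends it to the diagonal. The map α is
  -- already defined on N_P(R); only α ∘ ψ⁻¹ has to be extended, to the first projection of N(D).
  -- For (n₁, n₂) in N(D) conjugation by n₁ on ψ(R) matches conjugation by n₂ on R, so α(n₂) is the
  -- element required by the extension condition.
  have ha0 : F.Mor (im R ψ) (fun y => α (ψ' y)) := (hα.mono hRN).comp hψ' hψR
  have ha0im : (fun y => α (ψ' y)) '' (im R ψ) = ρ (im R ψ) := by
    rw [hρi R ψ hψ, ← hαR, hψ.coe_im, Set.image_image]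
    exact Set.image_congr fun u hu => by rw [hψψ u hu]
  obtain ⟨a, ha, haα⟩ := ha0.extend hF (hρc _ _ ha0 ha0im)
    (N := (Subgroup.normalizer (D : Set (P × P))).map (MonoidHom.fst P P)) (by
      intro y hy
      obtain ⟨u, hu, rfl⟩ := hψ.mem_im.1 hy
      exact ⟨_, Subgroup.le_normalizer (hmem u hu), rfl⟩) (by
      rintro _ ⟨n, hn, rfl⟩
      refine ⟨Subgroup.mem_normalizer_fintype ?_, α n.2, ?_⟩
      · intro y hy
        obtain ⟨u, hu, rfl⟩ := hψ.mem_im.1 hy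
        exact hψ.mem_im.2 ⟨_, (hconj n hn u hu).1, (hconj n hn u hu).2⟩
      · intro y hy
        obtain ⟨u, hu, rfl⟩ := hψ.mem_im.1 hy
        change α (ψ' (n.1 * ψ u * n.1⁻¹)) = _
        rw [← (hconj n hn u hu).2, hψψ _ (hconj n hn u hu).1, hψψ u hu]
        exact hα.map_conj (hn2 n hn) (hRN hu))
  have haψ : ∀ u ∈ R, a (ψ u) = α u := fun u hu => by
    rw [haα _ (hψ.apply_mem_im hu), hψψ u hu]
  refine ⟨_, _, a, α, ha, hα, fun n hn => ⟨⟨n, hn, rfl⟩, hn2 n hn⟩, fun z => ?_⟩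
  rw [mem_diag, ← SetLike.mem_coe, ← hαR]
  constructor
  · rintro ⟨⟨u, hu, huz⟩, hz⟩
    refine ⟨_, hmem u hu, Prod.ext ?_ huz⟩
    change a (ψ u) = z.1
    rw [haψ u hu, huz, hz]
  · rintro ⟨d, hd, rfl⟩
    obtain ⟨h1, h2⟩ := (hR d).1 hd
    refine ⟨⟨d.2, h1, rfl⟩, ?_⟩
    change α d.2 = a d.1
    rw [← h2, haψ _ h1]

/-- Subtract the two Burnside congruences for N(D) with normal subgroup D, one through the pair of
morphisms and one through the inclusion. For n outside D the terms belong to subgroups strictly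
larger than D: they cancel by hypothesis, or both vanish off graphs. The |D| remaining terms are
equal, so |N(D)| divides |D| times the difference, and `card_mul_mark_self` lets |D| be cancelled.
-/
theorem mark_self_dvd_sub {p : ℕ} (hF : F.IsFrobenius p) {ρ : Subgroup P → Subgroup P}
    (hρ : ∀ R : Subgroup P, ∃ α, F.Mor (Subgroup.normalizer (R : Set P)) α ∧ α '' R = ρ R)
    (hρc : ∀ (R : Subgroup P) (g : P → P), F.Mor R g → g '' R = ρ R → F.MaxCentralizer R g)
    (hρi : ∀ R f, F.Mor R f → ρ (im R f) = ρ R) (f : F.hecke)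
    {D : Subgroup (P × P)} (hD : F.IsGraph D)
    (hf : ∀ E E', F.IsGraph E → Nat.card D < Nat.card E → F.Transport E E' →
      mark E (DBurn.toBurn (f : DBurn P)) = mark E' (DBurn.toBurn (f : DBurn P))) :
    mark D (cls (P × P) ((P × P) ⧸ D)) ∣
      mark (diag (ρ (D.map (MonoidHom.snd P P)))) (DBurn.toBurn (f : DBurn P)) -
        mark D (DBurn.toBurn (f : DBurn P)) := by
  classical
  obtain ⟨A, B, a, b, ha, hb, hN, hdiag⟩ := exists_transport_normalizer hF hρ hρc hρi hD
  set Δ := diag (ρ (D.map (MonoidHom.snd P P))) with hΔ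
  set F' := DBurn.toBurn (f : DBurn P) with hF'
  let N := Subgroup.normalizer (D : Set (P × P))
  let _ : Fintype N := Fintype.ofFinite _
  let χ : N →* P × P :=
    { toFun n := (a n.1.1, b n.1.2)
      map_one' := Prod.ext ha.map_one hb.map_one
      map_mul' m n := Prod.ext (ha.map_mul (hN m m.2).1 (hN n n.2).1)
        (hb.map_mul (hN m m.2).2 (hN n n.2).2) }
  let DN : Subgroup N := D.subgroupOf N
  have hDN : D ≤ N := Subgroup.le_normalizer
  have hnormal : DN.Normal := Subgroup.normal_in_normalizer
  have h1 := dvd_sub (card_dvd_sum_mark χ DN F') (card_dvd_sum_mark N.subtype DN F')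
  rw [← Finset.sum_sub_distrib] at h1
  have hterm : ∀ n : N, mark ((DN ⊔ Subgroup.zpowers n).map χ) F' -
      mark ((DN ⊔ Subgroup.zpowers n).map N.subtype) F' =
      if n ∈ DN then mark Δ F' - mark D F' else 0 := by
    intro n
    have hT : ∀ E : Subgroup N, F.Transport (E.map N.subtype) (E.map χ) := by
      intro E
      refine ⟨A, B, a, b, ha, hb, ?_, fun z => ?_⟩
      · rintro _ ⟨n, -, rfl⟩
        exact hN n n.2
      · constructor
        · rintro ⟨n, hn, rfl⟩
          exact ⟨n, ⟨n, hn, rfl⟩, rfl⟩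
        · rintro ⟨_, ⟨n, hn, rfl⟩, rfl⟩
          exact ⟨n, hn, rfl⟩
    split_ifs with hn
    · have h2 : DN ⊔ Subgroup.zpowers n = DN := sup_eq_left.2 (by rwa [Subgroup.zpowers_le])
      rw [h2]
      have h3 : DN.map N.subtype = D := Subgroup.map_subgroupOf_eq_of_le hDN
      have h4 : DN.map χ = Δ := by
        ext z
        rw [hdiag]
        constructor
        · rintro ⟨n, hn, rfl⟩
          exact ⟨n, hn, rfl⟩
        · rintro ⟨d, hd, rfl⟩
          exact ⟨⟨d, hDN hd⟩, hd, rfl⟩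
      rw [h3, h4]
    · rw [sub_eq_zero]
      by_cases hE : F.IsGraph ((DN ⊔ Subgroup.zpowers n).map N.subtype)
      · refine (hf _ _ hE ?_ (hT _)).symm
        have hlt : D < (DN ⊔ Subgroup.zpowers n).map N.subtype := by
          refine lt_of_le_of_ne ?_ ?_
          · conv_lhs => rw [← Subgroup.map_subgroupOf_eq_of_le hDN]
            exact Subgroup.map_mono le_sup_left
          · intro he
            apply hn
            have : (n : P × P) ∈ (DN ⊔ Subgroup.zpowers n).map N.subtype :=
              ⟨n, (le_sup_right : Subgroup.zpowers n ≤ _) (Subgroup.mem_zpowers n), rfl⟩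
            rw [← he] at this
            exact this
        exact Set.ncard_lt_ncard hlt (Set.toFinite _)
      · rw [mark_eq_zero_of_not_isGraph F f hE,
          mark_eq_zero_of_not_isGraph F f fun h => hE ((hT _).symm.isGraph h)]
  rw [Finset.sum_congr rfl fun n _ => hterm n, ← Finset.sum_filter, Finset.sum_const] at h1
  have hcard : (Finset.univ.filter fun n : N => n ∈ DN).card = Nat.card D := by
    rw [← Nat.card_congr (Subgroup.subgroupOfEquivOfLe hDN).toEquiv, Nat.card_eq_fintype_card]
    exact (Fintype.card_subtype _).symm
  rw [hcard, nsmul_eq_mul, ← card_mul_mark_self D] at h1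
  exact Int.dvd_of_mul_dvd_mul_left (by exact_mod_cast Nat.card_pos.ne') h1

end Stabilization

end DivisibleCategory

/-! ### An element of the Hecke algebra with invariant marks. -/

namespace Burn

theorem exists_conj_of_mk_eq {G : Type u} [Group G] [Finite G] {K L : Subgroup G}
    (h : Quotient.mk (indecSetoid G) K = Quotient.mk (indecSetoid G) L) :
    ∃ g : G, K.map (MulAut.conj g).toMonoidHom = L := by
  obtain ⟨e⟩ := Quotient.exact h
  have hK : mark K (cls G (G ⧸ L)) ≠ 0 := by
    rw [← cls_congr e]; exact (mark_self_pos K).ne'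
  have hL : mark L (cls G (G ⧸ K)) ≠ 0 := by
    rw [cls_congr e]; exact (mark_self_pos L).ne'
  obtain ⟨g, hg⟩ := card_le_of_mark_ne_zero hK
  obtain ⟨g', hg'⟩ := card_le_of_mark_ne_zero hL
  refine ⟨g, Subgroup.eq_of_le_of_card_ge hg ?_⟩
  have h1 := Subgroup.card_le_of_le hg'
  rw [Subgroup.card_map_of_injective (MulAut.conj g').injective] at h1
  rwa [Subgroup.card_map_of_injective (MulAut.conj g).injective]

end Burn

namespace DivisibleCategory

open Burn

variable {P : Type u} [Group P] [Finite P] {F : DivisibleCategory P}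

/-- The marks of an element of the Hecke algebra at the graphs of order `n` can be changed by
multiples of the marks of the indecomposable sets, without changing the marks at the graphs of
larger order. -/
theorem exists_hecke_mark_eq (f : F.hecke) (n : ℕ) (c : Subgroup (P × P) → ℤ)
    (hc : ∀ D, F.IsGraph D → Nat.card D = n → mark D (cls (P × P) ((P × P) ⧸ D)) ∣
      c D - mark D (DBurn.toBurn (f : DBurn P)))
    (hconj : ∀ D g, F.IsGraph D → c (D.map (MulAut.conj g).toMonoidHom) = c D) :
    ∃ f' : F.hecke, (∀ D, F.IsGraph D → Nat.card D = n →
        mark D (DBurn.toBurn (f' : DBurn P)) = c D) ∧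
      ∀ D : Subgroup (P × P), n < Nat.card D →
        mark D (DBurn.toBurn (f' : DBurn P)) = mark D (DBurn.toBurn (f : DBurn P)) := by
  classical
  let _ : Fintype (IndecClass (P × P)) := Fintype.ofFinite _
  let s : Finset (IndecClass (P × P)) := Finset.univ.filter fun q =>
    F.IsGraph (Quotient.out q) ∧ Nat.card (Quotient.out q : Subgroup (P × P)) = n
  have hs : ∀ q ∈ s, F.IsGraph (Quotient.out q) ∧
      Nat.card (Quotient.out q : Subgroup (P × P)) = n := fun q hq => (Finset.mem_filter.1 hq).2
  -- By `hc` the division is exact: it gives the multiple of the basis element that corrects the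
  -- mark on the diagonal of the table.
  let k : IndecClass (P × P) → ℤ := fun q => (c (Quotient.out q) -
    mark (Quotient.out q) (DBurn.toBurn (f : DBurn P))) /
      mark (Quotient.out q) (cls (P × P) ((P × P) ⧸ Quotient.out q))
  let h : Burn (P × P) := ∑ q ∈ s, k q • cls (P × P) ((P × P) ⧸ Quotient.out q)
  have hmem : DBurn.toBurn.symm h ∈ F.hecke := by
    change _ ∈ F.heckeModule
    simp only [h, map_sum, map_smul]
    refine Submodule.sum_mem _ fun q hq => Submodule.smul_mem _ _ (Submodule.subset_span ?_)
    obtain ⟨⟨Q, φ, hφ, he⟩, -⟩ := hs q hq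
    exact ⟨Q, φ, hφ, by rw [indecElt, he]⟩
  have hmark : ∀ D, mark D (DBurn.toBurn ((f + ⟨_, hmem⟩ : F.hecke) : DBurn P)) =
      mark D (DBurn.toBurn (f : DBurn P)) +
        ∑ q ∈ s, k q • mark D (cls (P × P) ((P × P) ⧸ Quotient.out q)) := by
    intro D
    rw [AddMemClass.coe_add, map_add, map_add, LinearEquiv.apply_symm_apply]
    simp only [h, map_sum, map_smul]
  refine ⟨f + ⟨_, hmem⟩, fun D hD hDn => ?_, fun D hD => ?_⟩
  · have hmk : Quotient.mk (indecSetoid (P × P)) D =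
        Quotient.mk (indecSetoid (P × P)) (Quotient.out (Quotient.mk (indecSetoid (P × P)) D)) :=
      (Quotient.out_eq _).symm
    obtain ⟨g, hg⟩ := exists_conj_of_mk_eq hmk
    rw [← hconj D g hD, ← mark_conj g, hg]
    generalize Quotient.mk (indecSetoid (P × P)) D = q at hg
    have hK : F.IsGraph (Quotient.out q) := hg ▸ (Transport.conj D g).isGraph hD
    have hKn : Nat.card (Quotient.out q : Subgroup (P × P)) = n := by
      rw [← hg, (Transport.conj (F := F) D g).card_eq, hDn]
    rw [hmark, Finset.sum_eq_single q]
    · rw [smul_eq_mul, Int.ediv_mul_cancel (hc _ hK hKn)]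
      ring
    -- Different classes of the same order have zero mark at each other, so the corrections do not
    -- interfere.
    · intro r hr hrq
      rw [smul_eq_zero]
      right
      by_contra hne
      have := mk_eq_of_mark_ne_zero hne (by rw [(hs r hr).2, hKn])
      rw [Quotient.out_eq, Quotient.out_eq] at this
      exact hrq this.symm
    · intro hq
      exact absurd (Finset.mem_filter.2 ⟨Finset.mem_univ _, hK, hKn⟩) hq
  · rw [hmark, Finset.sum_eq_zero, add_zero]
    intro q hq
    rw [smul_eq_zero]
    right
    by_contra hne
    obtain ⟨g, hg⟩ := card_le_of_mark_ne_zero hne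
    have h1 := Subgroup.card_le_of_le hg
    rw [Subgroup.card_map_of_injective (MulAut.conj g).injective, (hs q hq).2] at h1
    omega

theorem IsGraph.card_le {D : Subgroup (P × P)} (hD : F.IsGraph D) : Nat.card D ≤ Nat.card P := by
  obtain ⟨Q, f, hf, hQ⟩ := isGraph_iff_mor.1 hD
  refine Nat.card_le_card_of_injective (fun d : D => d.1.2) fun d d' h => ?_
  have h1 := ((hQ d).1 d.2).2
  have h2 := ((hQ d').1 d'.2).2
  refine Subtype.ext (Prod.ext ?_ h)
  rw [← h1, ← h2]
  exact congrArg f h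

/-- Here D is the graph of an automorphism of P. Dividing an element of N(D) by the element of D
with the same second component leaves some (z, 1), which normalizes D exactly when z is central. So
N(D) is the product of Z(P) × 1 and D, which meet trivially. -/
theorem mark_self_of_card_eq {D : Subgroup (P × P)} (hD : F.IsGraph D)
    (hc : Nat.card D = Nat.card P) :
    mark D (cls (P × P) ((P × P) ⧸ D)) = Nat.card (Subgroup.center P) := by
  obtain ⟨Q, f, hf, hQ⟩ := isGraph_iff_mor.1 hD
  have hinj : Function.Injective (fun d : D => d.1.2) := by
    intro d d' h
    have h1 := ((hQ d).1 d.2).2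
    have h2 := ((hQ d').1 d'.2).2
    refine Subtype.ext (Prod.ext ?_ h)
    rw [← h1, ← h2]
    exact congrArg f h
  have hbij := (Nat.bijective_iff_injective_and_card _).2 ⟨hinj, hc⟩
  have hQt : ∀ x, x ∈ Q := by
    intro x
    obtain ⟨d, rfl⟩ := hbij.2 x
    exact ((hQ d).1 d.2).1
  have hmem : ∀ u, (f u, u) ∈ D := fun u => (hQ (f u, u)).2 ⟨hQt u, rfl⟩
  have hfs : Function.Surjective f := Finite.injective_iff_surjective.1 fun x y h =>
    hf.injOn (hQt x) (hQt y) h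
  have hz : ∀ z : P, (z, (1 : P)) ∈ Subgroup.normalizer (D : Set (P × P)) ↔
      z ∈ Subgroup.center P := by
    intro z
    constructor
    · intro h
      rw [Subgroup.mem_center_iff]
      intro y
      obtain ⟨u, rfl⟩ := hfs y
      have h1 := ((hQ _).1 ((Subgroup.mem_normalizer_iff.1 h _).1 (hmem u))).2
      have h2 : f u = z * f u * z⁻¹ := by simpa using h1
      exact eq_mul_inv_iff_mul_eq.1 h2
    · intro h
      refine Subgroup.mem_normalizer_fintype fun d hd => ?_
      have : (z, (1 : P)) * d * (z, (1 : P))⁻¹ = d := by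
        refine Prod.ext ?_ (by simp)
        change z * d.1 * z⁻¹ = d.1
        rw [← Subgroup.mem_center_iff.1 h d.1, mul_inv_cancel_right]
      rw [this]
      exact hd
  have hN : Nat.card (Subgroup.normalizer (D : Set (P × P))) =
      Nat.card (Subgroup.center P) * Nat.card D := by
    rw [← Nat.card_prod]
    symm
    refine Nat.card_congr (Equiv.ofBijective (fun a => ⟨((a.1 : P), (1 : P)) * a.2,
      mul_mem ((hz _).2 a.1.2) (Subgroup.le_normalizer a.2.2)⟩) ⟨?_, ?_⟩)
    · rintro ⟨z, d⟩ ⟨z', d'⟩ h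
      have h : ((z : P), (1 : P)) * d = ((z' : P), (1 : P)) * d' := congrArg Subtype.val h
      have h2 : d = d' := hinj (by simpa using congrArg Prod.snd h)
      subst h2
      have h3 := congrArg Prod.fst (mul_right_cancel h)
      exact Prod.ext (Subtype.ext h3) rfl
    · rintro ⟨⟨y, x⟩, hn⟩
      have he : ((y * (f x)⁻¹, (1 : P)) : P × P) = (y, x) * (f x, x)⁻¹ := by simp
      have h1 : (y * (f x)⁻¹, (1 : P)) ∈ Subgroup.normalizer (D : Set (P × P)) := by
        rw [he]
        exact mul_mem hn (inv_mem (Subgroup.le_normalizer (hmem x)))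
      refine ⟨⟨⟨_, (hz _).1 h1⟩, ⟨_, hmem x⟩⟩, Subtype.ext ?_⟩
      simp
  have h := card_mul_mark_self D
  rw [hN, Nat.cast_mul, mul_comm] at h
  exact mul_right_cancel₀ (by exact_mod_cast Nat.card_pos.ne') h

/-- There is an element of the Hecke algebra whose marks are invariant under morphisms, and equal
to the order of the center at the graphs of the automorphisms of `P`. -/
theorem exists_hecke_transport {p : ℕ} [Fact p.Prime] (hP : IsPGroup p P) (hF : F.IsFrobenius p) :
    ∃ f : F.hecke, (∀ D D', F.IsGraph D → F.Transport D D' →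
        mark D (DBurn.toBurn (f : DBurn P)) = mark D' (DBurn.toBurn (f : DBurn P))) ∧
      ∀ D, F.IsGraph D → Nat.card D = Nat.card P →
        mark D (DBurn.toBurn (f : DBurn P)) = Nat.card (Subgroup.center P) := by
  obtain ⟨ρ, hρi, hρ, hρc⟩ := exists_representatives (F := F) hP hF
  have key : ∀ m : ℕ, ∃ f : F.hecke, (∀ D D', F.IsGraph D → Nat.card P ≤ Nat.card D + m →
        F.Transport D D' →
        mark D (DBurn.toBurn (f : DBurn P)) = mark D' (DBurn.toBurn (f : DBurn P))) ∧
      ∀ D, F.IsGraph D → Nat.card D = Nat.card P →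
        mark D (DBurn.toBurn (f : DBurn P)) = Nat.card (Subgroup.center P) := by
    intro m
    induction m with
    | zero =>
      -- At the top order the diagonal marks are all |Z(P)|, so this value can be reached from 0.
      obtain ⟨f, hf, -⟩ := exists_hecke_mark_eq (0 : F.hecke) (Nat.card P)
        (fun _ => Nat.card (Subgroup.center P)) (fun D hD hc => by
          rw [mark_self_of_card_eq hD hc]
          simp) (fun _ _ _ => rfl)
      refine ⟨f, fun D D' hD hc hT => ?_, hf⟩
      have hc' := le_antisymm hD.card_le hc
      rw [hf D hD hc', hf D' (hT.isGraph hD) (hT.card_eq.trans hc')]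
    | succ m ih =>
      obtain ⟨f, hf, hfP⟩ := ih
      by_cases hm : Nat.card P ≤ m
      · exact ⟨f, fun D D' hD _ hT => hf D D' hD (by omega) hT, hfP⟩
      obtain ⟨n, hn⟩ : ∃ n, n + (m + 1) = Nat.card P := ⟨Nat.card P - (m + 1), by omega⟩
      have hinv : ∀ D D', F.Transport D D' →
          ρ (D'.map (MonoidHom.snd P P)) = ρ (D.map (MonoidHom.snd P P)) := by
        intro D D' hT
        obtain ⟨b, hb, he⟩ := hT.map_snd
        rw [he, hρi _ _ hb]
      -- The prescribed value is the mark of the old f at the diagonal of the representative; it is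
      -- invariant under transport because ρ is.
      obtain ⟨f', hf1, hf2⟩ := exists_hecke_mark_eq f n
        (fun D => mark (diag (ρ (D.map (MonoidHom.snd P P)))) (DBurn.toBurn (f : DBurn P)))
        (fun D hD hc => mark_self_dvd_sub hF hρ hρc hρi f hD fun E E' hE hlt hT =>
          hf E E' hE (by omega) hT)
        (fun D g hD => by rw [hinv _ _ (Transport.conj D g)])
      refine ⟨f', fun D D' hD hc hT => ?_, fun D hD hc => ?_⟩
      · rcases Nat.lt_or_ge n (Nat.card D) with hlt | hge
        · rw [hf2 D hlt, hf2 D' (by rwa [hT.card_eq]), hf D D' hD (by omega) hT]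
        · have hDn : Nat.card D = n := by omega
          rw [hf1 D hD hDn, hf1 D' (hT.isGraph hD) (hT.card_eq.trans hDn), hinv D D' hT]
      · rw [hf2 D (by omega), hfP D hD hc]
  obtain ⟨f, hf, hfP⟩ := key (Nat.card P)
  exact ⟨f, fun D D' hD hT => hf D D' hD (by omega) hT, hfP⟩

end DivisibleCategory

/-! ### H^F and (B_P)^F in terms of marks; injectivity of evaluation. -/

namespace DivisibleCategory

open Burn

variable {P : Type u} [Group P]

section

variable {F : DivisibleCategory P}

theorem Transport.swap {D D' : Subgroup (P × P)} (h : F.Transport D D') :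
    F.Transport (D.map (MulEquiv.prodComm : P × P ≃* P × P).toMonoidHom)
      (D'.map (MulEquiv.prodComm : P × P ≃* P × P).toMonoidHom) := by
  obtain ⟨A, B, a, b, ha, hb, hAB, hD'⟩ := h
  refine ⟨B, A, b, a, hb, ha, ?_, fun z => ⟨?_, ?_⟩⟩
  · rintro _ ⟨d, hd, rfl⟩
    exact (hAB d hd).symm
  · rintro ⟨z, hz, rfl⟩
    obtain ⟨d, hd, rfl⟩ := (hD' z).1 hz
    exact ⟨_, ⟨d, hd, rfl⟩, rfl⟩
  · rintro ⟨_, ⟨d, hd, rfl⟩, rfl⟩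
    exact ⟨_, (hD' _).2 ⟨d, hd, rfl⟩, rfl⟩

theorem map_fst_eq_map_snd_swap (D : Subgroup (P × P)) : D.map (MonoidHom.fst P P) =
    (D.map (MulEquiv.prodComm : P × P ≃* P × P).toMonoidHom).map (MonoidHom.snd P P) := by
  rw [Subgroup.map_map]
  rfl

/-- The first projection of a transport. -/
theorem Transport.map_fst {D D' : Subgroup (P × P)} (h : F.Transport D D') :
    ∃ a, F.Mor (D.map (MonoidHom.fst P P)) a ∧
      D'.map (MonoidHom.fst P P) = im (D.map (MonoidHom.fst P P)) a := by
  rw [map_fst_eq_map_snd_swap, map_fst_eq_map_snd_swap]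
  exact h.swap.map_snd

theorem transport_prodMap {Q : Subgroup P} {φ : Q →* P} (hφ : F.IsMor φ) (D : Subgroup (Q × P)) :
    F.Transport (D.map (Q.subtype.prodMap (MonoidHom.id P)))
      (D.map (φ.prodMap (MonoidHom.id P))) := by
  refine ⟨Q, ⊤, extFun φ, fun u => u, isMor_iff_mor.1 hφ, Mor.id ⊤, ?_, fun z => ⟨?_, ?_⟩⟩
  · rintro _ ⟨d, -, rfl⟩
    exact ⟨d.1.2, trivial⟩
  · rintro ⟨d, hd, rfl⟩
    exact ⟨_, ⟨d, hd, rfl⟩, Prod.ext (extFun_apply φ d.1) rfl⟩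
  · rintro ⟨_, ⟨d, hd, rfl⟩, rfl⟩
    exact ⟨d, hd, Prod.ext (extFun_apply φ d.1).symm rfl⟩

theorem isGraph_diag (R : Subgroup P) : F.IsGraph (diag R) := ⟨R, _, F.isMor_subtype R, rfl⟩

theorem transport_coGraph {R : Subgroup P} {ψ : R →* P} (hψ : F.IsMor ψ) :
    F.Transport (diag R) (coGraph ψ) := by
  refine ⟨⊤, R, fun u => u, extFun ψ, Mor.id ⊤, isMor_iff_mor.1 hψ, fun d hd =>
    ⟨trivial, (mem_diag.1 hd).1⟩, fun z => ⟨?_, ?_⟩⟩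
  · rintro ⟨u, rfl⟩
    exact ⟨(u, u), mem_diag.2 ⟨u.2, rfl⟩, Prod.ext rfl (extFun_apply ψ u)⟩
  · rintro ⟨⟨d1, d2⟩, hd, rfl⟩
    obtain ⟨h1, h2⟩ := mem_diag.1 hd
    change d2 ∈ R at h1
    change d2 = d1 at h2
    subst h2
    exact ⟨⟨d2, h1⟩, Prod.ext rfl (extFun_apply ψ ⟨d2, h1⟩).symm⟩

/-- In `coGraph` the source is the first factor, so the morphism f of which it is the graph is
inverse to ψ. -/
theorem isMor_of_isGraph_coGraph {R : Subgroup P} {ψ : R →* P} (h : F.IsGraph (coGraph ψ)) :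
    F.IsMor ψ := by
  obtain ⟨Q, f, hf, hQ⟩ := isGraph_iff_mor.1 h
  have hψ : ∀ u : R, ψ u ∈ Q ∧ f (ψ u) = u := fun u => (hQ (u, ψ u)).1 ⟨u, rfl⟩
  obtain ⟨g, hg, hgf⟩ := hf.exists_inverse
  have hR : R ≤ im Q f := fun u hu =>
    hf.mem_im.2 ⟨_, (hψ ⟨u, hu⟩).1, (hψ ⟨u, hu⟩).2⟩
  refine isMor_iff_mor.2 ((hg.mono hR).congr fun u hu => ?_)
  rw [extFun_apply ψ ⟨u, hu⟩, ← hgf _ (hψ ⟨u, hu⟩).1, (hψ ⟨u, hu⟩).2]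

theorem IsGraph.transport_diag {D : Subgroup (P × P)} (hD : F.IsGraph D) :
    F.Transport (diag (D.map (MonoidHom.snd P P))) D := by
  obtain ⟨Q, f, hf, hQ⟩ := isGraph_iff_mor.1 hD
  have hDQ : D.map (MonoidHom.snd P P) = Q := by
    ext u
    constructor
    · rintro ⟨d, hd, rfl⟩
      exact ((hQ d).1 hd).1
    · intro hu
      exact ⟨(f u, u), (hQ _).2 ⟨hu, rfl⟩, rfl⟩
  rw [hDQ]
  refine ⟨Q, ⊤, f, fun u => u, hf, Mor.id ⊤, fun d hd => ?_, fun z => ⟨fun hz => ?_, ?_⟩⟩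
  · obtain ⟨h1, h2⟩ := mem_diag.1 hd
    exact ⟨h2 ▸ h1, trivial⟩
  · obtain ⟨h1, h2⟩ := (hQ z).1 hz
    exact ⟨(z.2, z.2), mem_diag.2 ⟨h1, rfl⟩, Prod.ext h2 rfl⟩
  · rintro ⟨d, hd, rfl⟩
    obtain ⟨h1, h2⟩ := mem_diag.1 hd
    refine (hQ _).2 ⟨h1, ?_⟩
    change f d.2 = f d.1
    rw [h2]

end

variable [Finite P] (F : DivisibleCategory P)

/-- The condition on f lets a morphism move the first coordinate of D without changing the mark; the
condition on f° does the same for the second. A transport by (a, b) is one move after the other. In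
the converse direction subgroups that are not graphs also occur, but there both marks vanish. -/
theorem mem_heckeInv_iff {f : F.hecke} : f ∈ F.heckeInv ↔ ∀ D D', F.IsGraph D → F.Transport D D' →
    mark D (DBurn.toBurn (f : DBurn P)) = mark D' (DBurn.toBurn (f : DBurn P)) := by
  constructor
  · intro hf D D' hD hT
    obtain ⟨A, B, a, b, ha, hb, hAB, hD'⟩ := hT
    obtain ⟨α, hα, hαa⟩ := ha
    obtain ⟨β, hβ, hβb⟩ := hb
    let D₁ : Subgroup (A × P) := D.comap (A.subtype.prodMap (MonoidHom.id P))
    have h1 : D₁.map (A.subtype.prodMap (MonoidHom.id P)) = D := by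
      ext z
      constructor
      · rintro ⟨d, hd, rfl⟩
        exact hd
      · intro hz
        exact ⟨(⟨z.1, (hAB z hz).1⟩, z.2), hz, rfl⟩
    have h2 := congrArg (mark D₁) (hf A α hα).1
    rw [mark_comp_res, mark_comp_res, h1] at h2
    rw [← h2]
    let σ : P × P →* P × P := (MulEquiv.prodComm : P × P ≃* P × P).toMonoidHom
    -- The subgroup obtained after moving the first coordinate, with factors exchanged, so that b
    -- now acts on a first coordinate.
    let D₂ : Subgroup (B × P) := ((D₁.map (α.prodMap (MonoidHom.id P))).map σ).comap
      (B.subtype.prodMap (MonoidHom.id P))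
    have h3 : (D₂.map (B.subtype.prodMap (MonoidHom.id P))).map σ =
        D₁.map (α.prodMap (MonoidHom.id P)) := by
      ext z
      constructor
      · rintro ⟨_, ⟨d, ⟨d', hd', he⟩, rfl⟩, rfl⟩
        change σ (B.subtype.prodMap (MonoidHom.id P) d) ∈ _
        rw [← he]
        exact hd'
      · rintro ⟨d, hd, rfl⟩
        exact ⟨(d.2, α d.1), ⟨(⟨d.2, (hAB _ hd).2⟩, α d.1), ⟨_, ⟨d, hd, rfl⟩, rfl⟩, rfl⟩, rfl⟩
    have h4 : (D₂.map (β.prodMap (MonoidHom.id P))).map σ = D' := by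
      ext z
      rw [hD']
      constructor
      · rintro ⟨_, ⟨d, ⟨_, ⟨d', hd', rfl⟩, he⟩, rfl⟩, rfl⟩
        have he1 : d'.2 = d.1 := congrArg Prod.fst he
        have he2 : α d'.1 = d.2 := congrArg Prod.snd he
        refine ⟨((d'.1 : P), d'.2), hd', Prod.ext ?_ ?_⟩
        · exact ((hαa d'.1).symm).trans he2
        · change b d'.2 = β d.1
          rw [hβb, he1]
      · rintro ⟨d, hd, rfl⟩
        refine ⟨(β ⟨d.2, (hAB _ hd).2⟩, α ⟨d.1, (hAB _ hd).1⟩),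
          ⟨(⟨d.2, (hAB _ hd).2⟩, α ⟨d.1, (hAB _ hd).1⟩),
            ⟨_, ⟨(⟨d.1, (hAB _ hd).1⟩, d.2), hd, rfl⟩, rfl⟩, rfl⟩, ?_⟩
        exact Prod.ext (hαa _) (hβb _)
    have h5 := congrArg (mark D₂) (hf B β hβ).2
    rw [mark_comp_res, mark_comp_res, mark_opp, mark_opp] at h5
    change mark ((D₂.map _).map σ) _ = mark ((D₂.map _).map σ) _ at h5
    rw [h3, h4] at h5
    exact h5.symm
  · intro hf
    have key : ∀ D D', F.Transport D D' →
        mark D' (DBurn.toBurn (f : DBurn P)) = mark D (DBurn.toBurn (f : DBurn P)) := by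
      intro D D' hT
      by_cases hD : F.IsGraph D
      · exact (hf D D' hD hT).symm
      · rw [mark_eq_zero_of_not_isGraph F f hD,
          mark_eq_zero_of_not_isGraph F f fun h => hD (hT.symm.isGraph h)]
    intro Q φ hφ
    refine ⟨ext_mark fun D => ?_, ext_mark fun D => ?_⟩
    · rw [mark_comp_res, mark_comp_res]
      exact key _ _ (transport_prodMap hφ D)
    · rw [mark_comp_res, mark_comp_res, mark_opp, mark_opp]
      exact key _ _ (transport_prodMap hφ D).swap

theorem mem_burnInv_iff {s : Burn P} : s ∈ F.burnInv ↔
    ∀ Q f, F.Mor Q f → mark (im Q f) s = mark Q s := by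
  constructor
  · rintro hs Q f hf
    have hf' := hf
    obtain ⟨φ, hφ, h⟩ := hf'
    have h1 := congrArg (mark ⊤) (hs Q φ hφ)
    rw [mark_act_res, mark_act_res] at h1
    have h2 : (⊤ : Subgroup Q).map φ = im Q f := by
      ext y
      rw [hf.mem_im]
      constructor
      · rintro ⟨u, -, rfl⟩
        exact ⟨u, u.2, (h u).symm⟩
      · rintro ⟨u, hu, rfl⟩
        exact ⟨⟨u, hu⟩, trivial, h _⟩
    have h3 : (⊤ : Subgroup Q).map Q.subtype = Q := by
      rw [← MonoidHom.range_eq_map, Subgroup.range_subtype]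
    rwa [h2, h3] at h1
  · intro hs Q φ hφ
    refine ext_mark fun R => ?_
    rw [mark_act_res, mark_act_res]
    have hm : F.Mor (R.map Q.subtype) (extFun φ) := (isMor_iff_mor.1 hφ).mono (by
      rintro _ ⟨u, -, rfl⟩
      exact u.2)
    have h2 : R.map φ = im (R.map Q.subtype) (extFun φ) := by
      ext y
      rw [hm.mem_im]
      constructor
      · rintro ⟨u, hu, rfl⟩
        exact ⟨u, ⟨u, hu, rfl⟩, extFun_apply φ u⟩
      · rintro ⟨_, ⟨u, hu, rfl⟩, rfl⟩
        exact ⟨u, hu, (extFun_apply φ u).symm⟩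
    rw [h2]
    exact hs _ _ hm

/-- The subalgebra of the elements of the Burnside algebra which are invariant. -/
def burnInvSubalgebra : Subalgebra ℤ (Burn P) where
  carrier := F.burnInv
  mul_mem' {a b} ha hb := (F.mem_burnInv_iff).2 fun Q f hf => by
    rw [mark_mul, mark_mul, (F.mem_burnInv_iff).1 ha Q f hf, (F.mem_burnInv_iff).1 hb Q f hf]
  add_mem' ha hb := F.burnInv.add_mem ha hb
  algebraMap_mem' n := by
    rw [Algebra.algebraMap_eq_smul_one]
    refine F.burnInv.smul_mem n ((F.mem_burnInv_iff).2 fun Q f hf => ?_)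
    rw [mark_one, mark_one]

theorem eval_mul (h k : F.hecke) :
    F.eval (h * k) = act (DBurn.toBurn (h : DBurn P)) (F.eval k) :=
  act_comp (DBurn.toBurn (h : DBurn P)) (DBurn.toBurn (k : DBurn P)) 1

theorem eval_mulHecke_mul (s : Burn P) (k : F.hecke) :
    F.eval (F.mulHecke s * k) = s * F.eval k := by
  rw [eval_mul]
  exact act_mulMap s _

theorem eval_mulHecke (s : Burn P) : F.eval (F.mulHecke s) = s :=
  (act_mulMap s 1).trans (mul_one s)

theorem eval_one : F.eval 1 = 1 := by
  refine ext_mark fun R => ?_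
  change mark R (act (res (MonoidHom.id P)) 1) = _
  rw [mark_act_res, Subgroup.map_id]

theorem eval_mem_burnInv {f : F.hecke} (hf : f ∈ F.heckeInv) : F.eval f ∈ F.burnInv := by
  intro Q φ hφ
  change act (res φ) (act (DBurn.toBurn (f : DBurn P)) 1) =
    act (res Q.subtype) (act (DBurn.toBurn (f : DBurn P)) 1)
  rw [← act_comp, ← act_comp, (hf Q φ hφ).1]

theorem mark_mulHecke_mul (s : Burn P) (f : F.hecke) (D : Subgroup (P × P)) :
    mark D (DBurn.toBurn ((F.mulHecke s * f : F.hecke) : DBurn P)) =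
      mark (D.map (MonoidHom.fst P P)) s * mark D (DBurn.toBurn (f : DBurn P)) :=
  mark_mulMap_comp D s _

theorem mark_mul_mulHecke (s : Burn P) (f : F.hecke) (D : Subgroup (P × P)) :
    mark D (DBurn.toBurn ((f * F.mulHecke s : F.hecke) : DBurn P)) =
      mark (D.map (MonoidHom.snd P P)) s * mark D (DBurn.toBurn (f : DBurn P)) :=
  mark_comp_mulMap D s _

/-- The mark at D is multiplied by the mark of s at the first projection of D, which a transport
replaces by an isomorphic subgroup. -/
theorem mulHecke_mul_mem {s : Burn P} (hs : s ∈ F.burnInv) {f : F.hecke} (hf : f ∈ F.heckeInv) :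
    F.mulHecke s * f ∈ F.heckeInv := by
  rw [mem_heckeInv_iff] at hf ⊢
  intro D D' hD hT
  obtain ⟨a, ha, he⟩ := hT.map_fst
  rw [mark_mulHecke_mul, mark_mulHecke_mul, he, (F.mem_burnInv_iff).1 hs _ _ ha, hf D D' hD hT]

theorem mul_mem_heckeInv {f f' : F.hecke} (hf : f ∈ F.heckeInv) (hf' : f' ∈ F.heckeInv) :
    f * f' ∈ F.heckeInv := by
  rw [mul_eq_mulHecke_eval_mul F f f' hf']
  exact F.mulHecke_mul_mem (F.eval_mem_burnInv hf) hf'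

/-- The two projections of a graph are isomorphic in `F`, so s has the same mark at both; off graphs
the marks of f vanish. Hence the elements m_s are central in the whole Hecke algebra. -/
theorem mul_mulHecke_comm (f : F.hecke) {s : Burn P} (hs : s ∈ F.burnInv) :
    f * F.mulHecke s = F.mulHecke s * f := by
  apply Subtype.ext
  apply DBurn.toBurn.injective
  refine ext_mark fun D => ?_
  rw [mark_mul_mulHecke, mark_mulHecke_mul]
  by_cases hD : F.IsGraph D
  · obtain ⟨a, ha, he⟩ := hD.transport_diag.map_fst
    have h1 : (diag (D.map (MonoidHom.snd P P))).map (MonoidHom.fst P P) =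
        D.map (MonoidHom.snd P P) := by
      ext u
      constructor
      · rintro ⟨d, hd, rfl⟩
        obtain ⟨h1, h2⟩ := mem_diag.1 hd
        change d.1 ∈ _
        rwa [← h2]
      · intro hu
        exact ⟨(u, u), mem_diag.2 ⟨hu, rfl⟩, rfl⟩
    rw [he, (F.mem_burnInv_iff).1 hs _ _ ha, h1]
  · rw [mark_eq_zero_of_not_isGraph F f hD, mul_zero, mul_zero]

instance finite_monoidHom {G H : Type*} [Group G] [Group H] [Finite G] [Finite H] :
    Finite (G →* H) := Finite.of_injective _ DFunLike.coe_injective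

/-- In the sum over all homomorphisms ψ, those in `F` all contribute the mark at the diagonal of R,
by transport, and the others contribute 0. -/
theorem card_mul_mark_eval_of_mem {f : F.hecke} (hf : f ∈ F.heckeInv) (R : Subgroup P) :
    (Nat.card P : ℤ) * mark R (F.eval f) =
      Nat.card {ψ : R →* P // F.IsMor ψ} * mark (diag R) (DBurn.toBurn (f : DBurn P)) := by
  classical
  let _ : Fintype (R →* P) := Fintype.ofFinite _
  rw [card_mul_mark_eval]
  have hterm : ∀ ψ : R →* P, mark (coGraph ψ) (DBurn.toBurn (f : DBurn P)) =
      if F.IsMor ψ then mark (diag R) (DBurn.toBurn (f : DBurn P)) else 0 := by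
    intro ψ
    split_ifs with h
    · exact ((F.mem_heckeInv_iff).1 hf _ _ (isGraph_diag R) (transport_coGraph h)).symm
    · exact mark_eq_zero_of_not_isGraph F f fun h' => h (isMor_of_isGraph_coGraph h')
  rw [Finset.sum_congr rfl fun ψ _ => hterm ψ, ← Finset.sum_filter, Finset.sum_const,
    nsmul_eq_mul, Nat.card_eq_fintype_card, Fintype.card_subtype]

/-- The inclusion of R is a morphism, so the factor |F(P,R)| is nonzero and the marks at diagonals
vanish; every graph is a transport of a diagonal. -/
theorem eq_zero_of_eval_eq_zero {f : F.hecke} (hf : f ∈ F.heckeInv) (h : F.eval f = 0) : f = 0 := by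
  apply Subtype.ext
  apply DBurn.toBurn.injective
  change _ = DBurn.toBurn (0 : DBurn P)
  rw [map_zero]
  refine eq_zero_of_mark fun D => ?_
  by_cases hD : F.IsGraph D
  · rw [← (F.mem_heckeInv_iff).1 hf _ _ (isGraph_diag _) hD.transport_diag]
    have h1 := F.card_mul_mark_eval_of_mem hf (D.map (MonoidHom.snd P P))
    rw [h, map_zero, mul_zero] at h1
    have : Nonempty {ψ : D.map (MonoidHom.snd P P) →* P // F.IsMor ψ} :=
      ⟨⟨_, F.isMor_subtype _⟩⟩
    refine (mul_eq_zero.1 h1.symm).resolve_left ?_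
    exact_mod_cast Nat.card_pos.ne'
  · exact mark_eq_zero_of_not_isGraph F f hD

theorem card_isMor_top : Nat.card {ψ : (⊤ : Subgroup P) →* P // F.IsMor ψ} =
    Nat.card (F.aut ⊤) := by
  symm
  refine Nat.card_congr (Equiv.ofBijective (fun σ => ⟨(⊤ : Subgroup P).subtype.comp
    σ.1.toMonoidHom, isMor_of_hom σ.2⟩) ⟨?_, ?_⟩)
  · intro σ τ h
    have h := congrArg Subtype.val h
    refine Subtype.ext (MulEquiv.ext fun u => Subtype.ext ?_)
    exact DFunLike.congr_fun h u
  · rintro ⟨ψ, hψ⟩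
    obtain ⟨σ, hσ, h⟩ := (isMor_iff_mor.1 hψ).exists_aut fun _ _ => trivial
    refine ⟨⟨σ, hσ⟩, Subtype.ext (MonoidHom.ext fun u => ?_)⟩
    exact (h u).trans (extFun_apply ψ u)

theorem card_conjAut_top : Nat.card (conjAut (⊤ : Subgroup P)) * Nat.card (Subgroup.center P) =
    Nat.card P := by
  let χ : P →* MulAut (⊤ : Subgroup P) :=
    (MulAut.congr (Subgroup.topEquiv (G := P)).symm).toMonoidHom.comp MulAut.conj
  have hr : χ.range = conjAut (⊤ : Subgroup P) := by
    ext σ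
    rw [mem_conjAut]
    constructor
    · rintro ⟨x, rfl⟩
      exact ⟨x, Subgroup.mem_normalizer_fintype fun _ _ => trivial, fun u => rfl⟩
    · rintro ⟨x, -, h⟩
      exact ⟨x, MulEquiv.ext fun u => Subtype.ext (h u).symm⟩
  have hk : χ.ker = Subgroup.center P := by
    ext x
    rw [MonoidHom.mem_ker, Subgroup.mem_center_iff]
    constructor
    · intro h u
      have h1 : x * u * x⁻¹ = u :=
        congrArg Subtype.val (DFunLike.congr_fun h (⟨u, trivial⟩ : (⊤ : Subgroup P)))
      exact (mul_inv_eq_iff_eq_mul.1 h1).symm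
    · intro h
      refine MulEquiv.ext fun u => Subtype.ext ?_
      change x * u * x⁻¹ = u
      rw [← h, mul_inv_cancel_right]
  rw [← hr, ← hk, ← Subgroup.index_ker, Subgroup.index_mul_card]

/-- For the element of `exists_hecke_transport`, |P| times the mark at P is |F(P)| |Z(P)|, while |P|
= |F_P(P)| |Z(P)|. So the mark is |F(P) : F_P(P)|, prime to p by the Sylow axiom. -/
theorem exists_heckeInv_not_dvd {p : ℕ} [hp : Fact p.Prime] (hP : IsPGroup p P)
    (hF : F.IsFrobenius p) : ∃ f ∈ F.heckeInv, ¬ (p : ℤ) ∣ mark ⊤ (F.eval f) := by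
  obtain ⟨f, hf, hfP⟩ := exists_hecke_transport hP hF
  have hf := (F.mem_heckeInv_iff).2 hf
  refine ⟨f, hf, fun hdvd => ?_⟩
  have h := F.card_mul_mark_eval_of_mem hf ⊤
  have hcard : Nat.card (diag (⊤ : Subgroup P)) = Nat.card P := by
    refine Nat.card_congr ⟨fun d => d.1.2, fun u => ⟨(u, u), mem_diag.2 ⟨trivial, rfl⟩⟩,
      fun d => Subtype.ext (Prod.ext (mem_diag.1 d.2).2 rfl), fun _ => rfl⟩
  rw [hfP _ (isGraph_diag ⊤) hcard, card_isMor_top] at h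
  obtain ⟨S, hS⟩ := hF.sylow
  have h1 : Nat.card (F.aut ⊤) = Nat.card (conjAut (⊤ : Subgroup P)) *
      (S : Subgroup (F.aut ⊤)).index := by
    rw [← Subgroup.card_mul_index (S : Subgroup (F.aut ⊤)), hS,
      Nat.card_congr (Subgroup.subgroupOfEquivOfLe (conjAut_le_aut (F := F) ⊤)).toEquiv]
  have h2 : (Nat.card P : ℤ) * mark ⊤ (F.eval f) =
      Nat.card P * ((S : Subgroup (F.aut ⊤)).index : ℤ) := by
    rw [h, h1, ← card_conjAut_top (P := P)]
    push_cast
    ring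
  have h3 := mul_left_cancel₀ (by exact_mod_cast Nat.card_pos.ne') h2
  rw [h3] at hdvd
  exact S.not_dvd_index (by exact_mod_cast hdvd)

/-- There is an element of `H^F` whose evaluation is an integer prime to `p`. -/
theorem exists_heckeInv_eval_eq {p : ℕ} [hp : Fact p.Prime] (hP : IsPGroup p P)
    (hF : F.IsFrobenius p) : ∃ n : ℤ, ¬ (p : ℤ) ∣ n ∧ ∃ f ∈ F.heckeInv, F.eval f = n • 1 := by
  classical
  obtain ⟨f, hf, hdvd⟩ := F.exists_heckeInv_not_dvd hP hF
  have hs := F.eval_mem_burnInv hf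
  let _ : Fintype (Subgroup P) := Fintype.ofFinite _
  -- Marks are ring homomorphisms separating elements, so s = f(1) is a root of q. Writing q = X r +
  -- q(0) gives s r(s) = −q(0), and r(s) is invariant, being a polynomial in s.
  let q : Polynomial ℤ := ∏ K : Subgroup P, (Polynomial.X - Polynomial.C (mark K (F.eval f)))
  have hq : Polynomial.aeval (F.eval f) q = 0 := by
    refine eq_zero_of_mark fun K => ?_
    change (markHom K) _ = 0
    rw [map_prod, map_prod]
    refine Finset.prod_eq_zero (Finset.mem_univ K) ?_
    rw [map_sub, Polynomial.aeval_X, Polynomial.aeval_C, map_sub]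
    change mark K (F.eval f) - markHom K (algebraMap ℤ (Burn P) _) = 0
    rw [eq_intCast, map_intCast, Int.cast_id, sub_self]
  have hmem : Polynomial.aeval (F.eval f) q.divX ∈ F.burnInv :=
    Algebra.adjoin_le (S := F.burnInvSubalgebra) (Set.singleton_subset_iff.2 hs)
      (Polynomial.aeval_mem_adjoin_singleton ℤ (F.eval f))
  have hp' : Prime (p : ℤ) := Nat.prime_iff_prime_int.1 hp.out
  refine ⟨-q.coeff 0, ?_, F.mulHecke (Polynomial.aeval (F.eval f) q.divX) * f,
    F.mulHecke_mul_mem hmem hf, ?_⟩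
  -- Up to sign q(0) is the product of the marks of s. They are all congruent modulo p to the mark
  -- at P, which p does not divide.
  · rw [dvd_neg, Polynomial.coeff_zero_eq_eval_zero, Polynomial.eval_prod, hp'.dvd_finsetProd_iff]
    rintro ⟨K, -, hK⟩
    simp only [Polynomial.eval_sub, Polynomial.eval_X, Polynomial.eval_C, zero_sub, dvd_neg] at hK
    have h1 := mark_modEq_mark_bot hP K (F.eval f)
    have h2 := mark_modEq_mark_bot hP ⊤ (F.eval f)
    have h3 := (dvd_sub_left hK).1 h1
    exact hdvd ((dvd_sub_right h3).1 h2)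
  · rw [eval_mulHecke_mul]
    have h := congrArg (Polynomial.aeval (F.eval f)) (Polynomial.divX_mul_X_add q)
    rw [map_add, map_mul, Polynomial.aeval_X, Polynomial.aeval_C, hq] at h
    rw [eq_neg_of_add_eq_zero_left h, neg_smul, Algebra.algebraMap_eq_smul_one]

end DivisibleCategory

/-! ### Products and sums of base-changed submodules. -/

namespace Submodule

variable {R : Type*} [CommRing R] {M : Type*} [AddCommGroup M] [Module R M]

theorem baseChange_induction {A : Type*} [CommRing A] [Algebra R A] {p : Submodule R M}
    {C : A ⊗[R] M → Prop} (tmul : ∀ (a : A), ∀ m ∈ p, C (a ⊗ₜ m)) (zero : C 0)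
    (add : ∀ x y, C x → C y → C (x + y)) {x : A ⊗[R] M} (hx : x ∈ p.baseChange A) : C x := by
  obtain ⟨y, rfl⟩ := hx
  induction y using TensorProduct.induction_on with
  | zero => rw [map_zero]; exact zero
  | tmul a m => exact tmul a m m.2
  | add y z hy hz => rw [map_add]; exact add _ _ hy hz

theorem baseChange_sup_eq (A : Type*) [CommRing A] [Algebra R A] (p q : Submodule R M) :
    (p ⊔ q).baseChange A = p.baseChange A ⊔ q.baseChange A := by
  refine le_antisymm (fun x hx => ?_) (sup_le (baseChange_mono A le_sup_left)
    (baseChange_mono A le_sup_right))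
  refine baseChange_induction (C := fun x => x ∈ p.baseChange A ⊔ q.baseChange A)
    (fun a m hm => ?_) (zero_mem _) (fun x y => add_mem) hx
  obtain ⟨y, hy, z, hz, rfl⟩ := mem_sup.1 hm
  rw [TensorProduct.tmul_add]
  exact add_mem (mem_sup_left (tmul_mem_baseChange_of_mem a hy))
    (mem_sup_right (tmul_mem_baseChange_of_mem a hz))

theorem mul_mem_baseChange {A H : Type*} [CommRing A] [Algebra R A] [Ring H] [Algebra R H]
    {p q r : Submodule R H} (h : ∀ x ∈ p, ∀ y ∈ q, x * y ∈ r) {x y : A ⊗[R] H}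
    (hx : x ∈ p.baseChange A) (hy : y ∈ q.baseChange A) : x * y ∈ r.baseChange A := by
  refine baseChange_induction (C := fun x => x * y ∈ r.baseChange A) (fun a m hm => ?_)
    (by rw [zero_mul]; exact zero_mem _)
    (fun x x' hx hx' => by rw [add_mul]; exact add_mem hx hx') hx
  refine baseChange_induction (C := fun y => a ⊗ₜ m * y ∈ r.baseChange A) (fun b n hn => ?_)
    (by rw [mul_zero]; exact zero_mem _)
    (fun x x' hx hx' => by rw [mul_add]; exact add_mem hx hx') hy
  rw [Algebra.TensorProduct.tmul_mul_tmul]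
  exact tmul_mem_baseChange_of_mem _ (h m hm n hn)

end Submodule

/-! ### Kernel, H^F and evaluation after localization at p. -/

namespace DivisibleCategory

open Burn Submodule

variable {P : Type u} [Group P] [Finite P] (F : DivisibleCategory P)

theorem mul_mem_kerEval (h : F.hecke) {k : F.hecke} (hk : k ∈ F.kerEval) :
    h * k ∈ F.kerEval := by
  have hk : F.eval k = 0 := hk
  change F.eval (h * k) = 0
  rw [eval_mul, hk, map_zero]

/-- k f = m_{k(1)} f with k(1) = 0. This is why the semidirect product has no term k f'. -/
theorem kerEval_mul_heckeInv {k f : F.hecke} (hk : k ∈ F.kerEval) (hf : f ∈ F.heckeInv) :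
    k * f = 0 := by
  have hk : F.eval k = 0 := hk
  rw [mul_eq_mulHecke_eval_mul F k f hf, hk, map_zero, zero_mul]

theorem eval_mul_of_mem (h : F.hecke) {f : F.hecke} (hf : f ∈ F.heckeInv) :
    F.eval (h * f) = F.eval h * F.eval f := by
  rw [mul_eq_mulHecke_eval_mul F h f hf, eval_mulHecke_mul]

section Localization

variable (p : ℕ) [Fact p.Prime] (Zp : Type v) [CommRing Zp]
  [IsLocalization.AtPrime Zp (Ideal.span {(p : ℤ)})]

theorem isUnit_intCast_of_not_dvd {n : ℤ} (hn : ¬ (p : ℤ) ∣ n) : IsUnit (n : Zp) := by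
  have h := IsLocalization.map_units Zp (M := (Ideal.span {(p : ℤ)}).primeCompl)
    ⟨n, fun h => hn (Ideal.mem_span_singleton.1 h)⟩
  simpa using h

variable {p Zp}

theorem eval_baseChange_mul (x : Zp ⊗[ℤ] F.hecke) {y : Zp ⊗[ℤ] F.hecke}
    (hy : y ∈ F.heckeInv.baseChange Zp) : F.eval.baseChange Zp (x * y) =
      F.eval.baseChange Zp x * F.eval.baseChange Zp y := by
  refine baseChange_induction (C := fun y => F.eval.baseChange Zp (x * y) =
    F.eval.baseChange Zp x * F.eval.baseChange Zp y) (fun b f hf => ?_)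
    (by rw [mul_zero, map_zero, mul_zero])
    (fun y y' hy hy' => by rw [mul_add, map_add, map_add, mul_add, hy, hy']) hy
  induction x using TensorProduct.induction_on with
  | zero => rw [zero_mul, map_zero, zero_mul]
  | add x x' hx hx' => rw [add_mul, map_add, map_add, add_mul, hx, hx']
  | tmul a h =>
    rw [Algebra.TensorProduct.tmul_mul_tmul, LinearMap.baseChange_tmul, LinearMap.baseChange_tmul,
      LinearMap.baseChange_tmul, Algebra.TensorProduct.tmul_mul_tmul, eval_mul_of_mem F h hf]

/-- Injectivity holds on H^F over ℤ and survives a flat base change; the base-changed submodule is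
by definition the image of `Zp ⊗ H^F`. -/
theorem eval_baseChange_injOn [Module.Flat ℤ Zp] :
    Set.InjOn (F.eval.baseChange Zp) (F.heckeInv.baseChange Zp) := by
  rintro _ ⟨y, rfl⟩ _ ⟨z, rfl⟩ h
  have hinj : Function.Injective (F.eval ∘ₗ F.heckeInv.subtype) := by
    rw [← LinearMap.ker_eq_bot, LinearMap.ker_eq_bot']
    intro f hf
    exact Subtype.ext (F.eq_zero_of_eval_eq_zero f.2 hf)
  have hinj' := Module.Flat.lTensor_preserves_injective_linearMap (M := Zp) _ hinj
  rw [LinearMap.lTensor_comp] at hinj'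
  rw [hinj' h]

theorem eval_baseChange_mem {x : Zp ⊗[ℤ] F.hecke} (hx : x ∈ F.heckeInv.baseChange Zp) :
    F.eval.baseChange Zp x ∈ F.burnInv.baseChange Zp := by
  refine baseChange_induction (C := fun x => F.eval.baseChange Zp x ∈ F.burnInv.baseChange Zp)
    (fun a f hf => ?_) (by rw [map_zero]; exact zero_mem _)
    (fun x y hx hy => by rw [map_add]; exact add_mem hx hy) hx
  rw [LinearMap.baseChange_tmul]
  exact tmul_mem_baseChange_of_mem _ (F.eval_mem_burnInv hf)

theorem eval_baseChange_eq_zero {x : Zp ⊗[ℤ] F.hecke} (hx : x ∈ F.kerEval.baseChange Zp) :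
    F.eval.baseChange Zp x = 0 := by
  refine baseChange_induction (C := fun x => F.eval.baseChange Zp x = 0) (fun a f hf => ?_)
    (map_zero _)
    (fun x y hx hy => by rw [map_add, hx, hy, add_zero]) hx
  have hf : F.eval f = 0 := hf
  rw [LinearMap.baseChange_tmul, hf, TensorProduct.tmul_zero]

/-- If `n` is invertible then the base change of a submodule contains any element whose `n`-th
multiple belongs to it. -/
theorem tmul_mem_baseChange_of_zsmul_mem {M : Type*} [AddCommGroup M] {q : Submodule ℤ M} {n : ℤ}
    (hn : IsUnit (n : Zp)) {m : M} (hm : n • m ∈ q) (a : Zp) : a ⊗ₜ[ℤ] m ∈ q.baseChange Zp := by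
  obtain ⟨w, hw⟩ := hn
  have h : a ⊗ₜ[ℤ] m = ((w⁻¹ : Zpˣ) * a) ⊗ₜ[ℤ] (n • m) := by
    rw [TensorProduct.tmul_smul, TensorProduct.smul_tmul', zsmul_eq_mul, ← hw,
      Units.mul_inv_cancel_left]
  rw [h]
  exact tmul_mem_baseChange_of_mem _ hm

/-- As w(1) = n, the elements n m_s and m_s w have the same evaluation n s, and m_s w is in H^F. The
next lemma compares n and w in the same way. -/
theorem mulHecke_mem_sup {n : ℤ} {w : F.hecke} (hw : w ∈ F.heckeInv) (hwn : F.eval w = n • 1)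
    {s : Burn P} (hs : s ∈ F.burnInv) : n • F.mulHecke s ∈ F.kerEval ⊔ F.heckeInv := by
  refine mem_sup.2 ⟨n • F.mulHecke s - F.mulHecke s * w, ?_, F.mulHecke s * w,
    F.mulHecke_mul_mem hs hw, sub_add_cancel _ _⟩
  change F.eval _ = 0
  rw [map_sub, map_smul, eval_mulHecke, eval_mulHecke_mul, hwn, mul_smul_comm, mul_one, sub_self]

theorem one_mem_sup {n : ℤ} {w : F.hecke} (hw : w ∈ F.heckeInv) (hwn : F.eval w = n • 1) :
    n • (1 : F.hecke) ∈ F.kerEval ⊔ F.heckeInv := by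
  refine mem_sup.2 ⟨n • 1 - w, ?_, w, hw, sub_add_cancel _ _⟩
  change F.eval _ = 0
  rw [map_sub, map_smul, eval_one, hwn, sub_self]

theorem exists_eval_baseChange_eq {n : ℤ} (hn : IsUnit (n : Zp)) {w : F.hecke}
    (hw : w ∈ F.heckeInv) (hwn : F.eval w = n • 1) {y : Zp ⊗[ℤ] Burn P}
    (hy : y ∈ F.burnInv.baseChange Zp) :
    ∃ x ∈ F.heckeInv.baseChange Zp, F.eval.baseChange Zp x = y := by
  refine baseChange_induction
    (C := fun y => ∃ x ∈ F.heckeInv.baseChange Zp, F.eval.baseChange Zp x = y)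
    (fun a s hs => ?_) ⟨0, zero_mem _, map_zero _⟩ ?_ hy
  · obtain ⟨v, hv⟩ := hn
    -- The preimage of s is n⁻¹ m_s w.
    refine ⟨((v⁻¹ : Zpˣ) * a) ⊗ₜ (F.mulHecke s * w),
      tmul_mem_baseChange_of_mem _ (F.mulHecke_mul_mem hs hw), ?_⟩
    rw [LinearMap.baseChange_tmul, eval_mulHecke_mul, hwn, mul_smul_comm, mul_one,
      TensorProduct.tmul_smul, TensorProduct.smul_tmul', zsmul_eq_mul, ← hv,
      Units.mul_inv_cancel_left]
  · rintro _ _ ⟨x, hx, rfl⟩ ⟨y, hy, rfl⟩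
    exact ⟨x + y, add_mem hx hy, map_add _ _ _⟩

/-- (k + f)(k' + f') = (k + f)k' + f f': the first term is in the left ideal, the second in H^F. -/
theorem sup_mul_mem {x y : F.hecke} (hx : x ∈ F.kerEval ⊔ F.heckeInv)
    (hy : y ∈ F.kerEval ⊔ F.heckeInv) : x * y ∈ F.kerEval ⊔ F.heckeInv := by
  obtain ⟨k, hk, f, hf, rfl⟩ := mem_sup.1 hx
  obtain ⟨k', hk', f', hf', rfl⟩ := mem_sup.1 hy
  refine mem_sup.2 ⟨(k + f) * k', F.mul_mem_kerEval _ hk', f * f', F.mul_mem_heckeInv hf hf', ?_⟩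
  rw [mul_add, add_mul k f f', F.kerEval_mul_heckeInv hk hf', zero_add]

end Localization

end DivisibleCategory

end

/-! ### Assembly of the localized algebras and isomorphisms. -/

theorem theorem6p6 {P : Type u} [Group P] [Finite P] (p : ℕ) [Fact p.Prime] (hP : IsPGroup p P)
    (Zp : Type v) [CommRing Zp] [IsLocalization.AtPrime Zp (Ideal.span {(p : ℤ)})]
    (F : DivisibleCategory P) (hF : F.IsFrobenius p) :
    ∃ (S : Subalgebra Zp (Zp ⊗[ℤ] F.hecke))
      (K : Ideal (Zp ⊗[ℤ] F.hecke))
      (N : NonUnitalSubalgebra Zp (Zp ⊗[ℤ] F.hecke))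
      (A : Subalgebra Zp (Zp ⊗[ℤ] Burn P)),
      Subalgebra.toSubmodule S = (F.kerEval ⊔ F.heckeInv).baseChange Zp ∧
      K.restrictScalars Zp = F.kerEval.baseChange Zp ∧
      N.toSubmodule = F.heckeInv.baseChange Zp ∧
      Subalgebra.toSubmodule A = F.burnInv.baseChange Zp ∧
      (∀ s ∈ F.burnInv, (1 : Zp) ⊗ₜ[ℤ] F.mulHecke s ∈ S) ∧
      (∃ e : (K × N) ≃ₗ[Zp] S,
        (∀ (k : K) (f : N), (e (k, f) : Zp ⊗[ℤ] F.hecke) = k + f) ∧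
        ∀ (k k' : K) (f f' : N), e (k, f) * e (k', f') =
          e ((k : Zp ⊗[ℤ] F.hecke) • k' + (f : Zp ⊗[ℤ] F.hecke) • k', f * f')) ∧
      (∀ f ∈ F.heckeInv, ∀ s ∈ F.burnInv, f * F.mulHecke s = F.mulHecke s * f) ∧
      ∃ e : N ≃ₗ[Zp] A,
        (∀ f : N, (e f : Zp ⊗[ℤ] Burn P) = F.eval.baseChange Zp f) ∧
        ∀ f f' : N, e (f * f') = e f * e f' := by
  obtain ⟨n, hn, w, hw, hwn⟩ := F.exists_heckeInv_eval_eq hP hF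
  have hflat : Module.Flat ℤ Zp := IsLocalization.flat Zp (Ideal.span {(p : ℤ)}).primeCompl
  have hu : IsUnit (n : Zp) := DivisibleCategory.isUnit_intCast_of_not_dvd p Zp hn
  let S : Subalgebra Zp (Zp ⊗[ℤ] F.hecke) :=
    { carrier := (F.kerEval ⊔ F.heckeInv).baseChange Zp
      add_mem' := add_mem
      mul_mem' := Submodule.mul_mem_baseChange fun _ hx _ hy => F.sup_mul_mem hx hy
      -- Only n · 1 is known to lie in K + H^F over ℤ; the unit does so once n is invertible.
      algebraMap_mem' a :=
        DivisibleCategory.tmul_mem_baseChange_of_zsmul_mem hu (F.one_mem_sup hw hwn) a }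
  let K : Ideal (Zp ⊗[ℤ] F.hecke) :=
    { carrier := F.kerEval.baseChange Zp
      add_mem' := add_mem
      zero_mem' := zero_mem _
      smul_mem' x k hk := Submodule.mul_mem_baseChange (p := ⊤) (q := F.kerEval) (r := F.kerEval)
        (fun h _ _ hk => F.mul_mem_kerEval h hk) (by rw [Submodule.baseChange_top]; trivial) hk }
  let N : NonUnitalSubalgebra Zp (Zp ⊗[ℤ] F.hecke) :=
    { carrier := F.heckeInv.baseChange Zp
      add_mem' := add_mem
      zero_mem' := zero_mem _
      mul_mem' := Submodule.mul_mem_baseChange fun _ hx _ hy => F.mul_mem_heckeInv hx hy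
      smul_mem' a _ hx := Submodule.smul_mem _ a hx }
  let A : Subalgebra Zp (Zp ⊗[ℤ] Burn P) :=
    { carrier := F.burnInv.baseChange Zp
      add_mem' := add_mem
      mul_mem' := Submodule.mul_mem_baseChange fun _ hx _ hy => F.burnInvSubalgebra.mul_mem hx hy
      algebraMap_mem' a := Submodule.tmul_mem_baseChange_of_mem a F.burnInvSubalgebra.one_mem }
  refine ⟨S, K, N, A, rfl, rfl, rfl, rfl, fun s hs =>
    DivisibleCategory.tmul_mem_baseChange_of_zsmul_mem hu (F.mulHecke_mem_sup hw hwn hs) 1, ?_,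
    fun f _ s hs => F.mul_mulHecke_comm f hs, ?_⟩
  · have hmem : ∀ a : K × N, (a.1 : Zp ⊗[ℤ] F.hecke) + a.2 ∈ S := fun a => by
      change _ ∈ (F.kerEval ⊔ F.heckeInv).baseChange Zp
      rw [Submodule.baseChange_sup_eq]
      exact add_mem (Submodule.mem_sup_left a.1.2) (Submodule.mem_sup_right a.2.2)
    let g : (K × N) →ₗ[Zp] S :=
      { toFun a := ⟨a.1 + a.2, hmem a⟩
        map_add' a b := Subtype.ext (add_add_add_comm _ _ _ _)
        map_smul' c a := Subtype.ext (smul_add c (a.1 : Zp ⊗[ℤ] F.hecke) a.2).symm }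
    refine ⟨LinearEquiv.ofBijective g ⟨?_, ?_⟩, fun _ _ => rfl, fun k k' f f' => Subtype.ext ?_⟩
    · rintro ⟨k, f⟩ ⟨k', f'⟩ h
      have h : (k : Zp ⊗[ℤ] F.hecke) + f = k' + f' := congrArg Subtype.val h
      -- Evaluation kills the kernel parts and is injective on the H^F parts, so the sum is direct.
      have h1 := congrArg (F.eval.baseChange Zp) h
      rw [map_add, map_add, F.eval_baseChange_eq_zero k.2, F.eval_baseChange_eq_zero k'.2,
        zero_add, zero_add] at h1
      have h2 := F.eval_baseChange_injOn f.2 f'.2 h1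
      rw [h2] at h
      exact Prod.ext (Subtype.ext (add_right_cancel h)) (Subtype.ext h2)
    · rintro ⟨x, hx⟩
      have hx' : x ∈ (F.kerEval ⊔ F.heckeInv).baseChange Zp := hx
      rw [Submodule.baseChange_sup_eq] at hx'
      obtain ⟨k, hk, f, hf, rfl⟩ := Submodule.mem_sup.1 hx'
      exact ⟨(⟨k, hk⟩, ⟨f, hf⟩), rfl⟩
    · change ((k : Zp ⊗[ℤ] F.hecke) + f) * (k' + f') = k * k' + f * k' + f * f'
      -- The vanishing of k f' passes to the localization as a product landing in the base change of
      -- the zero submodule.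
      have h0 : (k : Zp ⊗[ℤ] F.hecke) * f' ∈ (⊥ : Submodule ℤ F.hecke).baseChange Zp :=
        Submodule.mul_mem_baseChange (fun _ hx _ hy => F.kerEval_mul_heckeInv hx hy) k.2 f'.2
      rw [Submodule.baseChange_bot, Submodule.mem_bot] at h0
      rw [mul_add, add_mul, add_mul, h0, zero_add]
  · let g : N →ₗ[Zp] A :=
      { toFun f := ⟨F.eval.baseChange Zp f, F.eval_baseChange_mem f.2⟩
        map_add' f f' := Subtype.ext (map_add (F.eval.baseChange Zp) f.1 f'.1)
        map_smul' c f := Subtype.ext (map_smul (F.eval.baseChange Zp) c f.1) }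
    refine ⟨LinearEquiv.ofBijective g ⟨?_, ?_⟩, fun _ => rfl, fun f f' => Subtype.ext ?_⟩
    · intro f f' h
      exact Subtype.ext (F.eval_baseChange_injOn f.2 f'.2 (congrArg Subtype.val h))
    · rintro ⟨y, hy⟩
      obtain ⟨x, hx, hxy⟩ := F.exists_eval_baseChange_eq hu hw hwn hy
      exact ⟨⟨x, hx⟩, Subtype.ext hxy⟩
    · exact F.eval_baseChange_mul f.1 f'.2
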